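/- Consider the class of two-dimensional shallow water systems \[ u_t+uu_x+vu_y+h_x=b_x,\qquad v_t+uv_x+vv_y+h_y=b_y,\qquad h_t+(uh)_x+(vh)_y=0, \tag{1} \] where the bottom topography $b=b(x,y)$ runs through the smooth functions on open subsets of $\mathbb R^2$, and the extended system that consists of (1) and the equation $b_t=0$, with $b$ as one more unknown function of $(t,x,y)$. A (local) point transformation is a $C^\infty$ diffeomorphism from a nonempty connected open subset of the space $\mathbb R^7$ with the coordinates $(t,x,y,u,v,h,b)$ onto an open subset of $\mathbb R^7$. It transforms a function $(u,v,h,b)$ of $(t,x,y)$, given on an open set and with graph in its domain, to another such function if it maps the graph of the former onto the graph of the latter. A point symmetry of the extended system is a point transformation that transforms at least one smooth solution (with nonempty domain) of the extended system to a smooth function, and such that each smooth function to which it transforms a smooth solution is again a solution. An equivalence transformation of the class (1) is a point transformation such that for every $b$ there is a $\tilde b$ for which each smooth function to which a solution $(u,v,h)$ of (1) with this $b$, supplemented with $b$, is transformed is a solution of (1) with $\tilde b$, supplemented with $\tilde b$; again at least one such solution has to be transformed to a smooth function. In either case, the continuous transformations are the finite compositions of elements of smooth one-parameter groups (defined on the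 whole of $\mathbb R^7$) of transformations of the kind in question. Theorem. A complete list of discrete point symmetries of the extended system that are independent up to combining with each other and with continuous point symmetries of this system is exhausted by the two involutions \[ d_1\colon(t,x,y,u,v,h,b)\mapsto(-t,x,y,-u,-v,h,b),\qquad d_2\colon(t,x,y,u,v,h,b)\mapsto(t,x,-y,u,-v,h,b). \] That is: $d_1$ and $d_2$ are involutive point symmetries of the extended system; every point symmetry of the extended system coincides on its domain with $C\circ d_1^{\,i}\circ d_2^{\,j}$ for some continuous point symmetry $C$ and some $i,j\in\{0,1\}$; and if, for some $i,j\in\{0,1\}$, the transformation $d_1^{\,i}\circ d_2^{\,j}$ coincides with a continuous point symmetry on some nonempty open set, then $i=j=0$. The same holds for the discrete and continuous equivalence transformations of the class (1) in place of the discrete and continuous point symmetries of the extended system. -/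

import Mathlib

open scoped ContDiff

namespace ShallowWater

/-- The space of the independent variables `(t, x, y)`. -/
abbrev Base : Type := Fin 3 → ℝ

/-- The space of the dependent variables `(u, v, h, b)`. -/
abbrev Fibre : Type := Fin 4 → ℝ

/-- The space with the coordinates `(t, x, y, u, v, h, b)`. -/
abbrev Total : Type := Base × Fibre

/-- The partial derivative of `f` with respect to the `j`-th of the variables `(t, x, y)`. -/
noncomputable def pd (f : Base → ℝ) (j : Fin 3) (z : Base) : ℝ :=
  fderiv ℝ f z (Pi.single j 1)

/-- The two-dimensional shallow water equations with bottom topography `b` at the point `z`. -/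
def ShallowWaterAt (u v h b : Base → ℝ) (z : Base) : Prop :=
  pd u 0 z + u z * pd u 1 z + v z * pd u 2 z + pd h 1 z = pd b 1 z ∧
  pd v 0 z + u z * pd v 1 z + v z * pd v 2 z + pd h 2 z = pd b 2 z ∧
  pd h 0 z + pd (fun z' => u z' * h z') 1 z + pd (fun z' => v z' * h z') 2 z = 0

/-- `w = (u, v, h, b)` is a smooth solution, on the open set `Ω`, of the extended system: the
shallow water equations together with `b_t = 0`, where `b` is one more unknown function. -/
structure IsSolution (Ω : Set Base) (w : Base → Fibre) : Prop where
  isOpen : IsOpen Ω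
  smooth : ContDiffOn ℝ ∞ w Ω
  shallowWater : ∀ z ∈ Ω, ShallowWaterAt (fun z' => w z' 0) (fun z' => w z' 1)
    (fun z' => w z' 2) (fun z' => w z' 3) z
  steady : ∀ z ∈ Ω, pd (fun z' => w z' 3) 0 z = 0

/-- `w = (u, v, h, b)`, where `(u, v, h)` is a smooth solution on the open set `Ω` of the system
with the fixed bottom topography `b = β(x, y)`, `(x, y) ∈ D`. -/
structure IsSolutionOver (D : Set (ℝ × ℝ)) (β : ℝ × ℝ → ℝ) (Ω : Set Base) (w : Base → Fibre) :
    Prop where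
  isOpen : IsOpen Ω
  smooth : ContDiffOn ℝ ∞ w Ω
  mem_domain : ∀ z ∈ Ω, (z 1, z 2) ∈ D
  bottom : ∀ z ∈ Ω, w z 3 = β (z 1, z 2)
  shallowWater : ∀ z ∈ Ω, ShallowWaterAt (fun z' => w z' 0) (fun z' => w z' 1)
    (fun z' => w z' 2) (fun z' => β (z' 1, z' 2)) z

/-- The graph of `w` over `Ω`. -/
def graphOver (Ω : Set Base) (w : Base → Fibre) : Set Total :=
  (fun z => (z, w z)) '' Ω

/-- A (local) point transformation of the space of `(t, x, y, u, v, h, b)`: a diffeomorphism from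
a nonempty connected open set onto an open set. -/
structure IsPointTransformation (Φ : OpenPartialHomeomorph Total Total) : Prop where
  connected : IsConnected Φ.source
  smooth : ContDiffOn ℝ ∞ Φ Φ.source
  smooth_symm : ContDiffOn ℝ ∞ Φ.symm Φ.target

/-- `Φ` transforms the function `w` on `Ω` to the smooth function `w'` on the open set `Ω'`. -/
structure TransformsTo (Φ : OpenPartialHomeomorph Total Total)
    (Ω : Set Base) (w : Base → Fibre) (Ω' : Set Base) (w' : Base → Fibre) : Prop where
  graph_subset : graphOver Ω w ⊆ Φ.source
  isOpen : IsOpen Ω'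
  smooth : ContDiffOn ℝ ∞ w' Ω'
  graph_eq : graphOver Ω' w' = Φ '' graphOver Ω w

/-- Point symmetries of the extended system: point transformations that map solutions to
solutions. The graph of a solution need not be mapped to a graph, but this has to happen for at
least one solution; otherwise `maps_solutions` would be void, as it is for the permutation of the
coordinates `t` and `b`, which turns the graph of no solution into a graph. -/
structure IsPointSymmetry (Φ : OpenPartialHomeomorph Total Total) : Prop where
  pointTransformation : IsPointTransformation Φ
  nondegenerate : ∃ (Ω : Set Base) (w : Base → Fibre) (Ω' : Set Base) (w' : Base → Fibre),
    Ω.Nonempty ∧ IsSolution Ω w ∧ TransformsTo Φ Ω w Ω' w'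
  maps_solutions : ∀ (Ω : Set Base) (w : Base → Fibre) (Ω' : Set Base) (w' : Base → Fibre),
    IsSolution Ω w → TransformsTo Φ Ω w Ω' w' → IsSolution Ω' w'

/-- Equivalence transformations of the class of shallow water systems with arbitrary bottom
topography `b = b(x, y)` (generalized ones: all components may depend on `b`): point
transformations of the space of `(t, x, y, u, v, h, b)` that map every system of the class to a
system of the class. -/
structure IsEquivalenceTransformation (Φ : OpenPartialHomeomorph Total Total) : Prop where
  pointTransformation : IsPointTransformation Φ
  nondegenerate : ∃ (D : Set (ℝ × ℝ)) (β : ℝ × ℝ → ℝ)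
    (Ω : Set Base) (w : Base → Fibre) (Ω' : Set Base) (w' : Base → Fibre),
    IsOpen D ∧ ContDiffOn ℝ ∞ β D ∧
    Ω.Nonempty ∧ IsSolutionOver D β Ω w ∧ TransformsTo Φ Ω w Ω' w'
  maps_systems : ∀ (D : Set (ℝ × ℝ)) (β : ℝ × ℝ → ℝ), IsOpen D → ContDiffOn ℝ ∞ β D →
    ∃ (D' : Set (ℝ × ℝ)) (β' : ℝ × ℝ → ℝ), IsOpen D' ∧ ContDiffOn ℝ ∞ β' D' ∧
      ∀ (Ω : Set Base) (w : Base → Fibre) (Ω' : Set Base) (w' : Base → Fibre),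
        IsSolutionOver D β Ω w → TransformsTo Φ Ω w Ω' w' → IsSolutionOver D' β' Ω' w'

/-- One-parameter groups of transformations from the collection `S`. -/
structure IsOneParameterGroup (S : OpenPartialHomeomorph Total Total → Prop)
    (Ψ : ℝ → Total ≃ₜ Total) : Prop where
  map_add : ∀ s r : ℝ, Ψ (s + r) = Ψ s * Ψ r
  smooth : ContDiff ℝ ∞ (fun q : ℝ × Total => Ψ q.1 q.2)
  mem : ∀ s : ℝ, S (Ψ s).toOpenPartialHomeomorph

/-- The continuous transformations in `S`: finite compositions of elements of one-parameter groups
of transformations from `S`. -/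
def continuousPart (S : OpenPartialHomeomorph Total Total → Prop) : Subgroup (Total ≃ₜ Total) :=
  Subgroup.closure {C | ∃ (Ψ : ℝ → Total ≃ₜ Total) (s : ℝ), IsOneParameterGroup S Ψ ∧ C = Ψ s}

/-- `(t, x, y, u, v, h, b) ↦ (-t, x, y, -u, -v, h, b)`. -/
def timeReversal : Total ≃ₜ Total where
  toFun p := (![-p.1 0, p.1 1, p.1 2], ![-p.2 0, -p.2 1, p.2 2, p.2 3])
  invFun p := (![-p.1 0, p.1 1, p.1 2], ![-p.2 0, -p.2 1, p.2 2, p.2 3])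
  left_inv p := by
    ext i <;> fin_cases i <;> simp
  right_inv p := by
    ext i <;> fin_cases i <;> simp
  continuous_toFun := by fun_prop
  continuous_invFun := by fun_prop

/-- `(t, x, y, u, v, h, b) ↦ (t, x, -y, u, -v, h, b)`. -/
def reflection : Total ≃ₜ Total where
  toFun p := (![p.1 0, p.1 1, -p.1 2], ![p.2 0, -p.2 1, p.2 2, p.2 3])
  invFun p := (![p.1 0, p.1 1, -p.1 2], ![p.2 0, -p.2 1, p.2 2, p.2 3])
  left_inv p := by
    ext i <;> fin_cases i <;> simp
  right_inv p := by
    ext i <;> fin_cases i <;> simp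
  continuous_toFun := by fun_prop
  continuous_invFun := by fun_prop

/-- Two involutions `d₁`, `d₂` form a complete list of discrete transformations in `S` that are
independent up to combining with each other and with continuous transformations in `S`. -/
structure IsCompleteDiscreteList (S : OpenPartialHomeomorph Total Total → Prop)
    (d₁ d₂ : Total ≃ₜ Total) : Prop where
  mem_left : S d₁.toOpenPartialHomeomorph
  mem_right : S d₂.toOpenPartialHomeomorph
  involution_left : d₁ * d₁ = 1
  involution_right : d₂ * d₂ = 1
  exhaustive : ∀ Φ : OpenPartialHomeomorph Total Total, S Φ →
    ∃ C ∈ continuousPart S, ∃ i j : Fin 2,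
      Set.EqOn Φ (C * d₁ ^ (i : ℕ) * d₂ ^ (j : ℕ) : Total ≃ₜ Total) Φ.source
  independent : ∀ C ∈ continuousPart S, ∀ (i j : Fin 2) (U : Set Total), IsOpen U → U.Nonempty →
    Set.EqOn (d₁ ^ (i : ℕ) * d₂ ^ (j : ℕ) : Total ≃ₜ Total) C U → i = 0 ∧ j = 0

end ShallowWater

/-! The shifts in `t`, `x`, `y`, `b`, the independent scalings of time and of the plane and the
rotations, combined with `d₁` and `d₂`, make up the group of `Similarity` maps. The core is
`IsPointSymmetry.exists_similarity`: every local point symmetry is the restriction of a similarity.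

At a point with the fibre value `w` the derivatives of solutions form a linear space, each element
of which is realised by a solution with velocity affine in `(x, y)` (`exists_solution_of_isJet`). So
a point symmetry carries such derivatives to such derivatives wherever the image is transversal
(`IsPointSymmetry.exists_jet`), and with them the characteristic covectors. With `σ` the value of a
covector `(τ, ξ)` on the particle direction `(1, u, v)`, these satisfy `τ σ (σ² - h |ξ|²) = 0`. A
plane on which this product vanishes annihilates the time axis or the particle direction, so the
symmetry maps these two lines to the corresponding two lines, possibly swapped
(`MapsJets.mem_line`). Varying the derivatives of the solution shows that the new `t`, `x`, `y` do
not depend on `u`, `v`, `h`; differentiation in `u`, `v` then excludes the swap and the dependence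
on `b` (`horizontal_of_general`).

The rest is comparison of coefficients in the transformed equations: the new time depends on `t`
only, the plane map is conformal, `H` and `B` scale like the squared velocity, and the terms
quadratic in the velocity force the plane map to be affine (`IsFibered.dT`, `IsFibered.conformal`,
`IsFibered.height`, `IsFibered.affine`). Connectedness of the domain makes the local similarity
global.

An equivalence transformation is a point symmetry, because locally the bottom of a solution of the
extended system is a function of `(x, y)`. The signs of time scaling and plane orientation are
invariants: an element of a one-parameter group is the square of its half-time element, so both are
positive on the continuous part, while `d₁` and `d₂` flip one each. -/

namespace ShallowWater

open Set Filter Topology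

/-! ### First derivatives of solutions at a point. -/

/-- The coordinate vectors of the space of `(t, x, y)`. -/
noncomputable abbrev eb (j : Fin 3) : Base := Pi.single j 1

/-- The coordinate vectors of the space of `(u, v, h, b)`. -/
noncomputable abbrev ef (i : Fin 4) : Fibre := Pi.single i 1

/-- The linear equations which the extended system imposes on the derivative `P` of a solution at
a point where it takes the value `w`. -/
def IsJet (w : Fibre) (P : Base →L[ℝ] Fibre) : Prop :=
  P (eb 0) 0 + w 0 * P (eb 1) 0 + w 1 * P (eb 2) 0 + P (eb 1) 2 = P (eb 1) 3 ∧
  P (eb 0) 1 + w 0 * P (eb 1) 1 + w 1 * P (eb 2) 1 + P (eb 2) 2 = P (eb 2) 3 ∧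
  P (eb 0) 2 + w 0 * P (eb 1) 2 + w 1 * P (eb 2) 2 + w 2 * (P (eb 1) 0 + P (eb 2) 1) = 0 ∧
  P (eb 0) 3 = 0

lemma pd_component {w : Base → Fibre} {z : Base} (hw : DifferentiableAt ℝ w z) (i : Fin 4)
    (j : Fin 3) : pd (fun z' => w z' i) j z = fderiv ℝ w z (eb j) i := by
  have h : HasFDerivAt (fun z' => w z' i) ((ContinuousLinearMap.proj i).comp (fderiv ℝ w z)) z :=
    (ContinuousLinearMap.proj (R := ℝ) (φ := fun _ : Fin 4 => ℝ) i).hasFDerivAt.comp z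
      hw.hasFDerivAt
  rw [pd, h.fderiv]; rfl

lemma pd_component_mul {w : Base → Fibre} {z : Base} (hw : DifferentiableAt ℝ w z) (i k : Fin 4)
    (j : Fin 3) : pd (fun z' => w z' i * w z' k) j z =
      w z i * fderiv ℝ w z (eb j) k + w z k * fderiv ℝ w z (eb j) i := by
  have h (i : Fin 4) : DifferentiableAt ℝ (fun z' => w z' i) z := by fun_prop
  rw [pd, fderiv_fun_mul (h i) (h k), ← pd_component hw k j, ← pd_component hw i j]
  rfl

lemma shallowWaterAt_iff {w : Base → Fibre} {z : Base} (hw : DifferentiableAt ℝ w z) :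
    (ShallowWaterAt (fun z' => w z' 0) (fun z' => w z' 1) (fun z' => w z' 2) (fun z' => w z' 3) z ∧
      pd (fun z' => w z' 3) 0 z = 0) ↔ IsJet (w z) (fderiv ℝ w z) := by
  simp only [ShallowWaterAt, IsJet, pd_component hw, pd_component_mul hw, and_assoc]
  refine and_congr_right fun _ => and_congr_right fun _ => and_congr_left fun _ => ?_
  constructor <;> intro h <;> linarith

lemma isSolution_iff {Ω : Set Base} {w : Base → Fibre} :
    IsSolution Ω w ↔ IsOpen Ω ∧ ContDiffOn ℝ ∞ w Ω ∧ ∀ z ∈ Ω, IsJet (w z) (fderiv ℝ w z) := by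
  have key (hΩ : IsOpen Ω) (hw : ContDiffOn ℝ ∞ w Ω) (z : Base) (hz : z ∈ Ω) :
      DifferentiableAt ℝ w z :=
    (hw.contDiffAt (hΩ.mem_nhds hz)).differentiableAt (by simp)
  constructor
  · rintro ⟨h1, h2, h3, h4⟩
    exact ⟨h1, h2, fun z hz => (shallowWaterAt_iff (key h1 h2 z hz)).1 ⟨h3 z hz, h4 z hz⟩⟩
  · rintro ⟨h1, h2, h3⟩
    exact ⟨h1, h2, fun z hz => ((shallowWaterAt_iff (key h1 h2 z hz)).2 (h3 z hz)).1,
      fun z hz => ((shallowWaterAt_iff (key h1 h2 z hz)).2 (h3 z hz)).2⟩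

/-- The linear map with the columns `c₀`, `c₁`, `c₂`. -/
noncomputable def ofColumns (c₀ c₁ c₂ : Fibre) : Base →L[ℝ] Fibre :=
  (ContinuousLinearMap.proj 0).smulRight c₀ + (ContinuousLinearMap.proj 1).smulRight c₁ +
    (ContinuousLinearMap.proj 2).smulRight c₂

lemma ofColumns_apply (c₀ c₁ c₂ : Fibre) (ζ : Base) :
    ofColumns c₀ c₁ c₂ ζ = ζ 0 • c₀ + ζ 1 • c₁ + ζ 2 • c₂ := by
  simp [ofColumns]

lemma ofColumns_eta (P : Base →L[ℝ] Fibre) : ofColumns (P (eb 0)) (P (eb 1)) (P (eb 2)) = P := by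
  ext ζ i
  have : ζ = ζ 0 • eb 0 + ζ 1 • eb 1 + ζ 2 • eb 2 := by
    ext j; fin_cases j <;> simp
  conv_rhs => rw [this]
  simp [ofColumns_apply]

/-- The derivative in the direction of `t` which the equations associate with the derivatives `cx`
and `cy` in the directions of `x` and `y`. -/
noncomputable def timeColumn (w cx cy : Fibre) : Fibre :=
  ![cx 3 - cx 2 - w 0 * cx 0 - w 1 * cy 0, cy 3 - cy 2 - w 0 * cx 1 - w 1 * cy 1,
    -(w 0 * cx 2) - w 1 * cy 2 - w 2 * (cx 0 + cy 1), 0]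

/-- The parametrisation of the solutions of the linear equations for the derivative. -/
noncomputable def jet (w cx cy : Fibre) : Base →L[ℝ] Fibre := ofColumns (timeColumn w cx cy) cx cy

lemma jet_apply (w cx cy : Fibre) (ζ : Base) :
    jet w cx cy ζ = ζ 0 • timeColumn w cx cy + ζ 1 • cx + ζ 2 • cy := ofColumns_apply ..

@[simp] lemma jet_eb_zero (w cx cy : Fibre) : jet w cx cy (eb 0) = timeColumn w cx cy := by
  simp [jet_apply]

@[simp] lemma jet_eb_one (w cx cy : Fibre) : jet w cx cy (eb 1) = cx := by
  simp [jet_apply]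

@[simp] lemma jet_eb_two (w cx cy : Fibre) : jet w cx cy (eb 2) = cy := by
  simp [jet_apply]

lemma isJet_jet (w cx cy : Fibre) : IsJet w (jet w cx cy) := by
  simp only [IsJet, jet_eb_zero, jet_eb_one, jet_eb_two, timeColumn]
  simp
  refine ⟨?_, ?_, ?_⟩ <;> ring

lemma IsJet.eq_jet {w : Fibre} {P : Base →L[ℝ] Fibre} (h : IsJet w P) :
    jet w (P (eb 1)) (P (eb 2)) = P := by
  rw [jet]
  conv_rhs => rw [← ofColumns_eta P]
  congr 1
  obtain ⟨h0, h1, h2, h3⟩ := h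
  ext i
  fin_cases i <;> simp [timeColumn] <;> linarith

/-- Since `b` is an unknown, its gradient is not an inhomogeneity: the conditions are linear in `P`,
and derivatives at a fixed point can be varied along lines. -/
lemma IsJet.add_smul {w : Fibre} {P R : Base →L[ℝ] Fibre} (hP : IsJet w P) (hR : IsJet w R)
    (s : ℝ) : IsJet w (P + s • R) := by
  obtain ⟨a0, a1, a2, a3⟩ := hP
  obtain ⟨b0, b1, b2, b3⟩ := hR
  refine ⟨?_, ?_, ?_, ?_⟩ <;> simp
  · linear_combination a0 + s * b0
  · linear_combination a1 + s * b1
  · linear_combination a2 + s * b2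
  · linear_combination a3 + s * b3

/-! ### Realisation of prescribed derivatives by solutions. -/

/-- A solution of a smooth autonomous differential equation with a prescribed initial value. -/
lemma exists_smooth_integralCurve {E : Type*} [NormedAddCommGroup E] [NormedSpace ℝ E]
    [CompleteSpace E] {f : E → E} (hf : ContDiff ℝ ∞ f) (t₀ : ℝ) (x₀ : E) :
    ∃ α : ℝ → E, α t₀ = x₀ ∧ ∃ ε > (0 : ℝ), ContDiffOn ℝ ∞ α (Ioo (t₀ - ε) (t₀ + ε)) ∧
      ∀ t ∈ Ioo (t₀ - ε) (t₀ + ε), HasDerivAt α (f (α t)) t := by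
  obtain ⟨α, h0, ε, hε, h⟩ :=
    ContDiffAt.exists_forall_mem_closedBall_exists_eq_forall_mem_Ioo_hasDerivAt₀
      (f := f) (x₀ := x₀) (hf.contDiffAt.of_le (by simp)) t₀
  -- The regularity theorem for integral curves is stated on closed intervals, hence the halved
  -- radius.
  have hsub : Icc (t₀ - ε / 2) (t₀ + ε / 2) ⊆ Ioo (t₀ - ε) (t₀ + ε) :=
    fun t ht => ⟨by linarith [ht.1], by linarith [ht.2]⟩
  refine ⟨α, h0, ε / 2, by positivity, ?_, fun t ht => h t (hsub (Ioo_subset_Icc_self ht))⟩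
  refine (ODE.contDiffOn_enat_Icc_of_hasDerivWithinAt (f := fun _ => f) (u := univ) (n := ⊤) ?_
    (fun t ht => (h t (hsub ht)).hasDerivWithinAt) (mapsTo_univ _ _)).mono Ioo_subset_Icc_self
  exact (hf.comp contDiff_snd).contDiffOn

/-- The vector field of the differential equations for the coefficients of a solution with a
velocity that is affine in `(x, y)` over a bottom with the gradient `(β₁, β₂)`. -/
noncomputable def affineField (β₁ β₂ : ℝ) (f : Fin 9 → ℝ) : Fin 9 → ℝ :=
  ![-(f 0 * f 0 + f 2 * f 1), -(f 1 * f 0 + f 3 * f 1), -(f 0 * f 2 + f 2 * f 3),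
    -(f 1 * f 2 + f 3 * f 3), β₁ - f 6 - f 4 * f 0 - f 5 * f 1, β₂ - f 7 - f 4 * f 2 - f 5 * f 3,
    -(f 0 * f 6 + f 2 * f 7 + (f 0 + f 3) * f 6), -(f 1 * f 6 + f 3 * f 7 + (f 0 + f 3) * f 7),
    -(f 4 * f 6 + f 5 * f 7 + (f 0 + f 3) * f 8)]

lemma contDiff_affineField (β₁ β₂ : ℝ) : ContDiff ℝ ∞ (affineField β₁ β₂) := by
  rw [contDiff_pi]
  intro i
  fin_cases i <;> simp [affineField] <;> fun_prop

lemma hasFDerivAt_affine {a b c : ℝ → ℝ} {a' b' c' : ℝ} {z : Base} (x₀ y₀ : ℝ)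
    (ha : HasDerivAt a a' (z 0)) (hb : HasDerivAt b b' (z 0)) (hc : HasDerivAt c c' (z 0)) :
    HasFDerivAt (fun z : Base => a (z 0) * (z 1 - x₀) + b (z 0) * (z 2 - y₀) + c (z 0))
      ((a' * (z 1 - x₀) + b' * (z 2 - y₀) + c') • ContinuousLinearMap.proj (R := ℝ) 0 +
        a (z 0) • ContinuousLinearMap.proj (R := ℝ) 1 + 
        b (z 0) • ContinuousLinearMap.proj (R := ℝ) 2 : Base →L[ℝ] ℝ) z := by
  have p (j : Fin 3) : HasFDerivAt (fun z : Base => z j)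
      (ContinuousLinearMap.proj (R := ℝ) (φ := fun _ : Fin 3 => ℝ) j) z :=
    (ContinuousLinearMap.proj (R := ℝ) (φ := fun _ : Fin 3 => ℝ) j).hasFDerivAt
  have h := (((ha.comp_hasFDerivAt z (p 0)).mul ((p 1).sub_const x₀)).add
    ((hb.comp_hasFDerivAt z (p 0)).mul ((p 2).sub_const y₀))).add (hc.comp_hasFDerivAt z (p 0))
  refine h.congr_fderiv ?_
  ext ζ
  simp
  ring

/-- Every solution of the linear equations for the derivative is the derivative of a solution. -/
lemma exists_solution_of_isJet (z : Base) (w₀ : Fibre) (P : Base →L[ℝ] Fibre) (hP : IsJet w₀ P) :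
    ∃ (Ω : Set Base) (w : Base → Fibre), z ∈ Ω ∧ IsSolution Ω w ∧ w z = w₀ ∧ HasFDerivAt w P z := by
  obtain ⟨f, f0, ε, hε, fs, hf⟩ := exists_smooth_integralCurve
    (contDiff_affineField (P (eb 1) 3) (P (eb 2) 3)) (z 0)
    ![P (eb 1) 0, P (eb 2) 0, P (eb 1) 1, P (eb 2) 1, w₀ 0, w₀ 1, P (eb 1) 2, P (eb 2) 2, w₀ 2]
  set β₁ := P (eb 1) 3
  set β₂ := P (eb 2) 3
  set Ω : Set Base := {z' | z' 0 ∈ Ioo (z 0 - ε) (z 0 + ε)} with hΩ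
  have hΩo : IsOpen Ω := isOpen_Ioo.preimage (continuous_apply 0)
  -- The entries of `f` are the velocity gradient (0 to 3), the velocity at the base point (4, 5),
  -- the gradient of `h` (6, 7) and its value there (8). The bottom is affine with a fixed gradient,
  -- so the equations close on these nine functions of `t`.
  set w : Base → Fibre := fun z' =>
    ![f (z' 0) 0 * (z' 1 - z 1) + f (z' 0) 1 * (z' 2 - z 2) + f (z' 0) 4,
      f (z' 0) 2 * (z' 1 - z 1) + f (z' 0) 3 * (z' 2 - z 2) + f (z' 0) 5,
      f (z' 0) 6 * (z' 1 - z 1) + f (z' 0) 7 * (z' 2 - z 2) + f (z' 0) 8,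
      β₁ * (z' 1 - z 1) + β₂ * (z' 2 - z 2) + w₀ 3] with hw
  have hfi (i : Fin 9) (z' : Base) (h : z' ∈ Ω) :
      HasDerivAt (fun t => f t i) (affineField β₁ β₂ (f (z' 0)) i) (z' 0) :=
    (hasDerivAt_pi.1 (hf _ h)) i
  have hj (z' : Base) (h : z' ∈ Ω) : HasFDerivAt w (jet (w z')
      ![f (z' 0) 0, f (z' 0) 2, f (z' 0) 6, β₁] ![f (z' 0) 1, f (z' 0) 3, f (z' 0) 7, β₂]) z' := by
    rw [hasFDerivAt_pi']
    intro i
    fin_cases i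
    · refine (hasFDerivAt_affine (z 1) (z 2) (hfi 0 z' h) (hfi 1 z' h) (hfi 4 z' h)).congr_fderiv ?_
      ext ζ
      simp [jet_apply, timeColumn, hw, affineField]
      ring
    · refine (hasFDerivAt_affine (z 1) (z 2) (hfi 2 z' h) (hfi 3 z' h) (hfi 5 z' h)).congr_fderiv ?_
      ext ζ
      simp [jet_apply, timeColumn, hw, affineField]
      ring
    · refine (hasFDerivAt_affine (z 1) (z 2) (hfi 6 z' h) (hfi 7 z' h) (hfi 8 z' h)).congr_fderiv ?_
      ext ζ
      simp [jet_apply, timeColumn, hw, affineField]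
      ring
    · refine (hasFDerivAt_affine (z 1) (z 2) (hasDerivAt_const (z' 0) β₁)
        (hasDerivAt_const (z' 0) β₂) (hasDerivAt_const (z' 0) (w₀ 3))).congr_fderiv ?_
      ext ζ
      simp [jet_apply, timeColumn, hw]
      ring
  have hz : z ∈ Ω := ⟨by linarith, by linarith⟩
  have hwz : w z = w₀ := by
    ext i
    fin_cases i <;> simp [hw, f0]
  refine ⟨Ω, w, hz, isSolution_iff.2 ⟨hΩo, ?_, fun z' h => ?_⟩, hwz, ?_⟩
  · have fsi (i : Fin 9) : ContDiffOn ℝ ∞ (fun z' : Base => f (z' 0) i) Ω := by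
      have h1 : ContDiffOn ℝ ∞ (fun t => f t i) (Ioo (z 0 - ε) (z 0 + ε)) := contDiffOn_pi.1 fs i
      exact h1.comp (contDiff_apply ℝ ℝ (0 : Fin 3)).contDiffOn fun z' h => h
    have cs (i : Fin 3) (c : ℝ) : ContDiffOn ℝ ∞ (fun z' : Base => z' i - c) Ω := by fun_prop
    have key (i j k : Fin 9) : ContDiffOn ℝ ∞ (fun z' : Base =>
      f (z' 0) i * (z' 1 - z 1) + f (z' 0) j * (z' 2 - z 2) + f (z' 0) k) Ω :=
      (((fsi i).mul (cs 1 _)).add ((fsi j).mul (cs 2 _))).add (fsi k)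
    rw [contDiffOn_pi]
    intro i
    fin_cases i
    · exact key 0 1 4
    · exact key 2 3 5
    · exact key 6 7 8
    · exact ((contDiffOn_const.mul (cs 1 _)).add (contDiffOn_const.mul (cs 2 _))).add
        contDiffOn_const
  · rw [(hj z' h).fderiv]
    exact isJet_jet ..
  · convert hj z hz using 1
    rw [hwz, ← hP.eq_jet]
    congr 1
    · ext i
      fin_cases i <;> simp [f0, β₁]
    · ext i
      fin_cases i <;> simp [f0, β₂]

lemma IsSolution.mono {Ω Ω' : Set Base} {w : Base → Fibre} (h : IsSolution Ω w) (hs : Ω' ⊆ Ω)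
    (ho : IsOpen Ω') : IsSolution Ω' w :=
  ⟨ho, h.smooth.mono hs, fun z hz => h.shallowWater z (hs hz), fun z hz => h.steady z (hs hz)⟩

/-! ### Prolongation of point symmetries to first derivatives. -/

/-- The horizontal part of the image of the graph of `P` under `L`. -/
noncomputable def hor (L : Total →L[ℝ] Total) (P : Base →L[ℝ] Fibre) : Base →L[ℝ] Base :=
  (ContinuousLinearMap.fst ℝ Base Fibre).comp (L.comp ((ContinuousLinearMap.id ℝ Base).prod P))

/-- The vertical part of the image of the graph of `P` under `L`. -/
noncomputable def ver (L : Total →L[ℝ] Total) (P : Base →L[ℝ] Fibre) : Base →L[ℝ] Fibre :=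
  (ContinuousLinearMap.snd ℝ Base Fibre).comp (L.comp ((ContinuousLinearMap.id ℝ Base).prod P))

@[simp] lemma hor_apply (L : Total →L[ℝ] Total) (P : Base →L[ℝ] Fibre) (ζ : Base) :
    hor L P ζ = (L (ζ, P ζ)).1 := rfl

@[simp] lemma ver_apply (L : Total →L[ℝ] Total) (P : Base →L[ℝ] Fibre) (ζ : Base) :
    ver L P ζ = (L (ζ, P ζ)).2 := rfl

lemma hasFDerivAt_graph {w : Base → Fibre} {z : Base} {P : Base →L[ℝ] Fibre} {Φ : Total → Total}
    {L : Total →L[ℝ] Total} (hw : HasFDerivAt w P z) (hΦ : HasFDerivAt Φ L (z, w z)) :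
    HasFDerivAt (fun z' => Φ (z', w z')) (L.comp ((ContinuousLinearMap.id ℝ Base).prod P)) z :=
  hΦ.comp (f := fun z' => (z', w z')) z ((hasFDerivAt_id z).prodMk hw)

lemma IsPointTransformation.contDiffAt {Φ : OpenPartialHomeomorph Total Total}
    (hΦ : IsPointTransformation Φ) {p : Total} (hp : p ∈ Φ.source) : ContDiffAt ℝ ∞ Φ p :=
  hΦ.smooth.contDiffAt (Φ.open_source.mem_nhds hp)

lemma IsPointTransformation.hasFDerivAt {Φ : OpenPartialHomeomorph Total Total}
    (hΦ : IsPointTransformation Φ) {p : Total} (hp : p ∈ Φ.source) :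
    HasFDerivAt Φ (fderiv ℝ Φ p) p :=
  ((hΦ.contDiffAt hp).differentiableAt (by simp)).hasFDerivAt

lemma IsPointTransformation.fderiv_injective {Φ : OpenPartialHomeomorph Total Total}
    (hΦ : IsPointTransformation Φ) {p : Total} (hp : p ∈ Φ.source) :
    Function.Injective (fderiv ℝ Φ p) := by
  have h1 : HasFDerivAt Φ.symm (fderiv ℝ Φ.symm (Φ p)) (Φ p) :=
    ((hΦ.smooth_symm.contDiffAt (Φ.open_target.mem_nhds (Φ.map_source hp))).differentiableAt
      (by simp)).hasFDerivAt
  have h2 := h1.comp p (hΦ.hasFDerivAt hp)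
  have h3 : HasFDerivAt (Φ.symm ∘ Φ) (ContinuousLinearMap.id ℝ Total) p := by
    refine (hasFDerivAt_id p).congr_of_eventuallyEq ?_
    filter_upwards [Φ.open_source.mem_nhds hp] with q hq
    exact Φ.left_inv hq
  have h4 := h2.unique h3
  exact Function.LeftInverse.injective (g := fderiv ℝ Φ.symm (Φ p))
    fun v => congrArg (fun A : Total →L[ℝ] Total => A v) h4

/-- The prolongation of a point symmetry maps derivatives of solutions to such derivatives. -/
lemma IsPointSymmetry.exists_jet {Φ : OpenPartialHomeomorph Total Total} (hΦ : IsPointSymmetry Φ)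
    {p : Total} (hp : p ∈ Φ.source) {P : Base →L[ℝ] Fibre} (hP : IsJet p.2 P)
    (hdet : (hor (fderiv ℝ Φ p) P).det ≠ 0) :
    ∃ P' : Base →L[ℝ] Fibre, IsJet (Φ p).2 P' ∧
      ∀ ζ, P' (hor (fderiv ℝ Φ p) P ζ) = ver (fderiv ℝ Φ p) P ζ := by
  obtain ⟨z₀, w₀⟩ := p
  obtain ⟨Ω, w, hz₀, hsol, rfl, hwP⟩ := exists_solution_of_isJet z₀ w₀ P hP
  set L := fderiv ℝ Φ (z₀, w z₀) with hL
  set G : Base → Total := fun z => Φ (z, w z) with hG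
  have hcont : ContinuousOn (fun z => (z, w z)) Ω := continuousOn_id.prodMk hsol.smooth.continuousOn
  set Ω₁ := Ω ∩ (fun z => (z, w z)) ⁻¹' Φ.source with hΩ₁
  have hΩ₁o : IsOpen Ω₁ := hcont.isOpen_inter_preimage hsol.isOpen Φ.open_source
  have hGs : ContDiffOn ℝ ∞ G Ω₁ :=
    hΦ.pointTransformation.smooth.comp
      ((contDiff_id.contDiffOn).prodMk (hsol.smooth.mono inter_subset_left)) fun z hz => hz.2
  have hg : ContDiffOn ℝ ∞ (fun z => (G z).1) Ω₁ := contDiff_fst.comp_contDiffOn hGs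
  -- The horizontal derivative has to stay invertible on the whole shrunken domain, so that the
  -- inverse `e.symm` is smooth on all of its image and not only at the image of `z₀`.
  set Ω₂ := Ω₁ ∩ (fun z => (fderiv ℝ (fun z => (G z).1) z).det) ⁻¹' {0}ᶜ with hΩ₂
  have hΩ₂o : IsOpen Ω₂ := by
    refine ContinuousOn.isOpen_inter_preimage ?_ hΩ₁o isOpen_compl_singleton
    exact ContinuousLinearMap.continuous_det.comp_continuousOn
      (hg.continuousOn_fderiv_of_isOpen hΩ₁o (by simp))
  have hGd := hasFDerivAt_graph hwP (hΦ.pointTransformation.hasFDerivAt hp)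
  have hg₀ : HasFDerivAt (fun z => (G z).1) (hor L P) z₀ := hGd.fst
  have hz₁ : z₀ ∈ Ω₁ := ⟨hz₀, hp⟩
  have hz₂ : z₀ ∈ Ω₂ := ⟨hz₁, by simpa [hg₀.fderiv] using hdet⟩
  have hga (z : Base) (hz : z ∈ Ω₁) : ContDiffAt ℝ ∞ (fun z => (G z).1) z :=
    hg.contDiffAt (hΩ₁o.mem_nhds hz)
  set A := (hor L P).toContinuousLinearEquivOfDetNeZero hdet
  have hA : HasFDerivAt (fun z => (G z).1) (A : Base →L[ℝ] Base) z₀ := by simpa [A] using hg₀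
  set e := (hga z₀ hz₁).toOpenPartialHomeomorph (fun z => (G z).1) hA (by simp) with he
  have hez₀ : z₀ ∈ e.source := (hga z₀ hz₁).mem_toOpenPartialHomeomorph_source hA (by simp)
  have hec (z : Base) : e z = (G z).1 := rfl
  set Ω₃ := Ω₂ ∩ e.source with hΩ₃
  have hΩ₃o : IsOpen Ω₃ := hΩ₂o.inter e.open_source
  have hesm : ContDiffOn ℝ ∞ e.symm (e '' Ω₃) := by
    rintro _ ⟨z, hz, rfl⟩
    refine ContDiffAt.contDiffWithinAt ?_
    have hd := hz.1.2
    simp only [mem_preimage, mem_compl_iff, mem_singleton_iff] at hd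
    refine e.contDiffAt_symm (f₀' := (fderiv ℝ (fun z => (G z).1)
      z).toContinuousLinearEquivOfDetNeZero hd) (e.map_source hz.2) ?_ ?_
    · rw [e.left_inv hz.2]
      rw [ContinuousLinearMap.coe_toContinuousLinearEquivOfDetNeZero]
      exact ((hga z hz.1.1).differentiableAt (by simp)).hasFDerivAt
    · rw [e.left_inv hz.2]
      exact hga z hz.1.1
  set w' : Base → Fibre := fun z' => (G (e.symm z')).2 with hw'
  have ht : TransformsTo Φ Ω₃ w (e '' Ω₃) w' := by
    refine ⟨?_, e.isOpen_image_of_subset_source hΩ₃o inter_subset_right, ?_, ?_⟩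
    · rintro _ ⟨z, hz, rfl⟩
      exact hz.1.1.2
    · refine (contDiff_snd.comp_contDiffOn hGs).comp hesm ?_
      rintro _ ⟨z, hz, rfl⟩
      rw [e.left_inv hz.2]
      exact hz.1.1
    · rw [graphOver, graphOver, image_image, image_image]
      refine image_congr fun z hz => ?_
      simp only [hw', e.left_inv hz.2]
      rfl
  have hsol' := isSolution_iff.1 (hΦ.maps_solutions _ _ _ _
    (hsol.mono (fun z hz => hz.1.1.1) hΩ₃o) ht)
  have hz₃ : z₀ ∈ Ω₃ := ⟨hz₂, hez₀⟩
  have hm : e z₀ ∈ e '' Ω₃ := mem_image_of_mem _ hz₃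
  have hj := hsol'.2.2 _ hm
  have hwe : w' (e z₀) = (Φ (z₀, w z₀)).2 := by simp [hw', e.left_inv hez₀, hG]
  refine ⟨fderiv ℝ w' (e z₀), by rwa [hwe] at hj, fun ζ => ?_⟩
  have hw'd : HasFDerivAt w' (fderiv ℝ w' (e z₀)) (e z₀) :=
    ((hsol'.2.1.contDiffAt (hsol'.1.mem_nhds hm)).differentiableAt (by simp)).hasFDerivAt
  -- The vertical component along the graph is `w'` after the horizontal one; computing its
  -- derivative in both ways gives the claim.
  have h1 := hw'd.comp z₀ hg₀
  have h2 : HasFDerivAt (w' ∘ fun z => (G z).1) (ver L P) z₀ := by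
    refine (hGd.snd : HasFDerivAt (fun z => (G z).2) (ver L P) z₀).congr_of_eventuallyEq ?_
    filter_upwards [e.open_source.mem_nhds hez₀] with z hz
    have := e.left_inv hz
    rw [hec] at this
    simp only [Function.comp_apply, hw', this]
    rfl
  exact congrArg (fun B : Base →L[ℝ] Fibre => B ζ) (h1.unique h2)

/-- The points at which a point transformation maps the tangent space of the graph of some
solution to the tangent space of a graph. -/
def regularSet (Φ : OpenPartialHomeomorph Total Total) : Set Total :=
  {p | p ∈ Φ.source ∧ ∃ cx cy : Fibre, (hor (fderiv ℝ Φ p) (jet p.2 cx cy)).det ≠ 0}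

lemma continuous_jet (cx cy : Fibre) : Continuous fun w : Fibre => jet w cx cy := by
  have h : Continuous fun w : Fibre => timeColumn w cx cy := by
    refine continuous_pi fun i => ?_
    fin_cases i <;> simp [timeColumn] <;> fun_prop
  have h2 : Continuous fun w : Fibre =>
      (ContinuousLinearMap.proj (R := ℝ) (φ := fun _ : Fin 3 => ℝ) 0).smulRight
        (timeColumn w cx cy) :=
    ((ContinuousLinearMap.smulRightL ℝ Base Fibre
      (ContinuousLinearMap.proj (R := ℝ) (φ := fun _ : Fin 3 => ℝ) 0)).continuous).comp h
  unfold jet ofColumns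
  exact (h2.add continuous_const).add continuous_const

lemma continuous_hor : Continuous fun q : (Total →L[ℝ] Total) × (Base →L[ℝ] Fibre) =>
    hor q.1 q.2 := by
  have (P : Base →L[ℝ] Fibre) : (ContinuousLinearMap.id ℝ Base).prod P =
      ContinuousLinearMap.inl ℝ Base Fibre + (ContinuousLinearMap.inr ℝ Base Fibre).comp P := by
    ext <;> simp
  simp only [hor, this]
  fun_prop

lemma isOpen_regularSet {Φ : OpenPartialHomeomorph Total Total} (hΦ : IsPointTransformation Φ) :
    IsOpen (regularSet Φ) := by
  have : regularSet Φ = ⋃ cx : Fibre, ⋃ cy : Fibre,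
      Φ.source ∩ (fun p => (hor (fderiv ℝ Φ p) (jet p.2 cx cy)).det) ⁻¹' {0}ᶜ := by
    ext p
    simp [regularSet]
  rw [this]
  refine isOpen_iUnion fun cx => isOpen_iUnion fun cy => ?_
  refine ContinuousOn.isOpen_inter_preimage ?_ Φ.open_source isOpen_compl_singleton
  refine ContinuousLinearMap.continuous_det.comp_continuousOn (continuous_hor.comp_continuousOn
    (ContinuousOn.prodMk (hΦ.smooth.continuousOn_fderiv_of_isOpen Φ.open_source (by simp)) ?_))
  exact ((continuous_jet cx cy).comp continuous_snd).continuousOn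

lemma TransformsTo.exists_eq {Φ : OpenPartialHomeomorph Total Total} {Ω Ω' : Set Base}
    {w w' : Base → Fibre} (h : TransformsTo Φ Ω w Ω' w') {z' : Base} (hz' : z' ∈ Ω') :
    ∃ z ∈ Ω, (z', w' z') = Φ (z, w z) := by
  have : (z', w' z') ∈ Φ '' graphOver Ω w := by
    rw [← h.graph_eq]
    exact mem_image_of_mem _ hz'
  obtain ⟨_, ⟨z, hz, rfl⟩, h1⟩ := this
  exact ⟨z, hz, h1.symm⟩

lemma TransformsTo.apply {Φ : OpenPartialHomeomorph Total Total} {Ω Ω' : Set Base}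
    {w w' : Base → Fibre} (h : TransformsTo Φ Ω w Ω' w') {z : Base} (hz : z ∈ Ω) :
    (Φ (z, w z)).1 ∈ Ω' ∧ Φ (z, w z) = ((Φ (z, w z)).1, w' (Φ (z, w z)).1) := by
  have : Φ (z, w z) ∈ graphOver Ω' w' := by
    rw [h.graph_eq]
    exact mem_image_of_mem _ (mem_image_of_mem _ hz)
  obtain ⟨z', hz', h1⟩ := this
  rw [← h1]
  exact ⟨hz', rfl⟩

/-- If a graph is mapped to a graph, the base component of `Φ.symm` along the new graph is a
differentiable left inverse of the horizontal map, so the derivative of the latter is invertible. -/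
lemma IsPointSymmetry.regularSet_nonempty {Φ : OpenPartialHomeomorph Total Total}
    (hΦ : IsPointSymmetry Φ) : (regularSet Φ).Nonempty := by
  obtain ⟨Ω, w, Ω', w', ⟨z₀, hz₀⟩, hsol, ht⟩ := hΦ.nondegenerate
  have hsol := isSolution_iff.1 hsol
  have hp : (z₀, w z₀) ∈ Φ.source := ht.graph_subset (mem_image_of_mem _ hz₀)
  have hG (z : Base) (hz : z ∈ Ω) : (Φ (z, w z)).1 ∈ Ω' ∧
      Φ (z, w z) = ((Φ (z, w z)).1, w' (Φ (z, w z)).1) := ht.apply hz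
  set p : Total := (z₀, w z₀)
  have hwd : HasFDerivAt w (fderiv ℝ w z₀) z₀ :=
    ((hsol.2.1.contDiffAt (hsol.1.mem_nhds hz₀)).differentiableAt (by simp)).hasFDerivAt
  have hgd := (hasFDerivAt_graph hwd (hΦ.pointTransformation.hasFDerivAt hp)).fst
  set z₁ := (Φ p).1 with hz₁
  obtain ⟨hz₁m, hp1⟩ := hG z₀ hz₀
  have hw'd : HasFDerivAt w' (fderiv ℝ w' z₁) z₁ :=
    ((ht.smooth.contDiffAt (ht.isOpen.mem_nhds hz₁m)).differentiableAt (by simp)).hasFDerivAt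
  have hsd : HasFDerivAt Φ.symm (fderiv ℝ Φ.symm (z₁, w' z₁)) (z₁, w' z₁) := by
    refine ((hΦ.pointTransformation.smooth_symm.contDiffAt
      (Φ.open_target.mem_nhds ?_)).differentiableAt (by simp)).hasFDerivAt
    rw [← hp1]
    exact Φ.map_source hp
  have hkd := (hasFDerivAt_graph hw'd hsd).fst
  have h1 := hkd.comp z₀ hgd
  have h2 : HasFDerivAt ((fun z' => (Φ.symm (z', w' z')).1) ∘ fun z => (Φ (z, w z)).1)
      (ContinuousLinearMap.id ℝ Base) z₀ := by
    refine (hasFDerivAt_id z₀).congr_of_eventuallyEq ?_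
    filter_upwards [hsol.1.mem_nhds hz₀] with z hz
    simp only [Function.comp_apply, ← (hG z hz).2]
    rw [Φ.left_inv (ht.graph_subset (mem_image_of_mem _ hz))]
    rfl
  have h3 := h1.unique h2
  refine ⟨p, hp, fderiv ℝ w z₀ (eb 1), fderiv ℝ w z₀ (eb 2), ?_⟩
  rw [(hsol.2.2 z₀ hz₀).eq_jet]
  have h4 := congrArg ContinuousLinearMap.det h3
  intro h0
  have h5 : ∀ A B : Base →L[ℝ] Base, (A.comp B).det = A.det * B.det := fun A B =>
    LinearMap.det_comp (A : Base →ₗ[ℝ] Base) (B : Base →ₗ[ℝ] Base)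
  rw [h5] at h4
  have h6 : (hor (fderiv ℝ Φ p) (fderiv ℝ w z₀)).det = 0 := h0
  unfold hor at h6
  rw [h6] at h4
  simp [ContinuousLinearMap.det] at h4

/-! ### Solutions over a given bottom and the extended system. -/

/-- The solutions over a bottom topography `β` are the solutions of the extended system whose last
component is given by `β`. -/
lemma isSolutionOver_iff {D : Set (ℝ × ℝ)} {β : ℝ × ℝ → ℝ} (hD : IsOpen D)
    (hβ : ContDiffOn ℝ ∞ β D) {Ω : Set Base} {w : Base → Fibre} :
    IsSolutionOver D β Ω w ↔ IsSolution Ω w ∧ (∀ z ∈ Ω, (z 1, z 2) ∈ D) ∧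
      ∀ z ∈ Ω, w z 3 = β (z 1, z 2) := by
  have heq (ho : IsOpen Ω) (hb : ∀ z ∈ Ω, w z 3 = β (z 1, z 2)) (z : Base) (hz : z ∈ Ω)
      (j : Fin 3) : pd (fun z' => w z' 3) j z = pd (fun z' => β (z' 1, z' 2)) j z := by
    have : (fun z' => w z' 3) =ᶠ[𝓝 z] fun z' => β (z' 1, z' 2) := by
      filter_upwards [ho.mem_nhds hz] with z' hz' using hb z' hz'
    rw [pd, pd, this.fderiv_eq]
  have hsw (ho : IsOpen Ω) (hb : ∀ z ∈ Ω, w z 3 = β (z 1, z 2)) (z : Base) (hz : z ∈ Ω) :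
      ShallowWaterAt (fun z' => w z' 0) (fun z' => w z' 1) (fun z' => w z' 2)
        (fun z' => w z' 3) z ↔ ShallowWaterAt (fun z' => w z' 0) (fun z' => w z' 1)
        (fun z' => w z' 2) (fun z' => β (z' 1, z' 2)) z := by
    simp only [ShallowWaterAt, heq ho hb z hz]
  constructor
  · rintro ⟨h1, h2, h3, h4, h5⟩
    refine ⟨⟨h1, h2, fun z hz => (hsw h1 h4 z hz).2 (h5 z hz), fun z hz => ?_⟩, h3, h4⟩
    rw [heq h1 h4 z hz]
    set proj : Base →L[ℝ] ℝ × ℝ :=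
      (ContinuousLinearMap.proj 1).prod (ContinuousLinearMap.proj 2) with hproj
    have hd : HasFDerivAt (fun z' : Base => β (z' 1, z' 2))
        ((fderiv ℝ β (z 1, z 2)).comp proj) z :=
      ((hβ.contDiffAt (hD.mem_nhds (h3 z hz))).differentiableAt (by simp)).hasFDerivAt.comp
        (f := proj) z proj.hasFDerivAt
    rw [pd, hd.fderiv]
    have : proj (Pi.single 0 1) = 0 := by simp [hproj]
    simp only [ContinuousLinearMap.comp_apply, this, map_zero]
  · rintro ⟨h, h3, h4⟩
    exact ⟨h.isOpen, h.smooth, h3, h4, fun z hz => (hsw h.isOpen h4 z hz).1 (h.shallowWater z hz)⟩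

/-! ### Characteristic covectors and the lines they single out. -/

/-- The direction of the particle paths. -/
noncomputable abbrev flow (w : Fibre) : Base := ![1, w 0, w 1]

lemma covector_apply (η : Base →L[ℝ] ℝ) (ζ : Base) :
    η ζ = ζ 0 * η (eb 0) + ζ 1 * η (eb 1) + ζ 2 * η (eb 2) := by
  have : ζ = ζ 0 • eb 0 + ζ 1 • eb 1 + ζ 2 • eb 2 := by
    ext j; fin_cases j <;> simp
  conv_lhs => rw [this]
  simp only [map_add, map_smul, smul_eq_mul]

/-- A rank-one derivative is a jump of the first derivatives across a surface with conormal `η`; the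
conditions say that the principal symbol at `η` annihilates `a`. -/
lemma isJet_smulRight_iff {w a : Fibre} {η : Base →L[ℝ] ℝ} : IsJet w (η.smulRight a) ↔
    η (flow w) * a 0 + η (eb 1) * (a 2 - a 3) = 0 ∧
    η (flow w) * a 1 + η (eb 2) * (a 2 - a 3) = 0 ∧
    η (flow w) * a 2 + w 2 * (η (eb 1) * a 0 + η (eb 2) * a 1) = 0 ∧ η (eb 0) * a 3 = 0 := by
  rw [covector_apply η (flow w)]
  simp only [IsJet, ContinuousLinearMap.smulRight_apply, Pi.smul_apply, smul_eq_mul, flow,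
    Matrix.cons_val]
  constructor
  · rintro ⟨h0, h1, h2, h3⟩
    refine ⟨?_, ?_, ?_, h3⟩ <;> linarith
  · rintro ⟨h0, h1, h2, h3⟩
    refine ⟨?_, ?_, ?_, h3⟩ <;> linarith

/-- The characteristic equation. -/
lemma characteristic_of_isJet {w a : Fibre} {η : Base →L[ℝ] ℝ} (ha : a ≠ 0)
    (h : IsJet w (η.smulRight a)) :
    η (eb 0) * η (flow w) * (η (flow w) ^ 2 - w 2 * (η (eb 1) ^ 2 + η (eb 2) ^ 2)) = 0 := by
  obtain ⟨h0, h1, h2, h3⟩ := isJet_smulRight_iff.1 h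
  by_contra hne
  obtain ⟨⟨hτ, hσ⟩, hc⟩ : (η (eb 0) ≠ 0 ∧ η (flow w) ≠ 0) ∧ _ := by
    simpa only [mul_ne_zero_iff] using hne
  have a3 : a 3 = 0 := by simpa [hτ] using h3
  rw [a3, sub_zero] at h0 h1
  have a2 : a 2 = 0 := by
    refine (mul_eq_zero.1 (?_ : (_ : ℝ) * a 2 = 0)).resolve_left hc
    linear_combination η (flow w) * h2 - w 2 * η (eb 1) * h0 - w 2 * η (eb 2) * h1
  rw [a2, mul_zero, add_zero] at h0 h1
  refine ha ?_
  ext i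
  fin_cases i
  · simpa [hσ] using h0
  · simpa [hσ] using h1
  · exact a2
  · exact a3

/-- A plane of characteristic covectors is orthogonal to the time axis or to the flow. -/
lemma mem_line_of_characteristic {w : Fibre} {d : Base} (hd : d ≠ 0)
    (h : ∀ η : Base →L[ℝ] ℝ, η ≠ 0 → η d = 0 → ∃ a : Fibre, a ≠ 0 ∧ IsJet w (η.smulRight a)) :
    (d 1 = 0 ∧ d 2 = 0) ∨ (d 1 = w 0 * d 0 ∧ d 2 = w 1 * d 0) := by
  have key (τ ξ₁ ξ₂ : ℝ) (hξ : ξ₁ ≠ 0 ∨ ξ₂ ≠ 0) (h0 : τ * d 0 + ξ₁ * d 1 + ξ₂ * d 2 = 0) :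
      τ * (τ + w 0 * ξ₁ + w 1 * ξ₂) *
        ((τ + w 0 * ξ₁ + w 1 * ξ₂) ^ 2 - w 2 * (ξ₁ ^ 2 + ξ₂ ^ 2)) = 0 := by
    set η : Base →L[ℝ] ℝ := τ • ContinuousLinearMap.proj 0 + ξ₁ • ContinuousLinearMap.proj 1 +
      ξ₂ • ContinuousLinearMap.proj 2 with hη
    have e0 : η (eb 0) = τ := by simp [hη]
    have e1 : η (eb 1) = ξ₁ := by simp [hη]
    have e2 : η (eb 2) = ξ₂ := by simp [hη]
    obtain ⟨a, ha, hj⟩ := h η (by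
      rintro h'
      rw [h'] at e1 e2
      rcases hξ with h | h
      · exact h e1.symm
      · exact h e2.symm) (by rw [covector_apply, e0, e1, e2]; linarith)
    have := characteristic_of_isJet ha hj
    rw [covector_apply η (flow w), e0, e1, e2] at this
    simp only [flow, Matrix.cons_val] at this
    linear_combination this
  -- The annihilator of `d` is parametrised by one real variable up to scaling, and the
  -- characteristic form on it becomes a polynomial that vanishes identically. Hence one of its
  -- factors vanishes.
  by_cases hd0 : d 0 = 0
  · exfalso
    rw [hd0] at key
    have hd12 : -d 2 ≠ 0 ∨ d 1 ≠ 0 := by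
      by_contra! hc
      refine hd ?_
      ext i
      fin_cases i
      · exact hd0
      · exact hc.2
      · simpa using hc.1
    set c := w 0 * (-d 2) + w 1 * d 1 with hc
    set m := w 2 * (d 2 ^ 2 + d 1 ^ 2)
    -- Here `ξ` is fixed orthogonally to `(d 1, d 2)` and `τ` is free; shifting `τ` by `c` makes `σ`
    -- the value on the particle direction. The result is a product of nonzero polynomials.
    have h2 (σ : ℝ) := key (σ - c) (-d 2) (d 1) hd12 (by ring)
    have h3 : (Polynomial.X - Polynomial.C c) * Polynomial.X *
        (Polynomial.X ^ 2 - Polynomial.C m) = 0 := by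
      refine Polynomial.funext fun σ => ?_
      simp
      have := h2 σ
      rw [show σ - c + w 0 * -d 2 + w 1 * d 1 = σ by rw [hc]; ring] at this
      simpa using this
    have h4 := Polynomial.X_pow_sub_C_ne_zero (R := ℝ) (n := 2) (by norm_num) m
    simp [Polynomial.X_sub_C_ne_zero, h4] at h3
  · set e₁ := d 1 - w 0 * d 0 with he₁
    set e₂ := d 2 - w 1 * d 0 with he₂
    have h2 (s : ℝ) := key (-(d 1 + s * d 2) / d 0) 1 s (by simp) (by field_simp; ring)
    have h3 : (Polynomial.C (d 1) + Polynomial.C (d 2) * Polynomial.X) *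
        (Polynomial.C e₁ + Polynomial.C e₂ * Polynomial.X) *
        ((Polynomial.C e₁ + Polynomial.C e₂ * Polynomial.X) ^ 2 -
          Polynomial.C (w 2 * d 0 ^ 2) * (1 + Polynomial.X ^ 2)) = 0 := by
      refine Polynomial.funext fun s => ?_
      simp
      have := h2 s
      rw [show -(d 1 + s * d 2) / d 0 + w 0 * 1 + w 1 * s = -(e₁ + e₂ * s) / d 0 by
        rw [he₁, he₂]; field_simp; ring] at this
      have h5 : (-(d 1 + s * d 2) / d 0 * (-(e₁ + e₂ * s) / d 0) *
        ((-(e₁ + e₂ * s) / d 0) ^ 2 - w 2 * (1 ^ 2 + s ^ 2))) * d 0 ^ 4 = 0 := by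
        rw [this, zero_mul]
      have h6 : (-(d 1 + s * d 2) / d 0 * (-(e₁ + e₂ * s) / d 0) *
        ((-(e₁ + e₂ * s) / d 0) ^ 2 - w 2 * (1 ^ 2 + s ^ 2))) * d 0 ^ 4 =
        (d 1 + d 2 * s) * (e₁ + e₂ * s) * ((e₁ + e₂ * s) ^ 2 - w 2 * d 0 ^ 2 * (1 + s ^ 2)) := by
        field_simp
      rw [h6] at h5
      simpa using h5
    have lin (a b : ℝ) (h : Polynomial.C a + Polynomial.C b * Polynomial.X = 0) :
        a = 0 ∧ b = 0 := by
      have h0 := congrArg (Polynomial.eval 0) h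
      have h1 := congrArg (Polynomial.eval 1) h
      simp at h0 h1
      exact ⟨h0, by linarith⟩
    rcases mul_eq_zero.1 h3 with h3 | h3
    · rcases mul_eq_zero.1 h3 with h3 | h3
      · exact Or.inl (lin _ _ h3)
      · obtain ⟨h4, h5⟩ := lin _ _ h3
        exact Or.inr ⟨by linarith, by linarith⟩
    -- The sonic factor, compared at `0`, `1` and `-1`, gives `e₁ e₂ = 0` and `e₁² = e₂²`. It
    -- therefore vanishes only when `d` is along the particle direction, as can happen when `w 2 =
    -- 0`.
    · have p0 := congrArg (Polynomial.eval 0) h3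
      have p1 := congrArg (Polynomial.eval 1) h3
      have p2 := congrArg (Polynomial.eval (-1)) h3
      simp at p0 p1 p2
      have q1 : e₁ * e₂ = 0 := by nlinarith
      have q2 : e₁ = 0 ∧ e₂ = 0 := by
        rcases mul_eq_zero.1 q1 with h | h
        · rw [h] at p0 p1
          exact ⟨h, by nlinarith⟩
        · rw [h] at p1
          exact ⟨by nlinarith, h⟩
      exact Or.inr ⟨by linarith [q2.1], by linarith [q2.2]⟩

/-! ### The linearised symmetry and the two characteristic lines. -/

/-- `L` maps the tangent spaces of graphs of solutions at a point with the fibre coordinates `w`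
to such tangent spaces at a point with the fibre coordinates `w'`. -/
def MapsJets (w w' : Fibre) (L : Total →L[ℝ] Total) : Prop :=
  ∀ P, IsJet w P → (hor L P).det ≠ 0 →
    ∃ P', IsJet w' P' ∧ ∀ ζ, P' (hor L P ζ) = ver L P ζ

lemma hor_add_smul (L : Total →L[ℝ] Total) (P R : Base →L[ℝ] Fibre) (s : ℝ) (ζ : Base) :
    hor L (P + s • R) ζ = hor L P ζ + s • (L (0, R ζ)).1 := by
  have : ((ζ, (P + s • R) ζ) : Total) = (ζ, P ζ) + s • (0, R ζ) := by simp
  simp only [hor_apply, this, map_add, map_smul]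
  rfl

lemma eventually_det_hor_ne_zero {L : Total →L[ℝ] Total} {P : Base →L[ℝ] Fibre}
    (hP : (hor L P).det ≠ 0) (R : Base →L[ℝ] Fibre) :
    ∀ᶠ s : ℝ in 𝓝 0, (hor L (P + s • R)).det ≠ 0 := by
  have hc : Continuous fun s : ℝ => (hor L (P + s • R)).det :=
    ContinuousLinearMap.continuous_det.comp (continuous_hor.comp
      (f := fun s : ℝ => (L, P + s • R)) (by fun_prop))
  exact hc.continuousAt.eventually_ne (by simpa using hP)

lemma bijective_of_det_ne_zero {M : Base →L[ℝ] Base} (hM : M.det ≠ 0) : Function.Bijective M := by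
  rw [← ContinuousLinearMap.coe_toContinuousLinearEquivOfDetNeZero M hM]
  exact (M.toContinuousLinearEquivOfDetNeZero hM).bijective

/-- The image of a vector whose annihilator is characteristic has the same property. -/
lemma MapsJets.mem_line {w w' : Fibre} {L : Total →L[ℝ] Total} (hL : Function.Injective L)
    (h : MapsJets w w' L) {P : Base →L[ℝ] Fibre} (hP : IsJet w P) (hdet : (hor L P).det ≠ 0)
    {d : Base} (hd : d ≠ 0)
    (hc : ∀ η : Base →L[ℝ] ℝ, η ≠ 0 → η d = 0 → ∃ a : Fibre, a ≠ 0 ∧ IsJet w (η.smulRight a)) :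
    ((hor L P d) 1 = 0 ∧ (hor L P d) 2 = 0) ∨
      ((hor L P d) 1 = w' 0 * (hor L P d) 0 ∧ (hor L P d) 2 = w' 1 * (hor L P d) 0) := by
  obtain ⟨inj, surj⟩ := bijective_of_det_ne_zero hdet
  refine mem_line_of_characteristic (fun h0 => hd (inj (by rw [h0, map_zero]))) fun η' hη' hη'd => ?_
  have hne : ∃ ζ, η' (hor L P ζ) = 1 := by
    obtain ⟨ζ', hζ'⟩ : ∃ ζ', η' ζ' ≠ 0 := by
      by_contra! hcon
      exact hη' (ContinuousLinearMap.ext hcon)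
    obtain ⟨ζ, hζ⟩ := surj ((η' ζ')⁻¹ • ζ')
    exact ⟨ζ, by rw [hζ, map_smul, smul_eq_mul, inv_mul_cancel₀ hζ']⟩
  obtain ⟨ζ₁, hζ₁⟩ := hne
  -- A covector that kills the image of `d` pulls back to one that kills `d`. Perturbing `P` by the
  -- corresponding rank-one solution `R` and subtracting the two image derivatives produces a
  -- rank-one solution for `η'`.
  obtain ⟨a, ha, hR⟩ := hc (η'.comp (hor L P)) (fun h0 => by
    have := congrArg (fun g : Base →L[ℝ] ℝ => g ζ₁) h0
    simp only [ContinuousLinearMap.comp_apply, hζ₁] at this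
    simp at this) hη'd
  set R := (η'.comp (hor L P)).smulRight a with hRdef
  have hRa (ζ : Base) : R ζ = η' (hor L P ζ) • a := rfl
  obtain ⟨s, hsdet, hs⟩ := (((eventually_det_hor_ne_zero hdet R).filter_mono
    nhdsWithin_le_nhds).and (eventually_mem_nhdsWithin (a := (0 : ℝ)) (s := {0}ᶜ))).exists
  have hs : s ≠ 0 := hs
  obtain ⟨P₀, hP₀, e₀⟩ := h P hP hdet
  obtain ⟨P₁, hP₁, e₁⟩ := h _ (hP.add_smul hR s) hsdet
  have hQ : IsJet w' (P₁ + (-1 : ℝ) • P₀) := hP₁.add_smul hP₀ _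
  set Q := P₁ + (-1 : ℝ) • P₀ with hQdef
  have hQk (ζ' : Base) (hζ' : η' ζ' = 0) : Q ζ' = 0 := by
    obtain ⟨ζ, rfl⟩ := surj ζ'
    have hz : (P + s • R) ζ = P ζ := by simp [-hor_apply, hRa, hζ']
    have h1 := e₁ ζ
    rw [show hor L (P + s • R) ζ = hor L P ζ by simp only [hor_apply, hz],
      show ver L (P + s • R) ζ = ver L P ζ by simp only [ver_apply, hz], ← e₀ ζ] at h1
    rw [hQdef]
    simp [-hor_apply, h1]
  have hQr : Q = η'.smulRight (Q (hor L P ζ₁)) := by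
    ext1 ζ'
    have := hQk (ζ' - η' ζ' • hor L P ζ₁) (by rw [map_sub, map_smul, hζ₁]; simp)
    rw [map_sub, map_smul, sub_eq_zero] at this
    rw [this]; rfl
  refine ⟨Q (hor L P ζ₁), fun h0 => ?_, hQr ▸ hQ⟩
  have hQ0 : Q = 0 := by rw [hQr, h0]; simp
  -- If the difference were zero, `L` would map the distinct graphs of `P` and `P + s • R` to the
  -- same space, contrary to injectivity.
  have hPP : P₁ = P₀ := by
    rw [hQdef] at hQ0
    ext1 ζ'
    have := congrArg (fun g : Base →L[ℝ] Fibre => g ζ') hQ0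
    simpa [← sub_eq_add_neg, sub_eq_zero] using this
  obtain ⟨ζ₀, hζ₀⟩ := surj (hor L (P + s • R) ζ₁)
  have hLe : L (ζ₁, (P + s • R) ζ₁) = L (ζ₀, P ζ₀) := by
    refine Prod.ext ?_ ?_
    · exact hζ₀.symm
    · have h1 := e₁ ζ₁
      have h2 := e₀ ζ₀
      rw [hPP, ← hζ₀, h2] at h1
      exact h1.symm
  have hpair := hL hLe
  have hz : ζ₁ = ζ₀ := congrArg Prod.fst hpair
  have hv : (P + s • R) ζ₁ = P ζ₀ := congrArg Prod.snd hpair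
  rw [← hz] at hv
  simp only [add_apply, smul_apply, hRa, hζ₁,
    one_smul, add_eq_left, smul_eq_zero] at hv
  exact hv.elim hs ha

/-- Shear waves: a front moving with the particles may carry a jump of the velocity tangential to
it. -/
lemma exists_isJet_of_flow_eq_zero {w : Fibre} {η : Base →L[ℝ] ℝ} (hη : η ≠ 0)
    (h : η (flow w) = 0) : ∃ a : Fibre, a ≠ 0 ∧ IsJet w (η.smulRight a) := by
  refine ⟨![-η (eb 2), η (eb 1), 0, 0], fun h0 => hη ?_, ?_⟩
  · have h2 : η (eb 2) = 0 := by simpa using congrFun h0 0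
    have h1 : η (eb 1) = 0 := by simpa using congrFun h0 1
    ext1 ζ
    rw [covector_apply η, h1, h2] at h ⊢
    simp [flow] at h
    simp [h]
  · rw [isJet_smulRight_iff, h]
    simp
    exact Or.inr (by ring)

/-- Steady jumps: the gradient of the bottom balances the momentum equations, which fixes `a 2 - a 3
= σ ^ 2`. Scaling by `m` solves the continuity equation, and `w 2 ≠ 0` keeps the vector nonzero. -/
lemma exists_isJet_of_time_eq_zero {w : Fibre} (hw : w 2 ≠ 0) {η : Base →L[ℝ] ℝ} (hη : η ≠ 0)
    (h : η (eb 0) = 0) : ∃ a : Fibre, a ≠ 0 ∧ IsJet w (η.smulRight a) := by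
  have hpos : 0 < η (eb 1) ^ 2 + η (eb 2) ^ 2 := by
    by_contra! hcon
    have h1 : η (eb 1) = 0 := by nlinarith [sq_nonneg (η (eb 1)), sq_nonneg (η (eb 2))]
    have h2 : η (eb 2) = 0 := by nlinarith [sq_nonneg (η (eb 1)), sq_nonneg (η (eb 2))]
    refine hη ?_
    ext1 ζ
    rw [covector_apply, h, h1, h2]
    simp
  set σ := η (flow w) with hσ
  set m := w 2 * (η (eb 1) ^ 2 + η (eb 2) ^ 2) with hm
  refine ⟨![-η (eb 1) * σ, -η (eb 2) * σ, m, m - σ ^ 2], fun h0 => ?_, ?_⟩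
  · have : m = 0 := by simpa using congrFun h0 2
    exact (mul_ne_zero hw hpos.ne') this
  · rw [isJet_smulRight_iff, h, ← hσ]
    simp
    refine ⟨by ring, by ring, by rw [hm]; ring⟩

/-- The derivative in the direction of the flow. -/
noncomputable def flowColumn (w cx cy : Fibre) : Fibre :=
  ![cx 3 - cx 2, cy 3 - cy 2, -(w 2 * (cx 0 + cy 1)), w 0 * cx 3 + w 1 * cy 3]

@[simp] lemma jet_flow (w cx cy : Fibre) : jet w cx cy (flow w) = flowColumn w cx cy := by
  rw [jet_apply]
  ext i
  simp only [flow, Pi.add_apply, Pi.smul_apply, Matrix.cons_val, smul_eq_mul]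
  fin_cases i <;> simp [timeColumn, flowColumn] <;> ring

/-- Near `v₀` the path avoids the closed set `ℓ₂`, so a nearby point with `s ≠ 0` lies in `ℓ₁`. This
prevents the choice between the two lines from jumping as derivatives vary. -/
lemma mem_of_eventually_mem {ℓ₁ ℓ₂ : Submodule ℝ Base} (hdis : Disjoint ℓ₁ ℓ₂) {v₀ v₁ : Base}
    (hv₀ : v₀ ≠ 0) (h₁ : v₀ ∈ ℓ₁) (h : ∀ᶠ s : ℝ in 𝓝 0, v₀ + s • v₁ ∈ ℓ₁ ∨ v₀ + s • v₁ ∈ ℓ₂) :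
    v₁ ∈ ℓ₁ := by
  have h₂ : v₀ ∉ ℓ₂ := fun hm => hv₀ (Submodule.disjoint_def.1 hdis v₀ h₁ hm)
  have hc : Continuous fun s : ℝ => v₀ + s • v₁ := by fun_prop
  have ho : ∀ᶠ s : ℝ in 𝓝 0, v₀ + s • v₁ ∈ (ℓ₂ : Set Base)ᶜ :=
    hc.continuousAt.eventually_mem
      (ℓ₂.closed_of_finiteDimensional.isOpen_compl.mem_nhds (by simpa using h₂))
  obtain ⟨s, ⟨hs1, hs2⟩, hs⟩ := (((h.and ho).filter_mono nhdsWithin_le_nhds).and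
    (eventually_mem_nhdsWithin (a := (0 : ℝ)) (s := {0}ᶜ))).exists
  have h3 := hs1.resolve_right hs2
  have h4 : s • v₁ ∈ ℓ₁ := by simpa using ℓ₁.sub_mem h3 h₁
  exact (ℓ₁.smul_mem_iff hs).1 h4

/-- If the images of the flow and of the time direction lie in different lines for all derivatives
of solutions, then the horizontal part of `L` does not depend on `u`, `v`, `h`. -/
lemma vertical_of_lines {w : Fibre} (hu : w 0 ≠ 0) (hh : w 2 ≠ 0) {L : Total →L[ℝ] Total}
    {ℓ₁ ℓ₂ : Submodule ℝ Base} (hdis : Disjoint ℓ₁ ℓ₂)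
    (h1 : ∀ R, IsJet w R → (L (0, R (flow w))).1 ∈ ℓ₁)
    (h2 : ∀ R, IsJet w R → (L (0, R (eb 0))).1 ∈ ℓ₂) :
    ((L (0, ef 0)).1 = 0 ∧ (L (0, ef 1)).1 = 0 ∧ (L (0, ef 2)).1 = 0) ∧ (L (0, ef 3)).1 ∈ ℓ₁ := by
  have f1 (cx cy : Fibre) := h1 _ (isJet_jet w cx cy)
  have f2 (cx cy : Fibre) := h2 _ (isJet_jet w cx cy)
  simp only [jet_eb_zero, jet_flow] at f1 f2
  have hs (c : ℝ) (a : Fibre) : (L (0, c • a)).1 = c • (L (0, a)).1 := by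
    rw [← Prod.smul_fst, ← map_smul]; simp
  have ha (a b : Fibre) : (L (0, a + b)).1 = (L (0, a)).1 + (L (0, b)).1 := by
    rw [← Prod.fst_add, ← map_add]; simp
  have cancel (i : Fin 4) (h1 : (L (0, ef i)).1 ∈ ℓ₁) (h2 : (L (0, ef i)).1 ∈ ℓ₂) :
      (L (0, ef i)).1 = 0 := Submodule.disjoint_def.1 hdis _ h1 h2
  have v1 (i : Fin 4) (c : ℝ) (hc : c ≠ 0) (cx cy : Fibre)
      (h : flowColumn w cx cy = c • ef i) :
      (L (0, ef i)).1 ∈ ℓ₁ := by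
    have := f1 cx cy
    rw [h, hs] at this
    exact (ℓ₁.smul_mem_iff hc).1 this
  have z0 : (L (0, ef 0)).1 = 0 := by
    refine cancel 0 (v1 0 1 one_ne_zero (-ef 2) 0 ?_) ?_
    · ext i
      fin_cases i <;> simp [flowColumn]
    · have := f2 (ef 3) 0
      rwa [show timeColumn w (ef 3) 0 = ef 0 by ext i; fin_cases i <;> simp [timeColumn]] at this
  have z1 : (L (0, ef 1)).1 = 0 := by
    refine cancel 1 (v1 1 1 one_ne_zero 0 (-ef 2) ?_) ?_
    · ext i
      fin_cases i <;> simp [flowColumn]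
    · have := f2 0 (ef 3)
      rwa [show timeColumn w 0 (ef 3) = ef 1 by ext i; fin_cases i <;> simp [timeColumn]] at this
  have z2 : (L (0, ef 2)).1 = 0 := by
    refine cancel 2 (v1 2 (-w 2) (by simpa using hh) (ef 0) 0 ?_) ?_
    · ext i
      fin_cases i <;> simp [flowColumn]
    · have := f2 (ef 0) 0
      rw [show timeColumn w (ef 0) 0 = (-w 0) • ef 0 + (-w 2) • ef 2 by
        ext i; fin_cases i <;> simp [timeColumn], ha, hs, hs, z0, smul_zero, zero_add] at this
      exact (ℓ₂.smul_mem_iff (by simpa using hh)).1 this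
  refine ⟨⟨z0, z1, z2⟩, v1 3 (w 0) hu (ef 3 + ef 2) 0 ?_⟩
  ext i
  fin_cases i <;> simp [flowColumn]

/-- The structure of the horizontal part of the linearisation of a point symmetry at a point
in general position. -/
lemma MapsJets.horizontal {w w' : Fibre} (hu : w 0 ≠ 0) (hh : w 2 ≠ 0) (hu' : w' 0 ≠ 0)
    {L : Total →L[ℝ] Total} (hL : Function.Injective L) (h : MapsJets w w' L)
    {P : Base →L[ℝ] Fibre} (hP : IsJet w P) (hdet : (hor L P).det ≠ 0) :
    ((L (0, ef 0)).1 = 0 ∧ (L (0, ef 1)).1 = 0 ∧ (L (0, ef 2)).1 = 0) ∧ (L (eb 0, 0)).1 ≠ 0 ∧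
    (((L (eb 0, 0)).1 ∈ Submodule.span ℝ {eb 0} ∧
      (L (0, ef 3)).1 ∈ Submodule.span ℝ {flow w'} ∧
      (L (flow w, 0)).1 ∈ Submodule.span ℝ {flow w'}) ∨
    ((L (eb 0, 0)).1 ∈ Submodule.span ℝ {flow w'} ∧
      (L (0, ef 3)).1 ∈ Submodule.span ℝ {eb 0} ∧
      (L (flow w, 0)).1 ∈ Submodule.span ℝ {eb 0})) := by
  set ℓT : Submodule ℝ Base := Submodule.span ℝ {eb 0} with hℓT
  set ℓD : Submodule ℝ Base := Submodule.span ℝ {flow w'} with hℓD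
  have memT (d : Base) : d 1 = 0 ∧ d 2 = 0 → d ∈ ℓT := fun hd => by
    rw [hℓT, Submodule.mem_span_singleton]
    refine ⟨d 0, ?_⟩
    ext i
    fin_cases i <;> simp [hd.1, hd.2]
  have memD (d : Base) : d 1 = w' 0 * d 0 ∧ d 2 = w' 1 * d 0 → d ∈ ℓD := fun hd => by
    rw [hℓD, Submodule.mem_span_singleton]
    refine ⟨d 0, ?_⟩
    ext i
    fin_cases i <;> simp [hd.1, hd.2, mul_comm]
  -- The lines differ because the transformed `u` is nonzero.
  have hdis : Disjoint ℓT ℓD := by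
    rw [Submodule.disjoint_def]
    intro d h1 h2
    obtain ⟨r, rfl⟩ := Submodule.mem_span_singleton.1 h1
    obtain ⟨s, hs⟩ := Submodule.mem_span_singleton.1 h2
    have h3 := congrFun hs 1
    have h4 := congrFun hs 0
    simp [flow, hu'] at h3 h4
    rw [← h4, h3, zero_smul]
  have flow_ne : flow w ≠ 0 := fun h0 => by simpa using congrFun h0 0
  have time_ne : eb 0 ≠ 0 := fun h0 => by simpa using congrFun h0 0
  have inj := (bijective_of_det_ne_zero hdet).1
  have lineD {P' : Base →L[ℝ] Fibre} (hP' : IsJet w P') (hdet' : (hor L P').det ≠ 0) :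
      hor L P' (flow w) ∈ ℓT ∨ hor L P' (flow w) ∈ ℓD :=
    (h.mem_line hL hP' hdet' flow_ne fun η hη h0 => exists_isJet_of_flow_eq_zero hη h0).imp
      (memT _) (memD _)
  have lineT {P' : Base →L[ℝ] Fibre} (hP' : IsJet w P') (hdet' : (hor L P').det ≠ 0) :
      hor L P' (eb 0) ∈ ℓT ∨ hor L P' (eb 0) ∈ ℓD :=
    (h.mem_line hL hP' hdet' time_ne fun η hη h0 => exists_isJet_of_time_eq_zero hh hη h0).imp
      (memT _) (memD _)
  have flow_im : hor L P (flow w) ≠ 0 := fun h0 => flow_ne (inj (by rw [h0, map_zero]))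
  have time_im : hor L P (eb 0) ≠ 0 := fun h0 => time_ne (inj (by rw [h0, map_zero]))
  have indep {d : Base} (h1 : hor L P (flow w) ∈ Submodule.span ℝ {d})
      (h2 : hor L P (eb 0) ∈ Submodule.span ℝ {d}) : False := by
    obtain ⟨r, hr⟩ := Submodule.mem_span_singleton.1 h1
    obtain ⟨s, hs⟩ := Submodule.mem_span_singleton.1 h2
    have : hor L P (s • flow w) = hor L P (r • eb 0) := by
      rw [map_smul, map_smul, ← hr, ← hs, smul_smul, smul_smul, mul_comm]
    have h3 := congrFun (inj this) 1
    simp [hu] at h3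
    rw [h3, zero_smul] at hs
    exact time_im hs.symm
  have persist {ℓ₁ ℓ₂ : Submodule ℝ Base} (hdis : Disjoint ℓ₁ ℓ₂) {d : Base}
      (hd : hor L P d ≠ 0) (h1 : hor L P d ∈ ℓ₁)
      (hline : ∀ {P'}, IsJet w P' → (hor L P').det ≠ 0 → hor L P' d ∈ ℓ₁ ∨ hor L P' d ∈ ℓ₂)
      (R : Base →L[ℝ] Fibre) (hR : IsJet w R) : (L (0, R d)).1 ∈ ℓ₁ := by
    refine mem_of_eventually_mem hdis hd h1 ?_
    filter_upwards [eventually_det_hor_ne_zero hdet R] with s hs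
    rw [← hor_add_smul]
    exact hline (hP.add_smul hR s) hs
  have split (d : Base) : hor L P d = (L (d, 0)).1 + (L (0, P d)).1 := by
    rw [← Prod.fst_add, ← map_add]; simp
  have conclude {ℓ₁ ℓ₂ : Submodule ℝ Base} (hdis : Disjoint ℓ₁ ℓ₂)
      (m1 : hor L P (flow w) ∈ ℓ₁) (m2 : hor L P (eb 0) ∈ ℓ₂)
      (l1 : ∀ {P'}, IsJet w P' → (hor L P').det ≠ 0 →
        hor L P' (flow w) ∈ ℓ₁ ∨ hor L P' (flow w) ∈ ℓ₂)
      (l2 : ∀ {P'}, IsJet w P' → (hor L P').det ≠ 0 →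
        hor L P' (eb 0) ∈ ℓ₂ ∨ hor L P' (eb 0) ∈ ℓ₁) :
      ((L (0, ef 0)).1 = 0 ∧ (L (0, ef 1)).1 = 0 ∧ (L (0, ef 2)).1 = 0) ∧ (L (eb 0, 0)).1 ≠ 0 ∧
        (L (eb 0, 0)).1 ∈ ℓ₂ ∧ (L (0, ef 3)).1 ∈ ℓ₁ ∧ (L (flow w, 0)).1 ∈ ℓ₁ := by
    have r1 := persist hdis flow_im m1 l1
    have r2 := persist hdis.symm time_im m2 l2
    obtain ⟨⟨z0, z1, z2⟩, z3⟩ := vertical_of_lines hu hh hdis r1 r2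
    -- The time derivative of `b` is zero, so `P (eb 0)` involves only the directions already known
    -- to have no horizontal image.
    have hPt : (L (0, P (eb 0))).1 = 0 := by
      have e : ((0, P (eb 0)) : Total) = P (eb 0) 0 • (0, ef 0) + P (eb 0) 1 • (0, ef 1) +
          P (eb 0) 2 • (0, ef 2) := by
        have h3 := hP.2.2.2
        ext i
        · simp
        · fin_cases i <;> simp [h3]
      rw [e, map_add, map_add, map_smul, map_smul, map_smul]
      simp [z0, z1, z2]
    have et := split (eb 0)
    rw [hPt, add_zero] at et
    refine ⟨⟨z0, z1, z2⟩, et ▸ time_im, et ▸ m2, z3, ?_⟩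
    have := ℓ₁.sub_mem m1 (r1 P hP)
    rwa [split, add_sub_cancel_right] at this
  rcases lineD hP hdet with hD | hD
  · have hT := (lineT hP hdet).resolve_left fun hT => indep hD hT
    obtain ⟨a, b, c⟩ := conclude hdis hD hT lineD fun h1 h2 => (lineT h1 h2).symm
    exact ⟨a, b, Or.inr c⟩
  · have hT := (lineT hP hdet).resolve_right fun hT => indep hD hT
    obtain ⟨a, b, c⟩ := conclude hdis.symm hD hT (fun h1 h2 => (lineD h1 h2).symm) lineT
    exact ⟨a, b, Or.inl c⟩

/-! Differentiation of functions of `(t, x, y, u, v, h, b)` on open sets -/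

/-- The derivative of a function in a fixed direction. -/
noncomputable def D (v : Total) (F : Total → ℝ) (p : Total) : ℝ := fderiv ℝ F p v

noncomputable abbrev dt (F : Total → ℝ) : Total → ℝ := D (eb 0, 0) F
noncomputable abbrev dx (F : Total → ℝ) : Total → ℝ := D (eb 1, 0) F
noncomputable abbrev dy (F : Total → ℝ) : Total → ℝ := D (eb 2, 0) F
noncomputable abbrev du (F : Total → ℝ) : Total → ℝ := D (0, ef 0) F
noncomputable abbrev dv (F : Total → ℝ) : Total → ℝ := D (0, ef 1) F
noncomputable abbrev dh (F : Total → ℝ) : Total → ℝ := D (0, ef 2) F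
noncomputable abbrev db (F : Total → ℝ) : Total → ℝ := D (0, ef 3) F

section

variable {N : Set Total} {F G : Total → ℝ} {p : Total} {v w : Total}

@[fun_prop]
lemma contDiffOn_D (hN : IsOpen N) (hF : ContDiffOn ℝ ∞ F N) : ContDiffOn ℝ ∞ (D v F) N :=
  (hF.fderiv_of_isOpen hN (m := ∞) (by simp)).clm_apply contDiffOn_const

lemma ContDiffOn.differentiableAt' (hN : IsOpen N) (hp : p ∈ N) (hF : ContDiffOn ℝ ∞ F N) :
    DifferentiableAt ℝ F p :=
  (hF.contDiffAt (hN.mem_nhds hp)).differentiableAt (by simp)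

lemma D_congr (hN : IsOpen N) (hp : p ∈ N) (h : ∀ q ∈ N, F q = G q) : D v F p = D v G p := by
  have : F =ᶠ[𝓝 p] G := by
    filter_upwards [hN.mem_nhds hp] with q hq using h q hq
  rw [D, D, this.fderiv_eq]

lemma D_const (c : ℝ) : D v (fun _ => c) p = 0 := by simp [D]

lemma D_zero_of_eq (hN : IsOpen N) (hp : p ∈ N) {c : ℝ} (h : ∀ q ∈ N, F q = c) : D v F p = 0 := by
  rw [D_congr hN hp h, D_const]

lemma D_mul (hN : IsOpen N) (hp : p ∈ N) (hF : ContDiffOn ℝ ∞ F N) (hG : ContDiffOn ℝ ∞ G N) :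
    D v (fun q => F q * G q) p = F p * D v G p + G p * D v F p := by
  rw [D, fderiv_fun_mul (ContDiffOn.differentiableAt' hN hp hF)
    (ContDiffOn.differentiableAt' hN hp hG)]
  simp [D]

lemma D_add (hN : IsOpen N) (hp : p ∈ N) (hF : ContDiffOn ℝ ∞ F N) (hG : ContDiffOn ℝ ∞ G N) :
    D v (fun q => F q + G q) p = D v F p + D v G p := by
  rw [D, fderiv_fun_add (ContDiffOn.differentiableAt' hN hp hF)
    (ContDiffOn.differentiableAt' hN hp hG)]
  simp [D]

lemma D_fibre (i : Fin 4) : D v (fun q : Total => q.2 i) p = v.2 i := by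
  have : HasFDerivAt (fun q : Total => q.2 i) ((ContinuousLinearMap.proj (R := ℝ)
    (φ := fun _ : Fin 4 => ℝ) i).comp (ContinuousLinearMap.snd ℝ Base Fibre)) p :=
    ((ContinuousLinearMap.proj (R := ℝ) (φ := fun _ : Fin 4 => ℝ) i).comp
      (ContinuousLinearMap.snd ℝ Base Fibre)).hasFDerivAt
  rw [D, this.fderiv]
  rfl

lemma D_comm (hN : IsOpen N) (hp : p ∈ N) (hF : ContDiffOn ℝ ∞ F N) :
    D v (D w F) p = D w (D v F) p := by
  have hF' : ContDiffAt ℝ ∞ F p := hF.contDiffAt (hN.mem_nhds hp)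
  have hd : DifferentiableAt ℝ (fderiv ℝ F) p :=
    (hF'.fderiv_right (m := ∞) (by simp)).differentiableAt (by simp)
  have key (a b : Total) : D a (D b F) p = fderiv ℝ (fderiv ℝ F) p a b := by
    have := hd.hasFDerivAt.clm_apply (hasFDerivAt_const b p)
    rw [D, show D b F = fun q => fderiv ℝ F q b from rfl, this.fderiv]
    simp
  rw [key, key]
  exact (hF'.isSymmSndFDerivAt (by simp; exact WithTop.coe_le_coe.2 le_top)).eq v w

/-- If `w F` vanishes on `N`, then so do all derivatives of `F` in the direction of `w`. -/
lemma D_D_eq_zero (hN : IsOpen N) (hF : ContDiffOn ℝ ∞ F N) (h : ∀ q ∈ N, D w F q = 0)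
    (v : Total) : ∀ q ∈ N, D w (D v F) q = 0 := fun q hq => by
  rw [D_comm hN hq hF, D_zero_of_eq hN hq h]

end

/-! ### Independence of the new `t`, `x`, `y` from `u`, `v`, `h`, `b`. -/

/-- Points in general position: `u`, `v`, `h` and the transformed velocities do not vanish. -/
def General (U V : Total → ℝ) (p : Total) : Prop :=
  p.2 0 ≠ 0 ∧ p.2 1 ≠ 0 ∧ p.2 2 ≠ 0 ∧ U p ≠ 0 ∧ V p ≠ 0

lemma eq_of_general {N : Set Total} {U V F G : Total → ℝ}
    (hdense : ∀ O ⊆ N, IsOpen O → O.Nonempty → ∃ p ∈ O, General U V p) (hN : IsOpen N)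
    (hF : ContDiffOn ℝ ∞ F N) (hG : ContDiffOn ℝ ∞ G N)
    (h : ∀ p ∈ N, General U V p → F p = G p) : ∀ p ∈ N, F p = G p := by
  intro p hp
  by_contra hne
  have hc : ContinuousOn (fun q => F q - G q) N := hF.continuousOn.sub hG.continuousOn
  obtain ⟨q, hq, hgen⟩ := hdense (N ∩ (fun q => F q - G q) ⁻¹' {0}ᶜ) inter_subset_left
    (hc.isOpen_inter_preimage hN isOpen_compl_singleton) ⟨p, hp, by simpa [sub_eq_zero] using hne⟩
  exact hq.2 (by simpa [sub_eq_zero] using h q hq.1 hgen)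

lemma isOpen_ne_zero {N : Set Total} {F : Total → ℝ} (hN : IsOpen N) (hF : ContDiffOn ℝ ∞ F N) :
    IsOpen {q | q ∈ N ∧ F q ≠ 0} :=
  hF.continuousOn.isOpen_inter_preimage hN isOpen_compl_singleton

/-- What `MapsJets.horizontal` says about the components of a point symmetry. -/
def HorizontalAt (T X Y U V : Total → ℝ) (p : Total) : Prop :=
  (∀ F ∈ ({T, X, Y} : Set (Total → ℝ)), du F p = 0 ∧ dv F p = 0 ∧ dh F p = 0) ∧
  (dt T p ≠ 0 ∨ dt X p ≠ 0 ∨ dt Y p ≠ 0) ∧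
  ((dt X p = 0 ∧ dt Y p = 0 ∧ db X p = U p * db T p ∧ db Y p = V p * db T p ∧
    dt X p + p.2 0 * dx X p + p.2 1 * dy X p =
      U p * (dt T p + p.2 0 * dx T p + p.2 1 * dy T p) ∧
    dt Y p + p.2 0 * dx Y p + p.2 1 * dy Y p =
      V p * (dt T p + p.2 0 * dx T p + p.2 1 * dy T p)) ∨
  (dt X p = U p * dt T p ∧ dt Y p = V p * dt T p ∧ 
    dt X p + p.2 0 * dx X p + p.2 1 * dy X p = 0))

section

variable {N : Set Total} {T X Y U V : Total → ℝ}

lemma horizontal_of_general (hN : IsOpen N)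
    (hT : ContDiffOn ℝ ∞ T N) (hX : ContDiffOn ℝ ∞ X N) (hY : ContDiffOn ℝ ∞ Y N)
    (hU : ContDiffOn ℝ ∞ U N) (hV : ContDiffOn ℝ ∞ V N)
    (hdense : ∀ O ⊆ N, IsOpen O → O.Nonempty → ∃ p ∈ O, General U V p)
    (h : ∀ p ∈ N, General U V p → HorizontalAt T X Y U V p) :
    (∀ p ∈ N, ∀ F ∈ ({T, X, Y} : Set (Total → ℝ)),
      du F p = 0 ∧ dv F p = 0 ∧ dh F p = 0 ∧ db F p = 0) ∧
    (∀ p ∈ N, dt X p = 0) ∧ (∀ p ∈ N, dt Y p = 0) ∧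
    (∀ p ∈ N, p.2 0 * dx X p + p.2 1 * dy X p =
      U p * (dt T p + p.2 0 * dx T p + p.2 1 * dy T p)) ∧
    (∀ p ∈ N, p.2 0 * dx Y p + p.2 1 * dy Y p =
      V p * (dt T p + p.2 0 * dx T p + p.2 1 * dy T p)) := by
  have close {O : Set Total} (hO : IsOpen O) (hON : O ⊆ N) {F G : Total → ℝ}
      (hF : ContDiffOn ℝ ∞ F O) (hG : ContDiffOn ℝ ∞ G O)
      (hFG : ∀ p ∈ O, General U V p → F p = G p) : ∀ p ∈ O, F p = G p :=
    eq_of_general (fun O' hO' => hdense O' (hO'.trans hON)) hO hF hG hFG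
  have vert (F : Total → ℝ) (hF : F ∈ ({T, X, Y} : Set (Total → ℝ))) (hFs : ContDiffOn ℝ ∞ F N) :
      (∀ p ∈ N, du F p = 0) ∧ (∀ p ∈ N, dv F p = 0) ∧ ∀ p ∈ N, dh F p = 0 :=
    ⟨close hN subset_rfl (by fun_prop (disch := assumption)) contDiffOn_const
      fun p hp hg => ((h p hp hg).1 F hF).1,
    close hN subset_rfl (by fun_prop (disch := assumption)) contDiffOn_const
      fun p hp hg => ((h p hp hg).1 F hF).2.1,
    close hN subset_rfl (by fun_prop (disch := assumption)) contDiffOn_const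
      fun p hp hg => ((h p hp hg).1 F hF).2.2⟩
  obtain ⟨uT, vT, hhT⟩ := vert T (by simp) hT
  obtain ⟨uX, vX, hhX⟩ := vert X (by simp) hX
  obtain ⟨uY, vY, hhY⟩ := vert Y (by simp) hY
  -- In the swapped case the new `x` has a nonzero time derivative, so the swap persists on an open
  -- set and `X_t + u X_x + v X_y = 0` there. As `X` does not involve `u` and `v`, all three
  -- derivatives vanish, a contradiction.
  have first : ∀ p ∈ N, General U V p → dt X p = 0 ∧ dt Y p = 0 ∧ db X p = U p * db T p ∧
      db Y p = V p * db T p ∧ dt X p + p.2 0 * dx X p + p.2 1 * dy X p =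
        U p * (dt T p + p.2 0 * dx T p + p.2 1 * dy T p) ∧
      dt Y p + p.2 0 * dx Y p + p.2 1 * dy Y p =
        V p * (dt T p + p.2 0 * dx T p + p.2 1 * dy T p) := by
    intro p₀ hp₀ hg₀
    refine (h p₀ hp₀ hg₀).2.2.resolve_right fun h2 => ?_
    have hne : dt X p₀ ≠ 0 := by
      rw [h2.1]
      refine mul_ne_zero hg₀.2.2.2.1 fun h0 => ?_
      have := (h p₀ hp₀ hg₀).2.1
      rw [h2.1, h2.2.1, h0] at this
      simp at this
    set O := {q | q ∈ N ∧ dt X q ≠ 0} with hOdef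
    have hON : O ⊆ N := fun q hq => hq.1
    have hO : IsOpen O := isOpen_ne_zero hN (by fun_prop (disch := assumption))
    have hXO := hX.mono hON
    have id1 : ∀ q ∈ O, dt X q + q.2 0 * dx X q + q.2 1 * dy X q = 0 := by
      refine close hO hON (by fun_prop (disch := assumption)) contDiffOn_const fun q hq hg => ?_
      rcases (h q hq.1 hg).2.2 with h1 | h1
      · exact absurd h1.1 hq.2
      · exact h1.2.2
    have hp : p₀ ∈ O := ⟨hp₀, hne⟩
    have hu := D_congr (v := (0, ef 0)) hO hp id1
    have hv := D_congr (v := (0, ef 1)) hO hp id1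
    simp (disch := fun_prop (disch := assumption)) only [D_mul hO hp, D_add hO hp, D_fibre,
      D_const] at hu hv
    rw [D_D_eq_zero hN hX uX _ p₀ hp₀, D_D_eq_zero hN hX uX _ p₀ hp₀,
      D_D_eq_zero hN hX uX _ p₀ hp₀] at hu
    rw [D_D_eq_zero hN hX vX _ p₀ hp₀, D_D_eq_zero hN hX vX _ p₀ hp₀,
      D_D_eq_zero hN hX vX _ p₀ hp₀] at hv
    simp at hu hv
    have := id1 p₀ hp
    rw [hu, hv] at this
    exact hne (by simpa using this)
  have tX : ∀ p ∈ N, dt X p = 0 := close hN subset_rfl (by fun_prop (disch := assumption))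
    contDiffOn_const fun p hp hg => (first p hp hg).1
  have tY : ∀ p ∈ N, dt Y p = 0 := close hN subset_rfl (by fun_prop (disch := assumption))
    contDiffOn_const fun p hp hg => (first p hp hg).2.1
  have bX : ∀ p ∈ N, db X p = U p * db T p := close hN subset_rfl
    (by fun_prop (disch := assumption)) (by fun_prop (disch := assumption))
    fun p hp hg => (first p hp hg).2.2.1
  have bY : ∀ p ∈ N, db Y p = V p * db T p := close hN subset_rfl
    (by fun_prop (disch := assumption)) (by fun_prop (disch := assumption))
    fun p hp hg => (first p hp hg).2.2.2.1
  have fX : ∀ p ∈ N, p.2 0 * dx X p + p.2 1 * dy X p =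
      U p * (dt T p + p.2 0 * dx T p + p.2 1 * dy T p) := close hN subset_rfl
    (by fun_prop (disch := assumption)) (by fun_prop (disch := assumption))
    fun p hp hg => by
      have := (first p hp hg).2.2.2.2.1
      rwa [tX p hp, zero_add] at this
  have fY : ∀ p ∈ N, p.2 0 * dx Y p + p.2 1 * dy Y p =
      V p * (dt T p + p.2 0 * dx T p + p.2 1 * dy T p) := close hN subset_rfl
    (by fun_prop (disch := assumption)) (by fun_prop (disch := assumption))
    fun p hp hg => by
      have := (first p hp hg).2.2.2.2.2
      rwa [tY p hp, zero_add] at this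
  -- The `(T, X)`-components of the images of the flow and of the `b`-direction are parallel. The
  -- parallelism is affine in `(u, v)`; its constant term gives `T_t X_b = 0`, and `X_b = U T_b`
  -- with `U ≠ 0` finishes.
  have bT : ∀ p ∈ N, db T p = 0 := by
    refine close hN subset_rfl (by fun_prop (disch := assumption)) contDiffOn_const ?_
    intro p hp hg
    have par : ∀ q ∈ N, (q.2 0 * dx X q + q.2 1 * dy X q) * db T q =
        (dt T q + q.2 0 * dx T q + q.2 1 * dy T q) * db X q := fun q hq => by
      rw [fX q hq, bX q hq]; ring
    have hu := D_congr (v := (0, ef 0)) hN hp par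
    have hv := D_congr (v := (0, ef 1)) hN hp par
    simp (disch := fun_prop (disch := assumption)) only [D_mul hN hp, D_add hN hp, D_fibre] at hu hv
    simp only [D_D_eq_zero hN hX uX _ p hp, D_D_eq_zero hN hT uT _ p hp] at hu
    simp only [D_D_eq_zero hN hX vX _ p hp, D_D_eq_zero hN hT vT _ p hp] at hv
    simp at hu hv
    have h0 := par p hp
    have h1 : dt T p * db X p = 0 := by
      linear_combination p.2 0 * hu + p.2 1 * hv - h0
    have h2 : dt T p ≠ 0 := by
      have := (h p hp hg).2.1
      rw [tX p hp, tY p hp] at this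
      simpa using this
    have h3 := bX p hp
    rw [(mul_eq_zero.1 h1).resolve_left h2] at h3
    exact (mul_eq_zero.1 h3.symm).resolve_left hg.2.2.2.1
  refine ⟨fun p hp F hF => ?_, tX, tY, fX, fY⟩
  simp only [mem_insert_iff, mem_singleton_iff] at hF
  rcases hF with rfl | rfl | rfl
  · exact ⟨uT p hp, vT p hp, hhT p hp, bT p hp⟩
  · exact ⟨uX p hp, vX p hp, hhX p hp, by rw [bX p hp, bT p hp, mul_zero]⟩
  · exact ⟨uY p hp, vY p hp, hhY p hp, by rw [bY p hp, bT p hp, mul_zero]⟩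

end

/-! ### The transformed equations. -/

/-- The derivative along the graph of a function with the derivative `c` in the direction of the
`j`-th of the variables `(t, x, y)`. -/
noncomputable def tot (j : Fin 3) (c : Fibre) (F : Total → ℝ) (p : Total) : ℝ :=
  D (eb j, 0) F p + c 0 * du F p + c 1 * dv F p + c 2 * dh F p + c 3 * db F p

/-- The chain rule for the derivatives `a₀`, `a₁`, `a₂` of a transformed function. -/
def Lifts (T X Y : Total → ℝ) (p : Total) (cx cy : Fibre) (F : Total → ℝ) (a₀ a₁ a₂ : ℝ) : Prop :=
  tot 0 (timeColumn p.2 cx cy) F p = dt T p * a₀ + dt X p * a₁ + dt Y p * a₂ ∧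
  tot 1 cx F p = dx T p * a₀ + dx X p * a₁ + dx Y p * a₂ ∧
  tot 2 cy F p = dy T p * a₀ + dy X p * a₁ + dy Y p * a₂

/-- The derivatives of solutions at `p` are transformed to derivatives of solutions, where the
transformed `t`, `x`, `y` depend on `t`, `x`, `y` only. -/
def VerticalAt (T X Y U V H B : Total → ℝ) (p : Total) : Prop :=
  ∀ cx cy : Fibre, ∃ A₀ A₁ A₂ : Fibre,
    A₀ 0 + U p * A₁ 0 + V p * A₂ 0 + A₁ 2 = A₁ 3 ∧
    A₀ 1 + U p * A₁ 1 + V p * A₂ 1 + A₂ 2 = A₂ 3 ∧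
    A₀ 2 + U p * A₁ 2 + V p * A₂ 2 + H p * (A₁ 0 + A₂ 1) = 0 ∧ A₀ 3 = 0 ∧
    Lifts T X Y p cx cy U (A₀ 0) (A₁ 0) (A₂ 0) ∧ Lifts T X Y p cx cy V (A₀ 1) (A₁ 1) (A₂ 1) ∧
    Lifts T X Y p cx cy H (A₀ 2) (A₁ 2) (A₂ 2) ∧ Lifts T X Y p cx cy B (A₀ 3) (A₁ 3) (A₂ 3)

section pointwise

variable {T X Y U V H B : Total → ℝ} {p : Total}

lemma VerticalAt.steady (h : VerticalAt T X Y U V H B p) (tX : dt X p = 0) (tY : dt Y p = 0)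
    (cx cy : Fibre) : tot 0 (timeColumn p.2 cx cy) B p = 0 := by
  obtain ⟨A₀, A₁, A₂, -, -, -, h4, -, -, -, hB⟩ := h cx cy
  rw [hB.1, tX, tY, h4]; ring

/-- The transformed momentum equations are combined with the weights `(X_x, Y_x)` and `(X_y, Y_y)`,
which turn the new gradient of `H - B` into old derivatives up to a time term. By `fX` and `fY`, the
old derivative along the flow is the new one times the rate of the new time, and this eliminates the
unknown derivatives. -/
lemma VerticalAt.momentum (h : VerticalAt T X Y U V H B p) (tX : dt X p = 0) (tY : dt Y p = 0)
    (fX : p.2 0 * dx X p + p.2 1 * dy X p = U p * (dt T p + p.2 0 * dx T p + p.2 1 * dy T p))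
    (fY : p.2 0 * dx Y p + p.2 1 * dy Y p = V p * (dt T p + p.2 0 * dx T p + p.2 1 * dy T p))
    (cx cy : Fibre) :
    (dt T p + p.2 0 * dx T p + p.2 1 * dy T p) * (dt T p * (tot 1 cx H p - tot 1 cx B p) -
      dx T p * (tot 0 (timeColumn p.2 cx cy) H p - tot 0 (timeColumn p.2 cx cy) B p)) +
    dt T p * (dx X p * (tot 0 (timeColumn p.2 cx cy) U p + p.2 0 * tot 1 cx U p +
        p.2 1 * tot 2 cy U p) +
      dx Y p * (tot 0 (timeColumn p.2 cx cy) V p + p.2 0 * tot 1 cx V p +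
        p.2 1 * tot 2 cy V p)) = 0 ∧
    (dt T p + p.2 0 * dx T p + p.2 1 * dy T p) * (dt T p * (tot 2 cy H p - tot 2 cy B p) -
      dy T p * (tot 0 (timeColumn p.2 cx cy) H p - tot 0 (timeColumn p.2 cx cy) B p)) +
    dt T p * (dy X p * (tot 0 (timeColumn p.2 cx cy) U p + p.2 0 * tot 1 cx U p +
        p.2 1 * tot 2 cy U p) +
      dy Y p * (tot 0 (timeColumn p.2 cx cy) V p + p.2 0 * tot 1 cx V p +
        p.2 1 * tot 2 cy V p)) = 0 := by
  obtain ⟨A₀, A₁, A₂, e1, e2, -, -, ⟨u0, u1, u2⟩, ⟨v0, v1, v2⟩, ⟨h0, h1, h2⟩, ⟨b0, b1, b2⟩⟩ :=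
    h cx cy
  rw [u0, u1, u2, v0, v1, v2, h0, h1, h2, b0, b1, b2, tX, tY]
  set l := dt T p + p.2 0 * dx T p + p.2 1 * dy T p with hl
  constructor
  · linear_combination l * dt T p * dx X p * e1 + l * dt T p * dx Y p * e2 +
      dt T p * (dx X p * A₁ 0 + dx Y p * A₁ 1) * fX + dt T p * (dx X p * A₂ 0 + dx Y p * A₂ 1) * fY -
      (dt T p * dx X p * A₀ 0 + dt T p * dx Y p * A₀ 1) * hl
  · linear_combination l * dt T p * dy X p * e1 + l * dt T p * dy Y p * e2 +
      dt T p * (dy X p * A₁ 0 + dy Y p * A₁ 1) * fX + dt T p * (dy X p * A₂ 0 + dy Y p * A₂ 1) * fY -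
      (dt T p * dy X p * A₀ 0 + dt T p * dy Y p * A₀ 1) * hl

/-- Once the new time depends on `t` only, the transformed divergence is found by Cramer's rule;
multiplying by the spatial Jacobian clears its denominator. -/
lemma VerticalAt.continuity (h : VerticalAt T X Y U V H B p) (tX : dt X p = 0) (tY : dt Y p = 0)
    (xT : dx T p = 0) (yT : dy T p = 0)
    (fX : p.2 0 * dx X p + p.2 1 * dy X p = U p * dt T p)
    (fY : p.2 0 * dx Y p + p.2 1 * dy Y p = V p * dt T p) (cx cy : Fibre) :
    (dx X p * dy Y p - dy X p * dx Y p) * (tot 0 (timeColumn p.2 cx cy) H p +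
      p.2 0 * tot 1 cx H p + p.2 1 * tot 2 cy H p) +
    dt T p * H p * (dy Y p * tot 1 cx U p - dx Y p * tot 2 cy U p - dy X p * tot 1 cx V p +
      dx X p * tot 2 cy V p) = 0 := by
  obtain ⟨A₀, A₁, A₂, -, -, e3, -, ⟨u0, u1, u2⟩, ⟨v0, v1, v2⟩, ⟨h0, h1, h2⟩, -⟩ := h cx cy
  rw [u1, u2, v1, v2, h0, h1, h2, tX, tY, xT, yT]
  linear_combination (dx X p * dy Y p - dy X p * dx Y p) * dt T p * e3 +
    (dx X p * dy Y p - dy X p * dx Y p) * (A₁ 2 * fX + A₂ 2 * fY)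

end pointwise

/-! ### Polynomial identities in `u`, `v`, `h`. -/

/-- Smooth functions on `N` that do not depend on `u`, `v`, `h`. -/
structure IsBasic (N : Set Total) (F : Total → ℝ) : Prop where
  smooth : ContDiffOn ℝ ∞ F N
  du : ∀ q ∈ N, D (0, ef 0) F q = 0
  dv : ∀ q ∈ N, D (0, ef 1) F q = 0
  dh : ∀ q ∈ N, D (0, ef 2) F q = 0

namespace IsBasic

variable {N : Set Total} {F G : Total → ℝ}

lemma deriv (hN : IsOpen N) (h : IsBasic N F) (v : Total) : IsBasic N (D v F) :=
  ⟨contDiffOn_D hN h.smooth, D_D_eq_zero hN h.smooth h.du v, D_D_eq_zero hN h.smooth h.dv v,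
    D_D_eq_zero hN h.smooth h.dh v⟩

lemma mul (hN : IsOpen N) (hF : IsBasic N F) (hG : IsBasic N G) :
    IsBasic N (fun q => F q * G q) :=
  ⟨hF.smooth.mul hG.smooth,
    fun q hq => by
      rw [D_mul hN hq hF.smooth hG.smooth, hF.du q hq, hG.du q hq]; simp,
    fun q hq => by
      rw [D_mul hN hq hF.smooth hG.smooth, hF.dv q hq, hG.dv q hq]; simp,
    fun q hq => by
      rw [D_mul hN hq hF.smooth hG.smooth, hF.dh q hq, hG.dh q hq]; simp⟩

lemma add (hN : IsOpen N) (hF : IsBasic N F) (hG : IsBasic N G) :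
    IsBasic N (fun q => F q + G q) :=
  ⟨hF.smooth.add hG.smooth,
    fun q hq => by
      rw [D_add hN hq hF.smooth hG.smooth, hF.du q hq, hG.du q hq]; simp,
    fun q hq => by
      rw [D_add hN hq hF.smooth hG.smooth, hF.dv q hq, hG.dv q hq]; simp,
    fun q hq => by
      rw [D_add hN hq hF.smooth hG.smooth, hF.dh q hq, hG.dh q hq]; simp⟩

end IsBasic

/-- A quadratic polynomial in the velocity, affine in `h`, whose coefficients do not depend on
`u`, `v`, `h`, vanishes only if its coefficients do. -/
lemma coefficients_eq_zero {N : Set Total} {a b c₁ c₂ c₃ : Total → ℝ} (hN : IsOpen N)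
    (ha : IsBasic N a) (hb : IsBasic N b) (h₁ : IsBasic N c₁) (h₂ : IsBasic N c₂)
    (h₃ : IsBasic N c₃)
    (h : ∀ q ∈ N, q.2 2 * a q + b q + q.2 0 * q.2 0 * c₁ q + q.2 0 * q.2 1 * c₂ q +
      q.2 1 * q.2 1 * c₃ q = 0) {q : Total} (hq : q ∈ N) :
    b q = 0 ∧ c₁ q = 0 ∧ c₂ q = 0 ∧ c₃ q = 0 := by
  have as := ha.smooth
  have bs := hb.smooth
  have s1 := h₁.smooth
  have s2 := h₂.smooth
  have s3 := h₃.smooth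
  have hh : ∀ q ∈ N, a q = 0 := fun q hq => by
    have := D_congr (v := (0, ef 2)) hN hq h
    simp (disch := fun_prop (disch := assumption)) only [D_mul hN hq, D_add hN hq, D_fibre,
      ha.dh q hq, hb.dh q hq, h₁.dh q hq, h₂.dh q hq, h₃.dh q hq, D_const] at this
    simpa using this
  have hu : ∀ q ∈ N, 2 * (q.2 0 * c₁ q) + q.2 1 * c₂ q = 0 := fun q hq => by
    have := D_congr (v := (0, ef 0)) hN hq h
    simp (disch := fun_prop (disch := assumption)) only [D_mul hN hq, D_add hN hq, D_fibre,
      ha.du q hq, hb.du q hq, h₁.du q hq, h₂.du q hq, h₃.du q hq, D_const] at this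
    simp at this
    linear_combination this
  have hv : ∀ q ∈ N, 2 * (q.2 1 * c₃ q) + q.2 0 * c₂ q = 0 := fun q hq => by
    have := D_congr (v := (0, ef 1)) hN hq h
    simp (disch := fun_prop (disch := assumption)) only [D_mul hN hq, D_add hN hq, D_fibre,
      ha.dv q hq, hb.dv q hq, h₁.dv q hq, h₂.dv q hq, h₃.dv q hq, D_const] at this
    simp at this
    linear_combination this
  have e1 : c₁ q = 0 := by
    have := D_congr (v := (0, ef 0)) hN hq hu
    simp (disch := fun_prop (disch := assumption)) only [D_mul hN hq, D_add hN hq, D_fibre,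
      h₁.du q hq, h₂.du q hq, D_const] at this
    simpa using this
  have e2 : c₂ q = 0 := by
    have := D_congr (v := (0, ef 1)) hN hq hu
    simp (disch := fun_prop (disch := assumption)) only [D_mul hN hq, D_add hN hq, D_fibre,
      h₁.dv q hq, h₂.dv q hq, D_const] at this
    simpa using this
  have e3 : c₃ q = 0 := by
    have := D_congr (v := (0, ef 1)) hN hq hv
    simp (disch := fun_prop (disch := assumption)) only [D_mul hN hq, D_add hN hq, D_fibre,
      h₃.dv q hq, h₂.dv q hq, D_const] at this
    simpa using this
  have := h q hq
  rw [hh q hq, e1, e2, e3] at this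
  exact ⟨by linarith, e1, e2, e3⟩

/-! ### Determination of the components. -/

/-- A transformation of solutions for which the transformed `t`, `x`, `y` depend on `t`, `x`, `y`
only, with smooth components. -/
structure IsFibered (N : Set Total) (T X Y U V H B : Total → ℝ) : Prop where
  isOpen : IsOpen N
  T_smooth : ContDiffOn ℝ ∞ T N
  X_smooth : ContDiffOn ℝ ∞ X N
  Y_smooth : ContDiffOn ℝ ∞ Y N
  U_smooth : ContDiffOn ℝ ∞ U N
  V_smooth : ContDiffOn ℝ ∞ V N
  H_smooth : ContDiffOn ℝ ∞ H N
  B_smooth : ContDiffOn ℝ ∞ B N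
  dense : ∀ O ⊆ N, IsOpen O → O.Nonempty → ∃ p ∈ O, General U V p
  basic : ∀ p ∈ N, ∀ F ∈ ({T, X, Y} : Set (Total → ℝ)),
      du F p = 0 ∧ dv F p = 0 ∧ dh F p = 0 ∧ db F p = 0
  dt_X : ∀ p ∈ N, dt X p = 0
  dt_Y : ∀ p ∈ N, dt Y p = 0
  flow_X : ∀ p ∈ N, p.2 0 * dx X p + p.2 1 * dy X p =
      U p * (dt T p + p.2 0 * dx T p + p.2 1 * dy T p)
  flow_Y : ∀ p ∈ N, p.2 0 * dx Y p + p.2 1 * dy Y p =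
      V p * (dt T p + p.2 0 * dx T p + p.2 1 * dy T p)
  nondegenerate : ∀ p ∈ N, ∀ a b c : ℝ, a * dt T p + b * dx T p + c * dy T p = 0 →
    b * dx X p + c * dy X p = 0 → b * dx Y p + c * dy Y p = 0 → a = 0 ∧ b = 0 ∧ c = 0
  immersive : ∀ p ∈ N, dh U p = 0 → dh V p = 0 → dh B p = 0 → dh H p ≠ 0
  vertical : ∀ p ∈ N, VerticalAt T X Y U V H B p

namespace IsFibered

variable {N : Set Total} {T X Y U V H B : Total → ℝ} {p : Total}

lemma eq_of_general (hf : IsFibered N T X Y U V H B) {F G : Total → ℝ}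
    (hF : ContDiffOn ℝ ∞ F N) (hG : ContDiffOn ℝ ∞ G N)
    (h : ∀ p ∈ N, General U V p → F p = G p) : ∀ p ∈ N, F p = G p :=
  ShallowWater.eq_of_general hf.dense hf.isOpen hF hG h

lemma isBasic_T (hf : IsFibered N T X Y U V H B) : IsBasic N T :=
  ⟨hf.T_smooth, fun q hq => (hf.basic q hq T (by simp)).1,
    fun q hq => (hf.basic q hq T (by simp)).2.1, fun q hq => (hf.basic q hq T (by simp)).2.2.1⟩

lemma isBasic_X (hf : IsFibered N T X Y U V H B) : IsBasic N X :=
  ⟨hf.X_smooth, fun q hq => (hf.basic q hq X (by simp)).1,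
    fun q hq => (hf.basic q hq X (by simp)).2.1, fun q hq => (hf.basic q hq X (by simp)).2.2.1⟩

lemma isBasic_Y (hf : IsFibered N T X Y U V H B) : IsBasic N Y :=
  ⟨hf.Y_smooth, fun q hq => (hf.basic q hq Y (by simp)).1,
    fun q hq => (hf.basic q hq Y (by simp)).2.1, fun q hq => (hf.basic q hq Y (by simp)).2.2.1⟩

lemma dt_T_ne_zero (hf : IsFibered N T X Y U V H B) (hp : p ∈ N) : dt T p ≠ 0 := fun h => by
  have := hf.nondegenerate p hp 1 0 0 (by rw [h]; ring) (by ring) (by ring)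
  exact one_ne_zero this.1

lemma jacobian_ne_zero (hf : IsFibered N T X Y U V H B) (hp : p ∈ N) :
    dx X p * dy Y p - dy X p * dx Y p ≠ 0 := fun h => by
  have ht := hf.dt_T_ne_zero hp
  have key (b c : ℝ) := hf.nondegenerate p hp (-(b * dx T p + c * dy T p) / dt T p) b c
    (by field_simp; ring)
  have h1 := key (dy X p) (-dx X p) (by ring) (by linarith)
  have h2 := key (dy Y p) (-dx Y p) (by linarith) (by ring)
  have h3 := key 1 0 (by linarith [h1.2.2]) (by linarith [h2.2.2])
  exact one_ne_zero h3.2.1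

lemma speed_ne_zero (hf : IsFibered N T X Y U V H B) (hp : p ∈ N) :
    dt T p + p.2 0 * dx T p + p.2 1 * dy T p ≠ 0 := fun h => by
  have h1 := hf.flow_X p hp
  have h2 := hf.flow_Y p hp
  rw [h, mul_zero] at h1 h2
  exact one_ne_zero (hf.nondegenerate p hp 1 (p.2 0) (p.2 1) (by linarith) h1 h2).1

/-- Because the new `x` and `y` are independent of `t`, the steadiness of the new bottom says that
`B` has zero total time derivative. The time derivatives of `u`, `v`, `h` can be chosen so as to
isolate each partial derivative. -/
lemma dB (hf : IsFibered N T X Y U V H B) :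
    (∀ p ∈ N, dt B p = 0) ∧ (∀ p ∈ N, du B p = 0) ∧ (∀ p ∈ N, dv B p = 0) ∧
      ∀ p ∈ N, dh B p = 0 := by
  have key (p : Total) (hp : p ∈ N) :=
    (hf.vertical p hp).steady (hf.dt_X p hp) (hf.dt_Y p hp)
  have ht : ∀ p ∈ N, dt B p = 0 := fun p hp => by
    have := key p hp 0 0
    simpa [tot, timeColumn] using this
  have hu : ∀ p ∈ N, du B p = 0 := fun p hp => by
    have := key p hp (ef 3) 0
    simpa [tot, timeColumn, ht p hp] using this
  have hv : ∀ p ∈ N, dv B p = 0 := fun p hp => by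
    have := key p hp 0 (ef 3)
    simpa [tot, timeColumn, ht p hp] using this
  refine ⟨ht, hu, hv, ?_⟩
  refine hf.eq_of_general (contDiffOn_D hf.isOpen hf.B_smooth) contDiffOn_const fun p hp hg => ?_
  have := key p hp (ef 0) 0
  simpa [tot, timeColumn, ht p hp, hu p hp, hg.2.2.1] using this

/-- The coefficients of `flow_X` depend on `t`, `x`, `y` only, so differentiating it in the fibre
directions determines the fibre derivatives of `U`; the factor of `dh U` and `db U` is
`speed_ne_zero`. -/
lemma dU (hf : IsFibered N T X Y U V H B) (hp : p ∈ N) :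
    (dt T p + p.2 0 * dx T p + p.2 1 * dy T p) * du U p + dx T p * U p = dx X p ∧
    (dt T p + p.2 0 * dx T p + p.2 1 * dy T p) * dv U p + dy T p * U p = dy X p ∧
    dh U p = 0 ∧ db U p = 0 := by
  have hN := hf.isOpen
  have hT := hf.T_smooth
  have hX := hf.X_smooth
  have hU := hf.U_smooth
  have bT := (fun q hq => (hf.basic q hq T (by simp)).2.2.2 : ∀ q ∈ N, db T q = 0)
  have bX := (fun q hq => (hf.basic q hq X (by simp)).2.2.2 : ∀ q ∈ N, db X q = 0)
  have hu := D_congr (v := (0, ef 0)) hN hp hf.flow_X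
  have hv := D_congr (v := (0, ef 1)) hN hp hf.flow_X
  have hh := D_congr (v := (0, ef 2)) hN hp hf.flow_X
  have hb := D_congr (v := (0, ef 3)) hN hp hf.flow_X
  have iT := fun v => hf.isBasic_T.deriv hN v
  have iX := fun v => hf.isBasic_X.deriv hN v
  simp (disch := fun_prop (disch := assumption)) only [D_mul hN hp, D_add hN hp, D_fibre,
    (iT _).du p hp, (iX _).du p hp, (iT _).dv p hp, (iX _).dv p hp, (iT _).dh p hp,
    (iX _).dh p hp, D_D_eq_zero hN hT bT _ p hp, D_D_eq_zero hN hX bX _ p hp] at hu hv hh hb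
  simp [hf.speed_ne_zero hp] at hu hv hh hb
  exact ⟨by linarith, by linarith, hh, hb⟩

lemma dV (hf : IsFibered N T X Y U V H B) (hp : p ∈ N) :
    (dt T p + p.2 0 * dx T p + p.2 1 * dy T p) * du V p + dx T p * V p = dx Y p ∧
    (dt T p + p.2 0 * dx T p + p.2 1 * dy T p) * dv V p + dy T p * V p = dy Y p ∧
    dh V p = 0 ∧ db V p = 0 := by
  have hN := hf.isOpen
  have hT := hf.T_smooth
  have hY := hf.Y_smooth
  have hV := hf.V_smooth
  have bT := (fun q hq => (hf.basic q hq T (by simp)).2.2.2 : ∀ q ∈ N, db T q = 0)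
  have bY := (fun q hq => (hf.basic q hq Y (by simp)).2.2.2 : ∀ q ∈ N, db Y q = 0)
  have hu := D_congr (v := (0, ef 0)) hN hp hf.flow_Y
  have hv := D_congr (v := (0, ef 1)) hN hp hf.flow_Y
  have hh := D_congr (v := (0, ef 2)) hN hp hf.flow_Y
  have hb := D_congr (v := (0, ef 3)) hN hp hf.flow_Y
  have iT := fun v => hf.isBasic_T.deriv hN v
  have iY := fun v => hf.isBasic_Y.deriv hN v
  simp (disch := fun_prop (disch := assumption)) only [D_mul hN hp, D_add hN hp, D_fibre,
    (iT _).du p hp, (iY _).du p hp, (iT _).dv p hp, (iY _).dv p hp, (iT _).dh p hp,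
    (iY _).dh p hp, D_D_eq_zero hN hT bT _ p hp, D_D_eq_zero hN hY bY _ p hp] at hu hv hh hb
  simp [hf.speed_ne_zero hp] at hu hv hh hb
  exact ⟨by linarith, by linarith, hh, hb⟩

lemma dh_H_ne_zero (hf : IsFibered N T X Y U V H B) (hp : p ∈ N) : dh H p ≠ 0 :=
  hf.immersive p hp (hf.dU hp).2.2.1 (hf.dV hp).2.2.1 (hf.dB.2.2.2 p hp)

/-- The transformed time depends on the time only. -/
lemma dT (hf : IsFibered N T X Y U V H B) :
    (∀ p ∈ N, dx T p = 0) ∧ (∀ p ∈ N, dy T p = 0) ∧ (∀ p ∈ N, du H p = 0) ∧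
      ∀ p ∈ N, dv H p = 0 := by
  have key : ∀ p ∈ N, General U V p → dx T p = 0 ∧ dy T p = 0 ∧ du H p = 0 ∧ dv H p = 0 := by
    intro p hp hg
    obtain ⟨hu, hv, hh, -, -⟩ := hg
    have hl := hf.speed_ne_zero hp
    have M := (hf.vertical p hp).momentum (hf.dt_X p hp) (hf.dt_Y p hp) (hf.flow_X p hp)
      (hf.flow_Y p hp)
    -- Subtracting the equations for zero derivatives leaves the response to a single one, here
    -- `u_y`, `v_x` and `u_x`. The first two give that `H` is independent of `u`, `v`; then `u_x`
    -- enters only through the time derivative of `h`, multiplied by `T_x` or `T_y`.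
    obtain ⟨x0, y0⟩ := M ![0, 0, 0, 0] ![0, 0, 0, 0]
    obtain ⟨x1, y1⟩ := M ![0, 0, 0, 0] ![1, 0, 0, 0]
    obtain ⟨x2, y2⟩ := M ![0, 1, 0, 0] ![0, 0, 0, 0]
    obtain ⟨x3, y3⟩ := M ![1, 0, 0, 0] ![0, 0, 0, 0]
    simp only [tot, timeColumn, Matrix.cons_val, hf.dB.1 p hp, hf.dB.2.1 p hp, hf.dB.2.2.1 p hp,
      hf.dB.2.2.2 p hp, (hf.dU hp).2.2.1, (hf.dV hp).2.2.1] at x0 y0 x1 y1 x2 y2 x3 y3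
    set l := dt T p + p.2 0 * dx T p + p.2 1 * dy T p with hldef
    have a1 : l * (p.2 1 * (dx T p * du H p)) = 0 := by linear_combination x1 - x0
    have a2 : l * ((dt T p + p.2 1 * dy T p) * du H p) = 0 := by linear_combination y1 - y0
    have a3 : l * ((dt T p + p.2 0 * dx T p) * dv H p) = 0 := by linear_combination x2 - x0
    have a4 : l * (p.2 0 * (dy T p * dv H p)) = 0 := by linear_combination y2 - y0
    have b1 := (mul_eq_zero.1 ((mul_eq_zero.1 a1).resolve_left hl)).resolve_left hv
    have b2 := (mul_eq_zero.1 a2).resolve_left hl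
    have b3 := (mul_eq_zero.1 a3).resolve_left hl
    have b4 := (mul_eq_zero.1 ((mul_eq_zero.1 a4).resolve_left hl)).resolve_left hu
    have uH : du H p = 0 := by
      refine (mul_eq_zero.1 (?_ : l * du H p = 0)).resolve_left hl
      rw [hldef]; linear_combination b2 + p.2 0 * b1
    have vH : dv H p = 0 := by
      refine (mul_eq_zero.1 (?_ : l * dv H p = 0)).resolve_left hl
      rw [hldef]; linear_combination b3 + p.2 1 * b4
    have hne : l * (p.2 2 * dh H p) ≠ 0 := mul_ne_zero hl (mul_ne_zero hh (hf.dh_H_ne_zero hp))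
    refine ⟨(mul_eq_zero.1 (?_ : dx T p * (l * (p.2 2 * dh H p)) = 0)).resolve_right hne,
      (mul_eq_zero.1 (?_ : dy T p * (l * (p.2 2 * dh H p)) = 0)).resolve_right hne, uH, vH⟩
    · linear_combination x3 - x0 - l * (dt T p + dx T p * p.2 0) * uH
    · linear_combination y3 - y0 - l * dy T p * p.2 0 * uH
  have hT := hf.T_smooth
  have hH := hf.H_smooth
  have hN := hf.isOpen
  exact ⟨hf.eq_of_general (contDiffOn_D hN hT) contDiffOn_const fun p hp hg => (key p hp hg).1,
    hf.eq_of_general (contDiffOn_D hN hT) contDiffOn_const fun p hp hg => (key p hp hg).2.1,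
    hf.eq_of_general (contDiffOn_D hN hH) contDiffOn_const fun p hp hg => (key p hp hg).2.2.1,
    hf.eq_of_general (contDiffOn_D hN hH) contDiffOn_const fun p hp hg => (key p hp hg).2.2.2⟩

end IsFibered

namespace IsFibered

variable {N : Set Total} {T X Y U V H B : Total → ℝ} {p : Total}

lemma velocity (hf : IsFibered N T X Y U V H B) (hp : p ∈ N) :
    p.2 0 * dx X p + p.2 1 * dy X p = U p * dt T p ∧
    p.2 0 * dx Y p + p.2 1 * dy Y p = V p * dt T p := by
  have h1 := hf.flow_X p hp
  have h2 := hf.flow_Y p hp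
  rw [hf.dT.1 p hp, hf.dT.2.1 p hp] at h1 h2
  exact ⟨by linarith, by linarith⟩

lemma dU' (hf : IsFibered N T X Y U V H B) (hp : p ∈ N) :
    dt T p * du U p = dx X p ∧ dt T p * dv U p = dy X p ∧
    dt T p * du V p = dx Y p ∧ dt T p * dv V p = dy Y p := by
  have h1 := hf.dU hp
  have h2 := hf.dV hp
  rw [hf.dT.1 p hp, hf.dT.2.1 p hp] at h1 h2
  exact ⟨by linarith, by linarith, by linarith, by linarith⟩

/-- The spatial part of the transformation is conformal. -/
lemma conformal (hf : IsFibered N T X Y U V H B) (hp : p ∈ N) :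
    dx X p * dy X p + dx Y p * dy Y p = 0 ∧
    dy X p * dy X p + dy Y p * dy Y p = dx X p * dx X p + dx Y p * dx Y p ∧
    dt T p * dt T p * dh H p = dx X p * dx X p + dx Y p * dx Y p ∧
    dt T p * dt T p * (db H p - db B p) = -(dx X p * dx X p + dx Y p * dx Y p) := by
  have ht := hf.dt_T_ne_zero hp
  have M := (hf.vertical p hp).momentum (hf.dt_X p hp) (hf.dt_Y p hp) (hf.flow_X p hp)
    (hf.flow_Y p hp)
  -- The responses to `h_x`, `h_y` and `b_x`: the pressure gradient must balance the acceleration in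
  -- every direction of the plane, which makes the Jacobian matrix a multiple of an orthogonal one.
  obtain ⟨x0, y0⟩ := M ![0, 0, 0, 0] ![0, 0, 0, 0]
  obtain ⟨x1, -⟩ := M ![0, 0, 1, 0] ![0, 0, 0, 0]
  obtain ⟨x2, y2⟩ := M ![0, 0, 0, 0] ![0, 0, 1, 0]
  obtain ⟨x3, -⟩ := M ![0, 0, 0, 1] ![0, 0, 0, 0]
  obtain ⟨u1, u2, u3, u4⟩ := hf.dU' hp
  simp only [tot, timeColumn, Matrix.cons_val, hf.dB.1 p hp, hf.dB.2.1 p hp, hf.dB.2.2.1 p hp,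
    hf.dB.2.2.2 p hp, (hf.dU hp).2.2.1, (hf.dV hp).2.2.1, (hf.dU hp).2.2.2, (hf.dV hp).2.2.2,
    hf.dT.1 p hp, hf.dT.2.1 p hp, hf.dT.2.2.1 p hp, hf.dT.2.2.2 p hp]
    at x0 y0 x1 x2 y2 x3
  have c1 : dx X p * dy X p + dx Y p * dy Y p = 0 := by
    linear_combination x0 - x2 - dx X p * u2 - dx Y p * u4
  have c2 : dt T p * dt T p * dh H p = dx X p * dx X p + dx Y p * dx Y p := by
    linear_combination x1 - x0 + dx X p * u1 + dx Y p * u3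
  have c3 : dt T p * dt T p * dh H p = dy X p * dy X p + dy Y p * dy Y p := by
    linear_combination y2 - y0 + dy X p * u2 + dy Y p * u4
  refine ⟨c1, by linarith, c2, ?_⟩
  linear_combination x3 - x0 - dx X p * u1 - dx Y p * u3

/-- The response of the continuity equation to `u_x` is `H = h H_h`, and `conformal` supplies `H_h`.
-/
lemma height (hf : IsFibered N T X Y U V H B) :
    ∀ p ∈ N, H p * (dt T p * dt T p) = p.2 2 * (dx X p * dx X p + dx Y p * dx Y p) := by
  intro p hp
  have ht := hf.dt_T_ne_zero hp
  have C := (hf.vertical p hp).continuity (hf.dt_X p hp) (hf.dt_Y p hp) (hf.dT.1 p hp)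
    (hf.dT.2.1 p hp) (hf.velocity hp).1 (hf.velocity hp).2
  have c0 := C ![0, 0, 0, 0] ![0, 0, 0, 0]
  have c1 := C ![1, 0, 0, 0] ![0, 0, 0, 0]
  obtain ⟨u1, u2, u3, u4⟩ := hf.dU' hp
  simp only [tot, timeColumn, Matrix.cons_val, hf.dT.2.2.1 p hp, hf.dT.2.2.2 p hp] at c0 c1
  have h1 : H p = p.2 2 * dh H p := by
    refine mul_left_cancel₀ (hf.jacobian_ne_zero hp) ?_
    linear_combination c1 - c0 - H p * dy Y p * u1 + H p * dy X p * u3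
  rw [h1, ← (hf.conformal hp).2.2.1]
  ring

/-- The continuity equation responds to `b_x` only through `u H_b`, so `H_b = 0` where `u ≠ 0`; the
last relation of `conformal` then yields `B_b`. -/
lemma dB' (hf : IsFibered N T X Y U V H B) :
    ∀ p ∈ N, db B p * (dt T p * dt T p) = dx X p * dx X p + dx Y p * dx Y p := by
  have hN := hf.isOpen
  have hT := hf.T_smooth
  have hX := hf.X_smooth
  have hY := hf.Y_smooth
  have hB := hf.B_smooth
  refine hf.eq_of_general (by fun_prop (disch := assumption)) (by fun_prop (disch := assumption))
    fun p hp hg => ?_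
  have C := (hf.vertical p hp).continuity (hf.dt_X p hp) (hf.dt_Y p hp) (hf.dT.1 p hp)
    (hf.dT.2.1 p hp) (hf.velocity hp).1 (hf.velocity hp).2
  have c0 := C ![0, 0, 0, 0] ![0, 0, 0, 0]
  have c1 := C ![0, 0, 0, 1] ![0, 0, 0, 0]
  simp only [tot, timeColumn, Matrix.cons_val, hf.dT.2.2.1 p hp, hf.dT.2.2.2 p hp,
    (hf.dU hp).2.2.2, (hf.dV hp).2.2.2] at c0 c1
  have h1 : db H p = 0 := by
    have : (dx X p * dy Y p - dy X p * dx Y p) * p.2 0 * db H p = 0 := by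
      linear_combination c1 - c0
    exact (mul_eq_zero.1 this).resolve_left (mul_ne_zero (hf.jacobian_ne_zero hp) hg.1)
  have := (hf.conformal hp).2.2.2
  rw [h1] at this
  linarith

lemma scale_ne_zero (hf : IsFibered N T X Y U V H B) (hp : p ∈ N) :
    dx X p * dx X p + dx Y p * dx Y p ≠ 0 := by
  rw [← (hf.conformal hp).2.2.1]
  have := hf.dt_T_ne_zero hp
  exact mul_ne_zero (mul_ne_zero this this) (hf.dh_H_ne_zero hp)

/-- In `dB'` the scale and the nonzero factor `B_b` are independent of `t`, hence so is `T_t ^ 2`.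
-/
lemma dt_dt_T (hf : IsFibered N T X Y U V H B) : ∀ p ∈ N, dt (dt T) p = 0 := by
  intro p hp
  have hN := hf.isOpen
  have hT := hf.T_smooth
  have hX := hf.X_smooth
  have hY := hf.Y_smooth
  have hB := hf.B_smooth
  have h := D_congr (v := (eb 0, 0)) hN hp hf.dB'
  simp (disch := fun_prop (disch := assumption)) only [D_mul hN hp, D_add hN hp,
    D_D_eq_zero hN hB hf.dB.1 _ p hp, D_D_eq_zero hN hX hf.dt_X _ p hp,
    D_D_eq_zero hN hY hf.dt_Y _ p hp] at h
  have ht := hf.dt_T_ne_zero hp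
  have hb : db B p ≠ 0 := fun h0 => by
    have := hf.dB' p hp
    rw [h0, zero_mul] at this
    exact hf.scale_ne_zero hp this.symm
  have : db B p * dt T p * dt (dt T) p = 0 := by linear_combination h / 2
  exact (mul_eq_zero.1 this).resolve_left (mul_ne_zero hb ht)

/-- The part of the momentum equations that does not depend on the derivatives of the solution. -/
lemma free_momentum (hf : IsFibered N T X Y U V H B) (hp : p ∈ N) :
    dt T p * dt T p * (dx H p - dx B p) +
      dx X p * (p.2 0 * p.2 0 * dx (dx X) p + 2 * p.2 0 * p.2 1 * dx (dy X) p +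
        p.2 1 * p.2 1 * dy (dy X) p) +
      dx Y p * (p.2 0 * p.2 0 * dx (dx Y) p + 2 * p.2 0 * p.2 1 * dx (dy Y) p +
        p.2 1 * p.2 1 * dy (dy Y) p) = 0 ∧
    dt T p * dt T p * (dy H p - dy B p) +
      dy X p * (p.2 0 * p.2 0 * dx (dx X) p + 2 * p.2 0 * p.2 1 * dx (dy X) p +
        p.2 1 * p.2 1 * dy (dy X) p) +
      dy Y p * (p.2 0 * p.2 0 * dx (dx Y) p + 2 * p.2 0 * p.2 1 * dx (dy Y) p +
        p.2 1 * p.2 1 * dy (dy Y) p) = 0 := by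
  have hN := hf.isOpen
  have hT := hf.T_smooth
  have hX := hf.X_smooth
  have hY := hf.Y_smooth
  have hU := hf.U_smooth
  have hV := hf.V_smooth
  have ht := hf.dt_T_ne_zero hp
  -- As `T_t` has zero derivatives in `t`, `x` and `y`, differentiating `velocity` turns first
  -- derivatives of `U`, `V` into second derivatives of `X`, `Y`.
  have key {F Z : Total → ℝ} (hF : ContDiffOn ℝ ∞ F N) (hZ : ContDiffOn ℝ ∞ Z N)
      (tZ : ∀ q ∈ N, dt Z q = 0)
      (h : ∀ q ∈ N, q.2 0 * dx Z q + q.2 1 * dy Z q = F q * dt T q) :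
      dt F p = 0 ∧ dt T p * dx F p = p.2 0 * dx (dx Z) p + p.2 1 * dx (dy Z) p ∧
        dt T p * dy F p = p.2 0 * dx (dy Z) p + p.2 1 * dy (dy Z) p := by
    have h1 := D_congr (v := (eb 0, 0)) hN hp h
    have h2 := D_congr (v := (eb 1, 0)) hN hp h
    have h3 := D_congr (v := (eb 2, 0)) hN hp h
    simp (disch := fun_prop (disch := assumption)) only [D_mul hN hp, D_add hN hp, D_fibre,
      D_D_eq_zero hN hZ tZ _ p hp, hf.dt_dt_T p hp, D_D_eq_zero hN hT hf.dT.1 _ p hp,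
      D_D_eq_zero hN hT hf.dT.2.1 _ p hp] at h1 h2 h3
    rw [D_comm (v := (eb 2, 0)) (w := (eb 1, 0)) hN hp hZ] at h3
    simp [ht] at h1 h2 h3
    exact ⟨h1, by linear_combination -h2, by linear_combination -h3⟩
  obtain ⟨a1, a2, a3⟩ := key hU hX hf.dt_X fun q hq => (hf.velocity hq).1
  obtain ⟨b1, b2, b3⟩ := key hV hY hf.dt_Y fun q hq => (hf.velocity hq).2
  obtain ⟨x0, y0⟩ := (hf.vertical p hp).momentum (hf.dt_X p hp) (hf.dt_Y p hp) (hf.flow_X p hp)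
    (hf.flow_Y p hp) ![0, 0, 0, 0] ![0, 0, 0, 0]
  simp only [tot, timeColumn, Matrix.cons_val, hf.dB.1 p hp, a1, b1, hf.dT.1 p hp,
    hf.dT.2.1 p hp] at x0 y0
  constructor
  · linear_combination x0 - dx X p * (p.2 0 * a2 + p.2 1 * a3) -
      dx Y p * (p.2 0 * b2 + p.2 1 * b3)
  · linear_combination y0 - dy X p * (p.2 0 * a2 + p.2 1 * a3) -
      dy Y p * (p.2 0 * b2 + p.2 1 * b3)

/-- The second derivatives of the spatial part and the spatial derivatives of the transformed
bottom topography vanish. -/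
lemma affine (hf : IsFibered N T X Y U V H B) (hp : p ∈ N) :
    (dx B p = 0 ∧ dy B p = 0) ∧ (dx (dx X) p = 0 ∧ dx (dy X) p = 0 ∧ dy (dy X) p = 0) ∧
      dx (dx Y) p = 0 ∧ dx (dy Y) p = 0 ∧ dy (dy Y) p = 0 := by
  have hN := hf.isOpen
  have hT := hf.T_smooth
  have hX := hf.X_smooth
  have hY := hf.Y_smooth
  have hH := hf.H_smooth
  have hB := hf.B_smooth
  have bT := fun v => hf.isBasic_T.deriv hN v
  have bX := fun v => hf.isBasic_X.deriv hN v
  have bY := fun v => hf.isBasic_Y.deriv hN v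
  have bB : IsBasic N B := ⟨hB, hf.dB.2.1, hf.dB.2.2.1, hf.dB.2.2.2⟩
  have bc (c : ℝ) : IsBasic N (fun _ => c) :=
    ⟨contDiffOn_const, fun _ _ => D_const c, fun _ _ => D_const c, fun _ _ => D_const c⟩
  have pair (v a b c d : Total) : IsBasic N
      (fun q => D v X q * D a (D b X) q + D v Y q * D c (D d Y) q) :=
    ((bX _).mul hN ((bX _).deriv hN _)).add hN ((bY _).mul hN ((bY _).deriv hN _))
  have hx := fun q hq => D_congr (p := q) (v := (eb 1, 0)) hN hq hf.height
  have hy := fun q hq => D_congr (p := q) (v := (eb 2, 0)) hN hq hf.height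
  have hx' : ∀ q ∈ N, dt T q * dt T q * dx H q =
      2 * q.2 2 * (dx X q * dx (dx X) q + dx Y q * dx (dx Y) q) := fun q hq => by
    have := hx q hq
    simp (disch := fun_prop (disch := assumption)) only [D_mul hN hq, D_add hN hq, D_fibre,
      D_D_eq_zero hN hT hf.dT.1 _ q hq] at this
    simp at this
    linear_combination this
  have hy' : ∀ q ∈ N, dt T q * dt T q * dy H q =
      2 * q.2 2 * (dx X q * dx (dy X) q + dx Y q * dx (dy Y) q) := fun q hq => by
    have := hy q hq
    simp (disch := fun_prop (disch := assumption)) only [D_mul hN hq, D_add hN hq, D_fibre,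
      D_D_eq_zero hN hT hf.dT.2.1 _ q hq] at this
    rw [D_comm (v := (eb 2, 0)) (w := (eb 1, 0)) hN hq hX,
      D_comm (v := (eb 2, 0)) (w := (eb 1, 0)) hN hq hY] at this
    simp at this
    linear_combination this
  -- After `hx'` has replaced `H_x` by a multiple of `h`, the arguments are the coefficients of `h`,
  -- `1`, `u²`, `uv`, `v²` in `free_momentum`. The factor `-1` carries the sign of `B_x`.
  obtain ⟨r0, r1, r2, r3⟩ := coefficients_eq_zero hN
    ((bc 2).mul hN (pair (eb 1, 0) (eb 1, 0) (eb 1, 0) (eb 1, 0) (eb 1, 0)))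
    ((bc (-1)).mul hN (((bT (eb 0, 0)).mul hN (bT (eb 0, 0))).mul hN (bB.deriv hN (eb 1, 0))))
    (pair (eb 1, 0) (eb 1, 0) (eb 1, 0) (eb 1, 0) (eb 1, 0))
    ((bc 2).mul hN (pair (eb 1, 0) (eb 1, 0) (eb 2, 0) (eb 1, 0) (eb 2, 0)))
    (pair (eb 1, 0) (eb 2, 0) (eb 2, 0) (eb 2, 0) (eb 2, 0))
    (fun q hq => by linear_combination (hf.free_momentum hq).1 - hx' q hq) hp
  obtain ⟨s0, s1, s2, s3⟩ := coefficients_eq_zero hN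
    ((bc 2).mul hN (pair (eb 1, 0) (eb 1, 0) (eb 2, 0) (eb 1, 0) (eb 2, 0)))
    ((bc (-1)).mul hN (((bT (eb 0, 0)).mul hN (bT (eb 0, 0))).mul hN (bB.deriv hN (eb 2, 0))))
    (pair (eb 2, 0) (eb 1, 0) (eb 1, 0) (eb 1, 0) (eb 1, 0))
    ((bc 2).mul hN (pair (eb 2, 0) (eb 1, 0) (eb 2, 0) (eb 1, 0) (eb 2, 0)))
    (pair (eb 2, 0) (eb 2, 0) (eb 2, 0) (eb 2, 0) (eb 2, 0))
    (fun q hq => by linear_combination (hf.free_momentum hq).2 - hy' q hq) hp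
  have ht := hf.dt_T_ne_zero hp
  have hJ := hf.jacobian_ne_zero hp
  have cramer (α β : ℝ) (h1 : dx X p * α + dx Y p * β = 0) (h2 : dy X p * α + dy Y p * β = 0) :
      α = 0 ∧ β = 0 :=
    ⟨(mul_eq_zero.1 (by linear_combination dy Y p * h1 - dx Y p * h2 :
      (dx X p * dy Y p - dy X p * dx Y p) * α = 0)).resolve_left hJ,
    (mul_eq_zero.1 (by linear_combination dx X p * h2 - dy X p * h1 :
      (dx X p * dy Y p - dy X p * dx Y p) * β = 0)).resolve_left hJ⟩
  simp [ht] at r0 s0 r2 s2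
  obtain ⟨m1, n1⟩ := cramer _ _ r1 s1
  obtain ⟨m2, n2⟩ := cramer _ _ r2 s2
  obtain ⟨m3, n3⟩ := cramer _ _ r3 s3
  exact ⟨⟨r0, s0⟩, ⟨m1, m2, m3⟩, n1, n2, n3⟩

end IsFibered

/-! ### The group of similarities. -/

/-- The parameters of the transformations that consist of scalings, rotations, reflections and
shifts. -/
@[ext]
structure Similarity where
  τ : ℝ
  a : ℝ
  b : ℝ
  ε : ℝ
  k : Fin 4 → ℝ
  τ_ne : τ ≠ 0
  norm_ne : a * a + b * b ≠ 0
  ε_sq : ε * ε = 1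

namespace Similarity

/-- The square of the spatial scaling factor. -/
noncomputable abbrev μ (s : Similarity) : ℝ := s.a * s.a + s.b * s.b

/-- The transformation of the independent variables. -/
noncomputable def base (s : Similarity) (z : Base) : Base :=
  ![s.τ * z 0 + s.k 0, s.a * z 1 - s.ε * s.b * z 2 + s.k 1, s.b * z 1 + s.ε * s.a * z 2 + s.k 2]

/-- The transformation of the dependent variables. -/
noncomputable def fibre (s : Similarity) (w : Fibre) : Fibre :=
  ![(s.a * w 0 - s.ε * s.b * w 1) / s.τ, (s.b * w 0 + s.ε * s.a * w 1) / s.τ,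
    s.μ / s.τ ^ 2 * w 2, s.μ / s.τ ^ 2 * w 3 + s.k 3]

/-- The composition of two similarities. -/
noncomputable def mul (s r : Similarity) : Similarity where
  τ := s.τ * r.τ
  a := s.a * r.a - s.ε * s.b * r.b
  b := s.b * r.a + s.ε * s.a * r.b
  ε := s.ε * r.ε
  k := ![s.τ * r.k 0 + s.k 0, s.a * r.k 1 - s.ε * s.b * r.k 2 + s.k 1,
    s.b * r.k 1 + s.ε * s.a * r.k 2 + s.k 2, s.μ / s.τ ^ 2 * r.k 3 + s.k 3]
  τ_ne := mul_ne_zero s.τ_ne r.τ_ne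
  norm_ne := by
    have : (s.a * r.a - s.ε * s.b * r.b) * (s.a * r.a - s.ε * s.b * r.b) +
        (s.b * r.a + s.ε * s.a * r.b) * (s.b * r.a + s.ε * s.a * r.b) =
        (s.a * s.a + s.b * s.b) * (r.a * r.a + r.b * r.b) := by
      linear_combination (s.a * s.a + s.b * s.b) * r.b * r.b * s.ε_sq
    rw [this]
    exact mul_ne_zero s.norm_ne r.norm_ne
  ε_sq := by linear_combination r.ε * r.ε * s.ε_sq + r.ε_sq

lemma norm_ne' (s : Similarity) : s.a ^ 2 + s.b ^ 2 ≠ 0 := by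
  have := s.norm_ne
  rwa [← sq, ← sq] at this

lemma μ_mul (s r : Similarity) : (s.mul r).μ = s.μ * r.μ := by
  simp only [μ, mul]
  linear_combination (s.a * s.a + s.b * s.b) * r.b * r.b * s.ε_sq

lemma base_mul (s r : Similarity) (z : Base) : (s.mul r).base z = s.base (r.base z) := by
  ext i
  fin_cases i
  · simp [base, mul]; ring
  · simp [base, mul]
    linear_combination -(s.a * r.ε * r.b * z 2) * s.ε_sq
  · simp [base, mul]
    linear_combination -(s.b * r.ε * r.b * z 2) * s.ε_sq

lemma fibre_mul (s r : Similarity) (w : Fibre) : (s.mul r).fibre w = s.fibre (r.fibre w) := by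
  have hs := s.τ_ne
  have hr := r.τ_ne
  have e3 (c : ℝ) : (s.mul r).μ / (s.mul r).τ ^ 2 * c =
      s.μ / s.τ ^ 2 * (r.μ / r.τ ^ 2 * c) := by
    rw [μ_mul]
    simp only [mul]
    field_simp
  ext i
  fin_cases i
  · simp [fibre, mul]
    field_simp
    linear_combination -(s.a * r.ε * r.b * w 1) * s.ε_sq
  · simp [fibre, mul]
    field_simp
    linear_combination -(s.b * r.ε * r.b * w 1) * s.ε_sq
  · exact e3 _
  · have : (s.mul r).k 3 = s.μ / s.τ ^ 2 * r.k 3 + s.k 3 := rfl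
    simp only [fibre]
    simp [e3, this]
    ring

/-- The inverse of a similarity. -/
noncomputable def inv (s : Similarity) : Similarity where
  τ := s.τ⁻¹
  a := s.a / s.μ
  b := -(s.ε * s.b) / s.μ
  ε := s.ε
  k := ![-(s.k 0) / s.τ, -(s.a * s.k 1 + s.b * s.k 2) / s.μ,
    (s.ε * (s.b * s.k 1 - s.a * s.k 2)) / s.μ, -(s.k 3) * s.τ ^ 2 / s.μ]
  τ_ne := inv_ne_zero s.τ_ne
  norm_ne := by
    have h := s.norm_ne'
    have : s.a / s.μ * (s.a / s.μ) + -(s.ε * s.b) / s.μ * (-(s.ε * s.b) / s.μ) = 1 / s.μ := by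
      simp only [μ, ← sq]
      field_simp
      linear_combination s.b ^ 2 * s.ε_sq
    rw [this]
    exact one_div_ne_zero s.norm_ne
  ε_sq := s.ε_sq

lemma inv_mul_base (s : Similarity) (z : Base) : s.inv.base (s.base z) = z := by
  have h := s.norm_ne'
  have hτ := s.τ_ne
  ext i
  fin_cases i
  · simp [base, inv]
    field_simp
    ring
  · simp [base, inv, μ, ← sq]
    field_simp
    linear_combination (s.b * s.b * z 1 + s.ε * s.a * s.b * z 2 + s.b * s.k 2) * s.ε_sq
  · simp [base, inv, μ, ← sq]
    field_simp
    linear_combination (s.b * s.b * z 2 + s.a * s.a * z 2) * s.ε_sq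

lemma inv_mul_fibre (s : Similarity) (w : Fibre) : s.inv.fibre (s.fibre w) = w := by
  have h := s.norm_ne'
  have hτ := s.τ_ne
  have hμ : s.inv.μ = 1 / s.μ := by
    simp only [inv, μ, ← sq]
    field_simp
    linear_combination s.b ^ 2 * s.ε_sq
  have hi : s.inv.τ = s.τ⁻¹ := rfl
  have e3 (c : ℝ) : s.inv.μ / s.inv.τ ^ 2 * (s.μ / s.τ ^ 2 * c) = c := by
    rw [hμ, hi]
    have := s.norm_ne
    field_simp
  ext i
  fin_cases i
  · simp [fibre, inv, μ, ← sq]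
    field_simp
    linear_combination (s.b * s.b * w 0 + s.ε * s.a * s.b * w 1) * s.ε_sq
  · simp [fibre, inv, μ, ← sq]
    field_simp
    linear_combination (s.b * s.b * w 1 + s.a * s.a * w 1) * s.ε_sq
  · exact e3 _
  · have h3 : s.inv.k 3 = -(s.k 3) * s.τ ^ 2 / s.μ := rfl
    simp only [fibre]
    simp [mul_add, h3, hμ, hi]
    field_simp
    ring

/-- The left-inverse law applied to `s.inv` makes `s.inv.base` injective, and it sends both sides to
the same point. -/
lemma mul_inv_base (s : Similarity) (z : Base) : s.base (s.inv.base z) = z :=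
  (Function.LeftInverse.injective s.inv.inv_mul_base) (s.inv_mul_base _)

lemma mul_inv_fibre (s : Similarity) (w : Fibre) : s.fibre (s.inv.fibre w) = w :=
  (Function.LeftInverse.injective s.inv.inv_mul_fibre) (s.inv_mul_fibre _)

lemma contDiff_base (s : Similarity) : ContDiff ℝ ∞ s.base := by
  rw [contDiff_pi]
  intro i
  fin_cases i <;> simp [base] <;> fun_prop

lemma contDiff_fibre (s : Similarity) : ContDiff ℝ ∞ s.fibre := by
  rw [contDiff_pi]
  intro i
  fin_cases i <;> simp [fibre] <;> fun_prop

/-- A similarity as a homeomorphism. -/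
noncomputable def homeo (s : Similarity) : Total ≃ₜ Total where
  toFun p := (s.base p.1, s.fibre p.2)
  invFun p := (s.inv.base p.1, s.inv.fibre p.2)
  left_inv p := by simp [inv_mul_base, inv_mul_fibre]
  right_inv p := by simp [mul_inv_base, mul_inv_fibre]
  continuous_toFun := by
    have h1 := s.contDiff_base.continuous
    have h2 := s.contDiff_fibre.continuous
    fun_prop
  continuous_invFun := by
    have h1 := s.inv.contDiff_base.continuous
    have h2 := s.inv.contDiff_fibre.continuous
    fun_prop

lemma homeo_apply (s : Similarity) (p : Total) : s.homeo p = (s.base p.1, s.fibre p.2) := rfl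

lemma homeo_mul (s r : Similarity) : (s.mul r).homeo = s.homeo * r.homeo := by
  ext1 p
  rw [Homeomorph.mul_apply]
  simp only [homeo_apply, base_mul, fibre_mul]

lemma homeo_inv (s : Similarity) : s.inv.homeo = s.homeo⁻¹ := by
  rw [eq_inv_iff_mul_eq_one]
  ext1 p
  rw [Homeomorph.mul_apply]
  simp only [homeo_apply, inv_mul_base, inv_mul_fibre]
  rfl

lemma contDiff_homeo (s : Similarity) : ContDiff ℝ ∞ s.homeo :=
  (s.contDiff_base.comp contDiff_fst).prodMk (s.contDiff_fibre.comp contDiff_snd)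

end Similarity

/-! ### Integration to a local similarity. -/

lemma eq_affine {O : Set Total} {F : Total → ℝ} (hO : IsOpen O) (hOc : IsPreconnected O)
    (hF : ContDiffOn ℝ ∞ F O) (c : Fin 3 → ℝ) (d : Fin 4 → ℝ)
    (hc : ∀ q ∈ O, ∀ j, D (eb j, 0) F q = c j) (hd : ∀ q ∈ O, ∀ i, D (0, ef i) F q = d i)
    {p q : Total} (hp : p ∈ O) (hq : q ∈ O) :
    F q = F p + ∑ j, c j * (q.1 j - p.1 j) + ∑ i, d i * (q.2 i - p.2 i) := by
  set A : Total →L[ℝ] ℝ :=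
    (∑ j, c j • ContinuousLinearMap.proj (R := ℝ) (φ := fun _ : Fin 3 => ℝ) j).coprod
      (∑ i, d i • ContinuousLinearMap.proj (R := ℝ) (φ := fun _ : Fin 4 => ℝ) i) with hA
  have hAa (v : Total) : A v = ∑ j, c j * v.1 j + ∑ i, d i * v.2 i := by
    simp [hA, ContinuousLinearMap.coprod_apply]
  have hFd (x : Total) (hx : x ∈ O) : HasFDerivAt F A x := by
    have h1 := (ContDiffOn.differentiableAt' hO hx hF).hasFDerivAt
    refine h1.congr_fderiv (ContinuousLinearMap.ext fun v => ?_)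
    have hv : v = ∑ j, v.1 j • ((eb j, 0) : Total) + ∑ i, v.2 i • ((0, ef i) : Total) := by
      ext i
      · fin_cases i <;> simp [Fin.sum_univ_three, Fin.sum_univ_four]
      · fin_cases i <;> simp [Fin.sum_univ_three, Fin.sum_univ_four]
    have h2 : fderiv ℝ F x v = ∑ j, v.1 j * D (eb j, 0) F x + ∑ i, v.2 i * D (0, ef i) F x := by
      conv_lhs => rw [hv]
      simp only [map_add, map_sum, map_smul, smul_eq_mul, D]
    rw [h2, hAa]
    simp only [hc x hx, hd x hx, mul_comm]
  have hG (x : Total) (hx : x ∈ O) : HasFDerivAt (fun y => F y - A y) (0 : Total →L[ℝ] ℝ) x := by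
    exact ((hFd x hx).fun_sub A.hasFDerivAt).congr_fderiv (sub_self A)
  have := hO.is_const_of_fderiv_eq_zero (𝕜 := ℝ) hOc
    (fun x hx => (hG x hx).differentiableAt.differentiableWithinAt)
    (fun x hx => (hG x hx).fderiv) hq hp
  have h3 : A q - A p = ∑ j, c j * (q.1 j - p.1 j) + ∑ i, d i * (q.2 i - p.2 i) := by
    rw [← map_sub, hAa]; rfl
  linarith

lemma eq_const {O : Set Total} {F : Total → ℝ} (hO : IsOpen O) (hOc : IsPreconnected O)
    (hF : ContDiffOn ℝ ∞ F O)
    (hc : ∀ q ∈ O, ∀ j, D (eb j, 0) F q = 0) (hd : ∀ q ∈ O, ∀ i, D (0, ef i) F q = 0)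
    {p q : Total} (hp : p ∈ O) (hq : q ∈ O) : F q = F p := by
  simpa using eq_affine hO hOc hF 0 0 hc hd hp hq

namespace IsFibered

variable {N : Set Total} {T X Y U V H B : Total → ℝ} {p : Total}

/-- Near each point a transformation of solutions is a similarity. -/
lemma exists_similarity (hf : IsFibered N T X Y U V H B) (hp : p ∈ N) :
    ∃ s : Similarity, ∀ᶠ q in 𝓝 p, s.homeo q = (![T q, X q, Y q], ![U q, V q, H q, B q]) := by
  obtain ⟨r, hr, hrN⟩ := Metric.isOpen_iff.1 hf.isOpen p hp
  set O := Metric.ball p r with hOdef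
  have hO : IsOpen O := Metric.isOpen_ball
  have hOc : IsPreconnected O := (convex_ball p r).isPreconnected
  have hpO : p ∈ O := Metric.mem_ball_self hr
  have hN := hf.isOpen
  have bas (q : Total) (hq : q ∈ N) (F : Total → ℝ) (hF : F ∈ ({T, X, Y} : Set (Total → ℝ)))
      (i : Fin 4) : D (0, ef i) F q = 0 := by
    have := hf.basic q hq F hF
    fin_cases i
    · exact this.1
    · exact this.2.1
    · exact this.2.2.1
    · exact this.2.2.2
  have cT : ∀ q ∈ O, dt T q = dt T p := fun q hq => by
    refine eq_const hO hOc ((contDiffOn_D hN hf.T_smooth).mono hrN) (fun x hx j => ?_)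
      (fun x hx i => D_D_eq_zero hN hf.T_smooth (fun y hy => bas y hy T (by simp) i) _ x (hrN hx))
      hpO hq
    fin_cases j
    · exact hf.dt_dt_T x (hrN hx)
    · exact D_D_eq_zero hN hf.T_smooth hf.dT.1 _ x (hrN hx)
    · exact D_D_eq_zero hN hf.T_smooth hf.dT.2.1 _ x (hrN hx)
  have second (Z : Total → ℝ) (hZs : ContDiffOn ℝ ∞ Z N)
      (hZ : Z ∈ ({T, X, Y} : Set (Total → ℝ))) (tZ : ∀ q ∈ N, dt Z q = 0)
      (h : ∀ q ∈ N, dx (dx Z) q = 0 ∧ dx (dy Z) q = 0 ∧ dy (dy Z) q = 0) :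
      ∀ q ∈ O, dx Z q = dx Z p ∧ dy Z q = dy Z p := fun q hq => by
    constructor
    · refine eq_const hO hOc ((contDiffOn_D hN hZs).mono hrN) (fun x hx j => ?_)
        (fun x hx i => D_D_eq_zero hN hZs (fun y hy => bas y hy Z hZ i) _ x (hrN hx)) hpO hq
      fin_cases j
      · exact D_D_eq_zero hN hZs tZ _ x (hrN hx)
      · exact (h x (hrN hx)).1
      · exact (D_comm hN (hrN hx) hZs).trans (h x (hrN hx)).2.1
    · refine eq_const hO hOc ((contDiffOn_D hN hZs).mono hrN) (fun x hx j => ?_)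
        (fun x hx i => D_D_eq_zero hN hZs (fun y hy => bas y hy Z hZ i) _ x (hrN hx)) hpO hq
      fin_cases j
      · exact D_D_eq_zero hN hZs tZ _ x (hrN hx)
      · exact (h x (hrN hx)).2.1
      · exact (h x (hrN hx)).2.2
  have cX := second X hf.X_smooth (by simp) hf.dt_X fun q hq => (hf.affine hq).2.1
  have cY := second Y hf.Y_smooth (by simp) hf.dt_Y fun q hq => (hf.affine hq).2.2
  set τ := dt T p with hτ
  set a := dx X p with ha
  set b := dx Y p with hb
  have ht : τ ≠ 0 := hf.dt_T_ne_zero hp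
  have hm : a * a + b * b ≠ 0 := hf.scale_ne_zero hp
  obtain ⟨k1, k2, -, -⟩ := hf.conformal hp
  set c := dy X p
  set d := dy Y p
  rw [← ha, ← hb] at k1 k2
  -- The columns `(a, b)` and `(c, d)` are orthogonal and equally long, so `ε` is the sign of the
  -- determinant and the second column is `ε` times the first one turned by a right angle.
  set ε := (a * d - b * c) / (a * a + b * b) with hε
  have hεm : ε * (a * a + b * b) = a * d - b * c := by
    rw [hε, div_mul_cancel₀ _ hm]
  clear_value ε
  have e1 : c = -(ε * b) := by
    refine mul_left_cancel₀ hm ?_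
    linear_combination a * k1 + b * hεm
  have e2 : d = ε * a := by
    refine mul_left_cancel₀ hm ?_
    linear_combination b * k1 - a * hεm
  have e3 : ε * ε = 1 := by
    refine mul_left_cancel₀ hm ?_
    rw [e1, e2] at k2
    linear_combination k2
  set m := a * a + b * b with hmdef
  have fT : ∀ q ∈ O, T q = τ * q.1 0 + (T p - τ * p.1 0) := fun q hq => by
    have := eq_affine hO hOc (hf.T_smooth.mono hrN) ![τ, 0, 0] 0 (fun x hx j => by
      fin_cases j
      · exact cT x hx
      · exact hf.dT.1 x (hrN hx)
      · exact hf.dT.2.1 x (hrN hx)) (fun x hx i => bas x (hrN hx) T (by simp) i) hpO hq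
    simp [Fin.sum_univ_three] at this
    linarith
  have fX : ∀ q ∈ O, X q = a * q.1 1 + c * q.1 2 + (X p - a * p.1 1 - c * p.1 2) :=
      fun q hq => by
    have := eq_affine hO hOc (hf.X_smooth.mono hrN) ![0, a, c] 0 (fun x hx j => by
      fin_cases j
      · exact hf.dt_X x (hrN hx)
      · exact (cX x hx).1
      · exact (cX x hx).2) (fun x hx i => bas x (hrN hx) X (by simp) i) hpO hq
    simp [Fin.sum_univ_three] at this
    linarith
  have fY : ∀ q ∈ O, Y q = b * q.1 1 + d * q.1 2 + (Y p - b * p.1 1 - d * p.1 2) :=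
      fun q hq => by
    have := eq_affine hO hOc (hf.Y_smooth.mono hrN) ![0, b, d] 0 (fun x hx j => by
      fin_cases j
      · exact hf.dt_Y x (hrN hx)
      · exact (cY x hx).1
      · exact (cY x hx).2) (fun x hx i => bas x (hrN hx) Y (by simp) i) hpO hq
    simp [Fin.sum_univ_three] at this
    linarith
  have fB : ∀ q ∈ O, B q = m / τ ^ 2 * q.2 3 + (B p - m / τ ^ 2 * p.2 3) := fun q hq => by
    have := eq_affine hO hOc (hf.B_smooth.mono hrN) 0 ![0, 0, 0, m / τ ^ 2] (fun x hx j => by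
      fin_cases j
      · exact hf.dB.1 x (hrN hx)
      · exact (hf.affine (hrN hx)).1.1
      · exact (hf.affine (hrN hx)).1.2) (fun x hx i => by
      fin_cases i
      · exact hf.dB.2.1 x (hrN hx)
      · exact hf.dB.2.2.1 x (hrN hx)
      · exact hf.dB.2.2.2 x (hrN hx)
      · have h := hf.dB' x (hrN hx)
        rw [cT x hx, (cX x hx).1, (cY x hx).1] at h
        change db B x = m / τ ^ 2
        rw [eq_div_iff (by positivity), hmdef, ← h]
        ring) hpO hq
    simp [Fin.sum_univ_four] at this
    linarith
  refine ⟨⟨τ, a, b, ε, ![T p - τ * p.1 0, X p - a * p.1 1 - c * p.1 2,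
    Y p - b * p.1 1 - d * p.1 2, B p - m / τ ^ 2 * p.2 3], ht, hm, e3⟩, ?_⟩
  filter_upwards [hO.mem_nhds hpO] with q hq
  obtain ⟨v1, v2⟩ := hf.velocity (hrN hq)
  have v3 := hf.height q (hrN hq)
  rw [cT q hq, (cX q hq).1, (cY q hq).1] at v3
  rw [cT q hq, (cX q hq).1, (cX q hq).2] at v1
  rw [cT q hq, (cY q hq).1, (cY q hq).2] at v2
  rw [Similarity.homeo_apply]
  refine Prod.ext ?_ ?_
  · ext i
    fin_cases i
    · simp [Similarity.base, fT q hq]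
    · simp [Similarity.base, fX q hq, e1]
      ring
    · simp [Similarity.base, fY q hq, e2]
  · ext i
    fin_cases i
    · simp [Similarity.fibre]
      rw [div_eq_iff ht, ← v1]
      change a * q.2 0 - ε * b * q.2 1 = q.2 0 * a + q.2 1 * c
      rw [e1]; ring
    · simp [Similarity.fibre]
      rw [div_eq_iff ht, ← v2]
      change b * q.2 0 + ε * a * q.2 1 = q.2 0 * b + q.2 1 * d
      rw [e2]; ring
    · simp [Similarity.fibre]
      change m / τ ^ 2 * q.2 2 = H q
      field_simp
      linear_combination -v3
    · simp [Similarity.fibre, fB q hq]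
      exact Or.inl rfl

end IsFibered

/-! ### Point symmetries are similarities. -/

lemma nonempty_inter_ne_zero {O : Set Total} (hO : IsOpen O) (hne : O.Nonempty) (i : Fin 4) :
    IsOpen (O ∩ {p | p.2 i ≠ 0}) ∧ (O ∩ {p | p.2 i ≠ 0}).Nonempty := by
  have hc : Continuous fun p : Total => p.2 i := by fun_prop
  refine ⟨hO.inter (isOpen_compl_singleton.preimage hc), ?_⟩
  obtain ⟨p, hp⟩ := hne
  by_cases h : p.2 i = 0
  · have hl : Continuous fun s : ℝ => p + s • ((0, ef i) : Total) := by fun_prop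
    have h1 : ∀ᶠ s : ℝ in 𝓝 0, p + s • ((0, ef i) : Total) ∈ O :=
      hl.continuousAt.eventually_mem (hO.mem_nhds (by simpa using hp))
    obtain ⟨s, hs, hs0⟩ := ((h1.filter_mono nhdsWithin_le_nhds).and
      (eventually_mem_nhdsWithin (a := (0 : ℝ)) (s := {0}ᶜ))).exists
    exact ⟨_, hs, by simpa [h] using hs0⟩
  · exact ⟨p, hp, h⟩

/-- Conditions on the transformed velocity are imposed on the image, which is again open and
nonempty. -/
lemma exists_general (Φ : OpenPartialHomeomorph Total Total) {O : Set Total} (hO : IsOpen O)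
    (hne : O.Nonempty) (hs : O ⊆ Φ.source) :
    ∃ p ∈ O, General (fun q => (Φ q).2 0) (fun q => (Φ q).2 1) p := by
  obtain ⟨o1, n1⟩ := nonempty_inter_ne_zero hO hne 0
  obtain ⟨o2, n2⟩ := nonempty_inter_ne_zero o1 n1 1
  obtain ⟨o3, n3⟩ := nonempty_inter_ne_zero o2 n2 2
  have o4 := Φ.isOpen_image_of_subset_source o3 fun q hq => hs hq.1.1.1
  obtain ⟨o5, n5⟩ := nonempty_inter_ne_zero o4 (n3.image Φ) 0
  obtain ⟨-, n6⟩ := nonempty_inter_ne_zero o5 n5 1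
  obtain ⟨_, ⟨⟨p, ⟨⟨⟨hp, h0⟩, h1⟩, h2⟩, rfl⟩, h3⟩, h4⟩ := n6
  exact ⟨p, hp, h0, h1, h2, h3, h4⟩

section

variable {Φ : Total → Total} {p : Total}

lemma D_fst (h : DifferentiableAt ℝ Φ p) (v : Total) (j : Fin 3) :
    D v (fun q => (Φ q).1 j) p = (fderiv ℝ Φ p v).1 j := by
  have := ((ContinuousLinearMap.proj (R := ℝ) (φ := fun _ : Fin 3 => ℝ) j).comp
    (ContinuousLinearMap.fst ℝ Base Fibre)).hasFDerivAt.comp p h.hasFDerivAt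
  rw [D]
  exact congrArg (fun A : Total →L[ℝ] ℝ => A v) this.fderiv

lemma D_snd (h : DifferentiableAt ℝ Φ p) (v : Total) (i : Fin 4) :
    D v (fun q => (Φ q).2 i) p = (fderiv ℝ Φ p v).2 i := by
  have := ((ContinuousLinearMap.proj (R := ℝ) (φ := fun _ : Fin 4 => ℝ) i).comp
    (ContinuousLinearMap.snd ℝ Base Fibre)).hasFDerivAt.comp p h.hasFDerivAt
  rw [D]
  exact congrArg (fun A : Total →L[ℝ] ℝ => A v) this.fderiv

end

lemma IsPointTransformation.differentiableAt {Φ : OpenPartialHomeomorph Total Total}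
    (hΦ : IsPointTransformation Φ) {p : Total} (hp : p ∈ Φ.source) : DifferentiableAt ℝ Φ p :=
  (hΦ.hasFDerivAt hp).differentiableAt

lemma tot_eq {F : Total → ℝ} {p : Total} (j : Fin 3) (c : Fibre) :
    tot j c F p = fderiv ℝ F p (eb j, c) := by
  have : ((eb j, c) : Total) = (eb j, 0) + c 0 • (0, ef 0) + c 1 • (0, ef 1) + c 2 • (0, ef 2) +
      c 3 • (0, ef 3) := by
    ext i
    · simp
    · fin_cases i <;> simp
  rw [this]
  simp only [map_add, map_smul, smul_eq_mul, tot, du, dv, dh, db, D]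

lemma IsPointSymmetry.horizontalAt {Φ : OpenPartialHomeomorph Total Total}
    (hΦ : IsPointSymmetry Φ) {p : Total} (hp : p ∈ regularSet Φ)
    (hg : General (fun q => (Φ q).2 0) (fun q => (Φ q).2 1) p) :
    HorizontalAt (fun q => (Φ q).1 0) (fun q => (Φ q).1 1) (fun q => (Φ q).1 2)
      (fun q => (Φ q).2 0) (fun q => (Φ q).2 1) p := by
  obtain ⟨hps, cx, cy, hdet⟩ := hp
  have hd := hΦ.pointTransformation.differentiableAt hps
  have hmaps : MapsJets p.2 (Φ p).2 (fderiv ℝ Φ p) := fun P hP hPd => hΦ.exists_jet hps hP hPd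
  obtain ⟨⟨z0, z1, z2⟩, hne, hcase⟩ := hmaps.horizontal hg.1 hg.2.2.1 hg.2.2.2.1
    (hΦ.pointTransformation.fderiv_injective hps) (isJet_jet _ cx cy) hdet
  set L := fderiv ℝ Φ p with hL
  have hflow (j : Fin 3) : (L (flow p.2, 0)).1 j =
      (L (eb 0, 0)).1 j + p.2 0 * (L (eb 1, 0)).1 j + p.2 1 * (L (eb 2, 0)).1 j := by
    have : ((flow p.2, 0) : Total) = (eb 0, 0) + p.2 0 • (eb 1, 0) + p.2 1 • (eb 2, 0) := by
      ext i
      · fin_cases i <;> simp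
      · simp
    rw [this, map_add, map_add, map_smul, map_smul]
    rfl
  refine ⟨?_, ?_, ?_⟩
  · intro F hF
    simp only [mem_insert_iff, mem_singleton_iff] at hF
    rcases hF with rfl | rfl | rfl <;>
    · simp only [du, dv, dh, D_fst hd, ← hL, z0, z1, z2]
      simp
  · simp only [dt, D_fst hd, ← hL]
    by_contra! hc
    refine hne ?_
    ext j
    fin_cases j
    · exact hc.1
    · exact hc.2.1
    · exact hc.2.2
  · simp only [dt, dx, dy, db, D_fst hd, ← hL, ← hflow]
    rcases hcase with ⟨h1, h2, h3⟩ | ⟨h1, -, h3⟩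
    · obtain ⟨r1, e1⟩ := Submodule.mem_span_singleton.1 h1
      obtain ⟨r2, e2⟩ := Submodule.mem_span_singleton.1 h2
      obtain ⟨r3, e3⟩ := Submodule.mem_span_singleton.1 h3
      left
      rw [← e1, ← e2, ← e3]
      simp [mul_comm]
    · obtain ⟨r1, e1⟩ := Submodule.mem_span_singleton.1 h1
      obtain ⟨r3, e3⟩ := Submodule.mem_span_singleton.1 h3
      right
      rw [← e1, ← e3]
      simp [mul_comm]

lemma IsPointSymmetry.isFibered {Φ : OpenPartialHomeomorph Total Total}
    (hΦ : IsPointSymmetry Φ) :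
    IsFibered (regularSet Φ) (fun q => (Φ q).1 0) (fun q => (Φ q).1 1) (fun q => (Φ q).1 2)
      (fun q => (Φ q).2 0) (fun q => (Φ q).2 1) (fun q => (Φ q).2 2) (fun q => (Φ q).2 3) := by
  have hN := isOpen_regularSet hΦ.pointTransformation
  have hNs : regularSet Φ ⊆ Φ.source := fun q hq => hq.1
  have hsm := hΦ.pointTransformation.smooth.mono hNs
  have sz (j : Fin 3) : ContDiffOn ℝ ∞ (fun q => (Φ q).1 j) (regularSet Φ) :=
    contDiffOn_pi.1 (contDiff_fst.comp_contDiffOn hsm) j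
  have sw (i : Fin 4) : ContDiffOn ℝ ∞ (fun q => (Φ q).2 i) (regularSet Φ) :=
    contDiffOn_pi.1 (contDiff_snd.comp_contDiffOn hsm) i
  have hdense : ∀ O ⊆ regularSet Φ, IsOpen O → O.Nonempty →
      ∃ p ∈ O, General (fun q => (Φ q).2 0) (fun q => (Φ q).2 1) p :=
    fun O hO ho hn => exists_general Φ ho hn (hO.trans hNs)
  obtain ⟨hb, tX, tY, fX, fY⟩ := horizontal_of_general hN (sz 0) (sz 1) (sz 2) (sw 0) (sw 1)
    hdense fun p hp hg => hΦ.horizontalAt hp hg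
  have hvert (p : Total) (hp : p ∈ regularSet Φ) (c : Fibre) : (fderiv ℝ Φ p (0, c)).1 = 0 := by
    have hd := hΦ.pointTransformation.differentiableAt hp.1
    have e : ((0, c) : Total) = c 0 • (0, ef 0) + c 1 • (0, ef 1) + c 2 • (0, ef 2) +
        c 3 • (0, ef 3) := by
      ext i
      · simp
      · fin_cases i <;> simp
    ext j
    have h := hb p hp (fun q => (Φ q).1 j) (by fin_cases j <;> simp)
    simp only [du, dv, dh, db, D_fst hd] at h
    rw [e, map_add, map_add, map_add, map_smul, map_smul, map_smul, map_smul]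
    simp [h.1, h.2.1, h.2.2.1, h.2.2.2]
  -- The horizontal part no longer depends on the derivative of the solution, so at a regular point
  -- every derivative is transversal.
  have hhor (p : Total) (hp : p ∈ regularSet Φ) (P : Base →L[ℝ] Fibre) (ζ : Base) :
      hor (fderiv ℝ Φ p) P ζ = (fderiv ℝ Φ p (ζ, 0)).1 := by
    have : ((ζ, P ζ) : Total) = (ζ, 0) + (0, P ζ) := by simp
    rw [hor_apply, this, map_add, Prod.fst_add, hvert p hp, add_zero]
  refine ⟨hN, sz 0, sz 1, sz 2, sw 0, sw 1, sw 2, sw 3, hdense, hb, tX, tY, fX, fY, ?_, ?_, ?_⟩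
  · intro p hp a b c h0 h1 h2
    have hd := hΦ.pointTransformation.differentiableAt hp.1
    have htX := tX p hp
    have htY := tY p hp
    simp only [dt, dx, dy, D_fst hd] at h0 h1 h2 htX htY
    obtain ⟨-, cx, cy, hdet⟩ := id hp
    have inj := (bijective_of_det_ne_zero hdet).1
    have hz : hor (fderiv ℝ Φ p) (jet p.2 cx cy) ![a, b, c] = 0 := by
      rw [hhor p hp]
      have e : ((![a, b, c], 0) : Total) = a • (eb 0, 0) + b • (eb 1, 0) + c • (eb 2, 0) := by
        ext i
        · fin_cases i <;> simp
        · simp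
      rw [e, map_add, map_add, map_smul, map_smul, map_smul]
      ext j
      fin_cases j
      · simpa using h0
      · simpa [htX] using h1
      · simpa [htY] using h2
    have := inj (hz.trans (map_zero _).symm)
    exact ⟨congrFun this 0, congrFun this 1, congrFun this 2⟩
  · intro p hp h0 h1 h3 h2
    have hd := hΦ.pointTransformation.differentiableAt hp.1
    simp only [dh, D_snd hd] at h0 h1 h2 h3
    have : fderiv ℝ Φ p (0, ef 2) = 0 := by
      refine Prod.ext (hvert p hp _) ?_
      ext i
      fin_cases i
      · exact h0
      · exact h1
      · exact h2
      · exact h3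
    have h4 := hΦ.pointTransformation.fderiv_injective hp.1 (this.trans (map_zero _).symm)
    have h5 := congrFun (congrArg Prod.snd h4) 2
    simp at h5
  · intro p hp cx cy
    have hd := hΦ.pointTransformation.differentiableAt hp.1
    obtain ⟨-, cx', cy', hdet'⟩ := id hp
    have hdet : (hor (fderiv ℝ Φ p) (jet p.2 cx cy)).det ≠ 0 := by
      have : hor (fderiv ℝ Φ p) (jet p.2 cx cy) = hor (fderiv ℝ Φ p) (jet p.2 cx' cy') := by
        ext1 ζ
        rw [hhor p hp, hhor p hp]
      rwa [this]
    obtain ⟨P', hP', hPe⟩ := hΦ.exists_jet hp.1 (isJet_jet p.2 cx cy) hdet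
    obtain ⟨j0, j1, j2, j3⟩ := hP'
    refine ⟨P' (eb 0), P' (eb 1), P' (eb 2), j0, j1, j2, j3, ?_⟩
    have key (i : Fin 4) (j : Fin 3) (c : Fibre) (hc : jet p.2 cx cy (eb j) = c) :
        tot j c (fun q => (Φ q).2 i) p =
          D (eb j, 0) (fun q => (Φ q).1 0) p * P' (eb 0) i +
          D (eb j, 0) (fun q => (Φ q).1 1) p * P' (eb 1) i +
          D (eb j, 0) (fun q => (Φ q).1 2) p * P' (eb 2) i := by
      have h1 := congrFun (hPe (eb j)) i
      rw [hhor p hp, ver_apply, hc] at h1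
      rw [tot_eq, ← D, D_snd hd, ← h1, D_fst hd, D_fst hd, D_fst hd, ← ofColumns_eta P',
        ofColumns_apply]
      simp [ofColumns_eta]
    have lift (i : Fin 4) : Lifts (fun q => (Φ q).1 0) (fun q => (Φ q).1 1) (fun q => (Φ q).1 2) p
        cx cy (fun q => (Φ q).2 i) (P' (eb 0) i) (P' (eb 1) i) (P' (eb 2) i) :=
      ⟨key i 0 _ (by simp), key i 1 _ (by simp), key i 2 _ (by simp)⟩
    exact ⟨lift 0, lift 1, lift 2, lift 3⟩

lemma IsPointSymmetry.exists_similarity_nhds {Φ : OpenPartialHomeomorph Total Total}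
    (hΦ : IsPointSymmetry Φ) {p : Total} (hp : p ∈ regularSet Φ) :
    ∃ s : Similarity, Φ =ᶠ[𝓝 p] s.homeo := by
  obtain ⟨s, hs⟩ := hΦ.isFibered.exists_similarity hp
  refine ⟨s, ?_⟩
  filter_upwards [hs] with q hq
  rw [hq]
  refine Prod.ext ?_ ?_
  · ext j; fin_cases j <;> rfl
  · ext i; fin_cases i <;> rfl

lemma fderiv_apply_of_affine {E F : Type*} [NormedAddCommGroup E] [NormedSpace ℝ E]
    [NormedAddCommGroup F] [NormedSpace ℝ F] {f : E → F} {z ζ : E} {v : F}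
    (hf : DifferentiableAt ℝ f z) (h : ∀ c : ℝ, f (z + c • ζ) = f z + c • v) :
    fderiv ℝ f z ζ = v := by
  have h1 : HasDerivAt (fun c : ℝ => f (z + c • ζ)) (fderiv ℝ f z ζ) 0 := by
    have hl : HasDerivAt (fun c : ℝ => z + c • ζ) ζ 0 := by
      simpa using ((hasDerivAt_id (0 : ℝ)).smul_const ζ).const_add z
    have hf' : HasFDerivAt f (fderiv ℝ f z) (z + (0 : ℝ) • ζ) := by simpa using hf.hasFDerivAt
    exact hf'.comp_hasDerivAt 0 hl
  have h2 : HasDerivAt (fun c : ℝ => f (z + c • ζ)) v 0 := by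
    simp only [h]
    simpa using ((hasDerivAt_id (0 : ℝ)).smul_const v).const_add (f z)
  exact h1.unique h2

namespace Similarity

lemma base_affine (s : Similarity) (z ζ : Base) (c : ℝ) :
    s.base (z + c • ζ) = s.base z + c • (s.base ζ - s.base 0) := by
  ext i
  fin_cases i <;> simp [base] <;> ring

lemma fibre_affine (s : Similarity) (w κ : Fibre) (c : ℝ) :
    s.fibre (w + c • κ) = s.fibre w + c • (s.fibre κ - s.fibre 0) := by
  ext i
  fin_cases i <;> simp [fibre] <;> ring

lemma homeo_affine (s : Similarity) (p v : Total) (c : ℝ) :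
    s.homeo (p + c • v) = s.homeo p + c • (s.homeo v - s.homeo 0) :=
  Prod.ext (s.base_affine p.1 v.1 c) (s.fibre_affine p.2 v.2 c)

lemma fderiv_base (s : Similarity) (z ζ : Base) : fderiv ℝ s.base z ζ = s.base ζ - s.base 0 :=
  fderiv_apply_of_affine (s.contDiff_base.differentiable (by simp) z) (s.base_affine z ζ)

lemma fderiv_fibre (s : Similarity) (w κ : Fibre) :
    fderiv ℝ s.fibre w κ = s.fibre κ - s.fibre 0 :=
  fderiv_apply_of_affine (s.contDiff_fibre.differentiable (by simp) w) (s.fibre_affine w κ)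

lemma fderiv_homeo (s : Similarity) (p v : Total) :
    fderiv ℝ s.homeo p v = s.homeo v - s.homeo 0 :=
  fderiv_apply_of_affine (s.contDiff_homeo.differentiable (by simp) p) (s.homeo_affine p v)

/-- Similarities that coincide near a point are equal. -/
lemma homeo_eq_of_eventuallyEq {s r : Similarity} {p : Total} (h : s.homeo =ᶠ[𝓝 p] r.homeo) :
    s.homeo = r.homeo := by
  ext1 q
  have h1 : fderiv ℝ s.homeo p (q - p) = fderiv ℝ r.homeo p (q - p) := by rw [h.fderiv_eq]
  rw [fderiv_homeo, fderiv_homeo] at h1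
  have h2 := s.homeo_affine p (q - p) 1
  have h3 := r.homeo_affine p (q - p) 1
  rw [one_smul, add_sub_cancel] at h2 h3
  rw [h2, h3, h1, h.eq_of_nhds]

/-- A point where the derivative of a symmetry equals that of a similarity is therefore regular,
which lets the local form extend across boundary points. -/
lemma det_hor_ne_zero (s : Similarity) (p : Total) (P : Base →L[ℝ] Fibre) :
    (hor (fderiv ℝ s.homeo p) P).det ≠ 0 := by
  have hinj : Function.Injective (hor (fderiv ℝ s.homeo p) P) := by
    rw [injective_iff_map_eq_zero]
    intro ζ hζ
    rw [hor_apply, fderiv_homeo] at hζ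
    exact (Function.LeftInverse.injective s.inv_mul_base) (sub_eq_zero.1 hζ)
  have hker : LinearMap.ker (hor (fderiv ℝ s.homeo p) P : Base →ₗ[ℝ] Base) = ⊥ :=
    LinearMap.ker_eq_bot.2 hinj
  have := (LinearMap.isUnit_iff_ker_eq_bot _).2 hker
  exact ((LinearMap.isUnit_iff_isUnit_det _).1 this).ne_zero

end Similarity

/-- Point symmetries of the extended system are similarities. -/
theorem IsPointSymmetry.exists_similarity {Φ : OpenPartialHomeomorph Total Total}
    (hΦ : IsPointSymmetry Φ) : ∃ s : Similarity, EqOn Φ s.homeo Φ.source := by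
  obtain ⟨p₀, hp₀⟩ := hΦ.regularSet_nonempty
  obtain ⟨s, hs⟩ := hΦ.exists_similarity_nhds hp₀
  refine ⟨s, ?_⟩
  set S : Set Total := {p | Φ =ᶠ[𝓝 p] s.homeo} with hS
  have hSo : IsOpen S := by
    rw [isOpen_iff_mem_nhds]
    intro p hp
    exact hp.eventually_nhds
  -- By continuity the derivative at a limit point is still that of `s`, so the point is regular.
  -- The similarity found there agrees with `s` near a point of `S`, hence everywhere.
  have hcl : closure S ∩ Φ.source ⊆ S := by
    rintro p ⟨hpc, hps⟩
    have hcont : ContinuousOn (fderiv ℝ Φ) Φ.source :=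
      hΦ.pointTransformation.smooth.continuousOn_fderiv_of_isOpen Φ.open_source (by simp)
    have hcs : Continuous (fderiv ℝ s.homeo) := s.contDiff_homeo.continuous_fderiv (by simp)
    have hd : fderiv ℝ Φ p = fderiv ℝ s.homeo p := by
      by_contra hne
      have ho : IsOpen (Φ.source ∩ (fun q => fderiv ℝ Φ q - fderiv ℝ s.homeo q) ⁻¹' {0}ᶜ) :=
        (hcont.sub hcs.continuousOn).isOpen_inter_preimage Φ.open_source isOpen_compl_singleton
      obtain ⟨q, hq, hqS⟩ := mem_closure_iff.1 hpc _ ho ⟨hps, by simpa [sub_eq_zero] using hne⟩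
      exact hq.2 (by
        have hqS : Φ =ᶠ[𝓝 q] s.homeo := hqS
        simp [hqS.fderiv_eq])
    have hreg : p ∈ regularSet Φ := ⟨hps, 0, 0, by rw [hd]; exact s.det_hor_ne_zero p _⟩
    obtain ⟨r, hr⟩ := hΦ.exists_similarity_nhds hreg
    obtain ⟨q, hq, hqS⟩ := mem_closure_iff_nhds.1 hpc _ hr.eventually_nhds
    have hq : Φ =ᶠ[𝓝 q] r.homeo := hq
    have hqS : Φ =ᶠ[𝓝 q] s.homeo := hqS
    rwa [Similarity.homeo_eq_of_eventuallyEq (hq.symm.trans hqS)] at hr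
  have hsub : Φ.source ⊆ S :=
    hΦ.pointTransformation.connected.isPreconnected.subset_of_closure_inter_subset hSo
      ⟨p₀, hp₀.1, hs⟩ hcl
  intro p hp
  exact (hsub hp : Φ =ᶠ[𝓝 p] s.homeo).eq_of_nhds

/-! ### Similarities are symmetries and equivalence transformations. -/

lemma isSolution_zero : IsSolution univ (fun _ => (0 : Fibre)) :=
  isSolution_iff.2 ⟨isOpen_univ, contDiffOn_const, fun z _ => by simp [IsJet]⟩

namespace Similarity

lemma isPointTransformation (s : Similarity) :
    IsPointTransformation s.homeo.toOpenPartialHomeomorph where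
  connected := by
    have : IsConnected (univ : Set Total) := isConnected_univ
    simpa using this
  smooth := s.contDiff_homeo.contDiffOn
  smooth_symm := by
    have := s.inv.contDiff_homeo.contDiffOn (s := univ)
    rw [homeo_inv] at this
    exact this

lemma transformsTo_zero (s : Similarity) : TransformsTo s.homeo.toOpenPartialHomeomorph univ
    (fun _ => 0) univ (fun _ => s.fibre 0) where
  graph_subset := subset_univ _
  isOpen := isOpen_univ
  smooth := contDiffOn_const
  graph_eq := by
    ext ⟨z, w⟩
    simp only [graphOver, image_univ, mem_range, mem_image, Prod.mk.injEq, exists_exists_eq_and]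
    constructor
    · rintro ⟨z', rfl, rfl⟩
      exact ⟨s.inv.base z', Prod.ext (s.mul_inv_base z') rfl⟩
    · rintro ⟨z', h⟩
      exact ⟨z, rfl, congrArg Prod.snd h⟩

lemma isJet_transform (s : Similarity) {w : Fibre} {P P' : Base →L[ℝ] Fibre} (hP : IsJet w P)
    (h : ∀ ζ, P' (s.base ζ - s.base 0) = s.fibre (P ζ) - s.fibre 0) :
    IsJet (s.fibre w) P' := by
  have hτ := s.τ_ne
  have hμ := s.norm_ne
  have e0 : s.base (eb 0) - s.base 0 = s.τ • eb 0 := by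
    ext i; fin_cases i <;> simp [base]
  have e1 : s.base (eb 1) - s.base 0 = s.a • eb 1 + s.b • eb 2 := by
    ext i; fin_cases i <;> simp [base]
  have e2 : s.base (eb 2) - s.base 0 = (-(s.ε * s.b)) • eb 1 + (s.ε * s.a) • eb 2 := by
    ext i; fin_cases i <;> simp [base]
  have h0 := h (eb 0)
  have h1 := h (eb 1)
  have h2 := h (eb 2)
  rw [e0, map_smul] at h0
  rw [e1, map_add, map_smul, map_smul] at h1
  rw [e2, map_add, map_smul, map_smul] at h2
  -- The new derivatives are solved for with the inverse of the conformal matrix. Substituted into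
  -- the system they give the old equations, rotated or reflected and scaled.
  have q0 (i : Fin 4) : P' (eb 0) i = (s.fibre (P (eb 0)) - s.fibre 0) i / s.τ := by
    rw [← h0, Pi.smul_apply, smul_eq_mul]
    field_simp
  have q1 (i : Fin 4) : P' (eb 1) i = (s.a * (s.fibre (P (eb 1)) - s.fibre 0) i -
      s.ε * s.b * (s.fibre (P (eb 2)) - s.fibre 0) i) / s.μ := by
    rw [← h1, ← h2, eq_div_iff hμ]
    simp only [Pi.add_apply, Pi.smul_apply, smul_eq_mul]
    linear_combination (s.a * s.b * P' (eb 2) i - s.b * s.b * P' (eb 1) i) * s.ε_sq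
  have q2 (i : Fin 4) : P' (eb 2) i = (s.b * (s.fibre (P (eb 1)) - s.fibre 0) i +
      s.ε * s.a * (s.fibre (P (eb 2)) - s.fibre 0) i) / s.μ := by
    rw [← h1, ← h2, eq_div_iff hμ]
    simp only [Pi.add_apply, Pi.smul_apply, smul_eq_mul]
    linear_combination (s.a * s.b * P' (eb 1) i - s.a * s.a * P' (eb 2) i) * s.ε_sq
  obtain ⟨j0, j1, j2, j3⟩ := hP
  set p0 := P (eb 0)
  set p1 := P (eb 1)
  set p2 := P (eb 2)
  have hμ' := s.norm_ne'
  refine ⟨?_, ?_, ?_, ?_⟩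
  · simp only [q0, q1, q2, Pi.sub_apply]
    simp [fibre, μ, ← sq]
    field_simp
    linear_combination (s.a ^ 2 + s.b ^ 2) * (s.a * j0 - s.ε * s.b * j1) +
      (s.a ^ 2 + s.b ^ 2) * (s.a * p2 0 - s.ε * s.b * p2 1) * w 1 * s.ε_sq
  · simp only [q0, q1, q2, Pi.sub_apply]
    simp [fibre, μ, ← sq]
    field_simp
    linear_combination (s.a ^ 2 + s.b ^ 2) * (s.b * j0 + s.ε * s.a * j1) +
      (s.a ^ 2 + s.b ^ 2) * (s.b * p2 0 + s.ε * s.a * p2 1) * w 1 * s.ε_sq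
  · simp only [q0, q1, q2, Pi.sub_apply]
    simp [fibre, μ, ← sq]
    field_simp
    linear_combination (s.a ^ 2 + s.b ^ 2) * j2 +
      (s.a ^ 2 + s.b ^ 2) * (w 1 * p2 2 + w 2 * p2 1) * s.ε_sq
  · rw [q0]
    simp [fibre, j3]

lemma maps_solutions (s : Similarity) {Ω Ω' : Set Base} {w w' : Base → Fibre}
    (hw : IsSolution Ω w) (ht : TransformsTo s.homeo.toOpenPartialHomeomorph Ω w Ω' w') :
    IsSolution Ω' w' := by
  rw [isSolution_iff] at hw
  refine isSolution_iff.2 ⟨ht.isOpen, ht.smooth, fun z' hz' => ?_⟩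
  obtain ⟨z, hz, h⟩ := ht.exists_eq hz'
  obtain rfl : z' = s.base z := congrArg Prod.fst h
  have h2 : w' (s.base z) = s.fibre (w z) := congrArg Prod.snd h
  rw [h2]
  refine s.isJet_transform (hw.2.2 z hz) fun ζ => ?_
  have hwd : HasFDerivAt w (fderiv ℝ w z) z :=
    ((hw.2.1.contDiffAt (hw.1.mem_nhds hz)).differentiableAt (by simp)).hasFDerivAt
  have hwd' : HasFDerivAt w' (fderiv ℝ w' (s.base z)) (s.base z) :=
    ((ht.smooth.contDiffAt (ht.isOpen.mem_nhds hz')).differentiableAt (by simp)).hasFDerivAt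
  have hb := (s.contDiff_base.differentiable (by simp) z).hasFDerivAt
  have hf := (s.contDiff_fibre.differentiable (by simp) (w z)).hasFDerivAt
  have h3 := hwd'.comp z hb
  have h4 : HasFDerivAt (w' ∘ s.base) ((fderiv ℝ s.fibre (w z)).comp (fderiv ℝ w z)) z := by
    refine (hf.comp z hwd).congr_of_eventuallyEq ?_
    filter_upwards [hw.1.mem_nhds hz] with y hy
    exact (congrArg Prod.snd (ht.apply hy).2).symm
  have h5 := congrArg (fun A : Base →L[ℝ] Fibre => A ζ) (h3.unique h4)
  simpa only [ContinuousLinearMap.comp_apply, fderiv_base, fderiv_fibre] using h5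

/-- Similarities are point symmetries of the extended system. -/
lemma isPointSymmetry (s : Similarity) : IsPointSymmetry s.homeo.toOpenPartialHomeomorph where
  pointTransformation := s.isPointTransformation
  nondegenerate := ⟨univ, _, univ, _, univ_nonempty, isSolution_zero, s.transformsTo_zero⟩
  maps_solutions _ _ _ _ := s.maps_solutions

/-- The action of a similarity on the space of `(x, y)`. -/
noncomputable def plane (s : Similarity) (q : ℝ × ℝ) : ℝ × ℝ :=
  (s.base ![0, q.1, q.2] 1, s.base ![0, q.1, q.2] 2)

lemma plane_base (s : Similarity) (z : Base) : s.plane (z 1, z 2) = (s.base z 1, s.base z 2) := by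
  simp [plane, base]

lemma contDiff_plane (s : Similarity) : ContDiff ℝ ∞ s.plane := by
  unfold plane
  refine ContDiff.prodMk ?_ ?_ <;> simp [base] <;> fun_prop

/-- Similarities are equivalence transformations of the class of shallow water systems. -/
lemma isEquivalenceTransformation (s : Similarity) :
    IsEquivalenceTransformation s.homeo.toOpenPartialHomeomorph where
  pointTransformation := s.isPointTransformation
  nondegenerate := ⟨univ, fun _ => 0, univ, _, univ, _, isOpen_univ, contDiffOn_const,
    univ_nonempty, (isSolutionOver_iff isOpen_univ contDiffOn_const).2
      ⟨isSolution_zero, fun _ _ => mem_univ _, fun _ _ => rfl⟩, s.transformsTo_zero⟩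
  maps_systems D β hD hβ := by
    have hD' : IsOpen (s.inv.plane ⁻¹' D) := hD.preimage s.inv.contDiff_plane.continuous
    have hβ' : ContDiffOn ℝ ∞ (fun q => s.μ / s.τ ^ 2 * β (s.inv.plane q) + s.k 3)
        (s.inv.plane ⁻¹' D) :=
      (contDiffOn_const.mul (hβ.comp s.inv.contDiff_plane.contDiffOn fun _ h => h)).add
        contDiffOn_const
    refine ⟨_, _, hD', hβ', fun Ω w Ω' w' hw ht => ?_⟩
    rw [isSolutionOver_iff hD hβ] at hw
    refine (isSolutionOver_iff hD' hβ').2 ⟨s.maps_solutions hw.1 ht, fun z' hz' => ?_,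
      fun z' hz' => ?_⟩ <;>
    obtain ⟨z, hz, h⟩ := ht.exists_eq hz' <;>
    obtain rfl : z' = s.base z := congrArg Prod.fst h
    · rw [mem_preimage, plane_base, inv_mul_base]
      exact hw.2.1 z hz
    · rw [plane_base, inv_mul_base, ← hw.2.2 z hz]
      exact congrFun (congrArg Prod.snd h) 3

end Similarity

/-! ### From equivalence transformations to point symmetries. -/

/-- Equivalence transformations are point symmetries of the extended system. -/
theorem IsEquivalenceTransformation.isPointSymmetry {Φ : OpenPartialHomeomorph Total Total}
    (hΦ : IsEquivalenceTransformation Φ) : IsPointSymmetry Φ where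
  pointTransformation := hΦ.pointTransformation
  nondegenerate := by
    obtain ⟨D, β, Ω, w, Ω', w', hD, hβ, hne, hw, ht⟩ := hΦ.nondegenerate
    exact ⟨Ω, w, Ω', w', hne, ((isSolutionOver_iff hD hβ).1 hw).1, ht⟩
  maps_solutions Ω w Ω' w' hw ht := by
    refine isSolution_iff.2 ⟨ht.isOpen, ht.smooth, fun z' hz' => ?_⟩
    obtain ⟨z, hz, h⟩ := ht.exists_eq hz'
    obtain ⟨r, hr, hrΩ⟩ := Metric.isOpen_iff.1 hw.isOpen z hz
    -- In the sup metric the ball is a box: each `t`-line meets it in an interval containing `z 0`.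
    -- So `b`, being steady, is a function of `(x, y)` on it.
    set O := Metric.ball z r with hOdef
    have hO : IsOpen O := Metric.isOpen_ball
    set ι : ℝ → ℝ × ℝ → Base := fun t q => ![t, q.1, q.2] with hι
    have hιs (t : ℝ) : ContDiff ℝ ∞ (ι t) := by
      rw [contDiff_pi]
      intro i
      fin_cases i <;> simp [hι] <;> fun_prop
    have hmem {y : Base} : y ∈ O ↔ ∀ i, dist (y i) (z i) < r := by
      rw [hOdef, Metric.mem_ball, dist_pi_lt_iff hr]
    have hιO {y : Base} (hy : y ∈ O) : ι (z 0) (y 1, y 2) ∈ O := by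
      rw [hmem] at hy ⊢
      intro i
      fin_cases i
      · simpa [hι] using hr
      · exact hy 1
      · exact hy 2
    have hι' (y : Base) : ι (y 0) (y 1, y 2) = y := by
      ext i; fin_cases i <;> rfl
    set D : Set (ℝ × ℝ) := ι (z 0) ⁻¹' O with hDdef
    have hD : IsOpen D := hO.preimage (hιs _).continuous
    set β : ℝ × ℝ → ℝ := fun q => w (ι (z 0) q) 3 with hβdef
    have hw3 : ContDiffOn ℝ ∞ (fun y => w y 3) Ω := contDiffOn_pi.1 hw.smooth 3
    have hβ : ContDiffOn ℝ ∞ β D := hw3.comp (hιs _).contDiffOn fun q hq => hrΩ hq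
    have hbot (y : Base) (hy : y ∈ O) : w y 3 = β (y 1, y 2) := by
      set γ : ℝ → Base := fun t => ι t (y 1, y 2) with hγ
      set I : Set ℝ := Metric.ball (z 0) r
      have hγO (t : ℝ) (ht : t ∈ I) : γ t ∈ O := by
        rw [hmem] at hy ⊢
        intro i
        fin_cases i
        · exact ht
        · exact hy 1
        · exact hy 2
      have hγd (t : ℝ) : HasDerivAt γ (eb 0) t := by
        rw [hasDerivAt_pi]
        intro i
        fin_cases i
        · simpa [hγ, hι] using hasDerivAt_id' t
        · simpa [hγ, hι] using hasDerivAt_const t (y 1)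
        · simpa [hγ, hι] using hasDerivAt_const t (y 2)
      have hd (t : ℝ) (ht : t ∈ I) : HasDerivAt (fun t => w (γ t) 3) 0 t := by
        have hm := hrΩ (hγO t ht)
        have h1 := ((hw3.contDiffAt (hw.isOpen.mem_nhds hm)).differentiableAt
          (by simp)).hasFDerivAt.comp_hasDerivAt t (hγd t)
        have h2 : fderiv ℝ (fun y => w y 3) (γ t) (eb 0) = 0 := hw.steady _ hm
        rwa [h2] at h1
      have := Metric.isOpen_ball.is_const_of_deriv_eq_zero (convex_ball (z 0) r).isPreconnected
        (fun t ht => (hd t ht).differentiableAt.differentiableWithinAt)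
        (fun t ht => (hd t ht).deriv) (show y 0 ∈ I from hmem.1 hy 0)
        (show z 0 ∈ I from Metric.mem_ball_self hr)
      simpa only [hγ, hι'] using this
    obtain ⟨D', β', hD', hβ', hmap⟩ := hΦ.maps_systems D β hD hβ
    have hmemT {y : Base} (hy : y ∈ Ω') : (y, w' y) ∈ Φ.target := by
      obtain ⟨x, hx, he⟩ := ht.exists_eq hy
      rw [he]
      exact Φ.map_source (ht.graph_subset (mem_image_of_mem _ hx))
    have hc : ContinuousOn (fun y => (Φ.symm (y, w' y)).1) Ω' :=
      continuous_fst.comp_continuousOn (Φ.symm.continuousOn.comp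
        (continuousOn_id.prodMk ht.smooth.continuousOn) fun y hy => hmemT hy)
    -- The part of the new graph that comes from the box; the hypothesis on systems applies to this
    -- restriction.
    set Ω₀ := Ω' ∩ (fun y => (Φ.symm (y, w' y)).1) ⁻¹' O with hΩ₀
    have hΩ₀o : IsOpen Ω₀ := hc.isOpen_inter_preimage ht.isOpen hO
    have hsymm {x y : Base} (hx : x ∈ Ω) (he : (y, w' y) = Φ (x, w x)) :
        (Φ.symm (y, w' y)).1 = x := by
      rw [he, Φ.left_inv (ht.graph_subset (mem_image_of_mem _ hx))]
    have htO : TransformsTo Φ O w Ω₀ w' := by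
      refine ⟨(image_mono hrΩ).trans ht.graph_subset, hΩ₀o, ht.smooth.mono inter_subset_left, ?_⟩
      ext p
      constructor
      · rintro ⟨y, hy, rfl⟩
        obtain ⟨x, hx, he⟩ := ht.exists_eq hy.1
        have hyO := hy.2
        rw [mem_preimage, hsymm hx he] at hyO
        exact ⟨_, mem_image_of_mem _ hyO, he.symm⟩
      · rintro ⟨_, ⟨x, hx, rfl⟩, rfl⟩
        obtain ⟨h1, h2⟩ := ht.apply (hrΩ hx)
        refine ⟨_, ⟨h1, ?_⟩, h2.symm⟩
        rw [mem_preimage, hsymm (hrΩ hx) h2.symm]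
        exact hx
    have hsol := hmap O w Ω₀ w' ((isSolutionOver_iff hD hβ).2
      ⟨hw.mono hrΩ hO, fun y hy => hιO hy, hbot⟩) htO
    have hz₀ : z' ∈ Ω₀ := by
      refine ⟨hz', ?_⟩
      rw [mem_preimage, hsymm hz h]
      exact Metric.mem_ball_self hr
    exact (isSolution_iff.1 ((isSolutionOver_iff hD' hβ').1 hsol).1).2.2 z' hz₀

/-! ### The continuous part and the discrete list. -/

namespace Similarity

lemma τ_eq_of_homeo_eq {s r : Similarity} (h : s.homeo = r.homeo) : s.τ = r.τ := by
  have h1 (z : Base) : s.base z = r.base z :=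
    congrArg (fun H : Total ≃ₜ Total => (H (z, 0)).1) h
  have h2 := congrFun (h1 0) 0
  have h3 := congrFun (h1 (eb 0)) 0
  simp [base] at h2 h3
  linarith

lemma ε_eq_of_homeo_eq {s r : Similarity} (h : s.homeo = r.homeo) : s.ε = r.ε := by
  have h1 (z : Base) : s.base z = r.base z :=
    congrArg (fun H : Total ≃ₜ Total => (H (z, 0)).1) h
  have h0 := h1 0
  have hx := h1 (eb 1)
  have hy := h1 (eb 2)
  have x0 := congrFun h0 1
  have y0 := congrFun h0 2
  have xx := congrFun hx 1
  have yx := congrFun hx 2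
  have xy := congrFun hy 1
  have yy := congrFun hy 2
  simp [base] at x0 y0 xx yx xy yy
  have ha : s.a = r.a := by linarith
  have hb : s.b = r.b := by linarith
  have e1 : s.ε * s.b = r.ε * s.b := by rw [← hb] at xy; linarith
  have e2 : s.ε * s.a = r.ε * s.a := by rw [← ha] at yy; linarith
  refine mul_right_cancel₀ s.norm_ne ?_
  linear_combination s.a * e2 + s.b * e1

/-- The products of the time reversal and the reflection. -/
noncomputable def discrete (i j : Fin 2) : Similarity where
  τ := (-1) ^ (i : ℕ)
  a := 1
  b := 0
  ε := (-1) ^ (j : ℕ)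
  k := 0
  τ_ne := by simp
  norm_ne := by simp
  ε_sq := by rw [← mul_pow]; simp

lemma timeReversal_eq : timeReversal = (discrete 1 0).homeo := by
  ext1 p
  ext i
  · fin_cases i <;> simp [homeo_apply, timeReversal, base, discrete]
  · fin_cases i <;> simp [homeo_apply, timeReversal, fibre, discrete, μ, div_neg]

lemma reflection_eq : reflection = (discrete 0 1).homeo := by
  ext1 p
  ext i
  · fin_cases i <;> simp [homeo_apply, reflection, base, discrete]
  · fin_cases i <;> simp [homeo_apply, reflection, fibre, discrete, μ]

lemma homeo_discrete_zero : (discrete 0 0).homeo = 1 := by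
  ext1 p
  ext i
  · fin_cases i <;> simp [homeo_apply, base, discrete]
  · fin_cases i <;> simp [homeo_apply, fibre, discrete, μ]

lemma homeo_discrete (i j : Fin 2) :
    (discrete i j).homeo = timeReversal ^ (i : ℕ) * reflection ^ (j : ℕ) := by
  fin_cases i <;> fin_cases j
  · simpa using homeo_discrete_zero
  · simpa using reflection_eq.symm
  · simpa using timeReversal_eq.symm
  · have : discrete 1 1 = (discrete 1 0).mul (discrete 0 1) := by
      ext i <;> simp [discrete, mul]
      fin_cases i <;> simp
    simpa [this, homeo_mul, timeReversal_eq] using reflection_eq.symm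

/-- Shifts. -/
noncomputable def shift (k : Fin 4 → ℝ) : Similarity where
  τ := 1
  a := 1
  b := 0
  ε := 1
  k := k
  τ_ne := one_ne_zero
  norm_ne := by simp
  ε_sq := one_mul 1

/-- Compositions of scalings and rotations. -/
noncomputable def scaling (α β γ : ℝ) : Similarity where
  τ := Real.exp α
  a := Real.exp β * Real.cos γ
  b := Real.exp β * Real.sin γ
  ε := 1
  k := 0
  τ_ne := Real.exp_ne_zero α
  norm_ne := by
    have : Real.exp β * Real.cos γ * (Real.exp β * Real.cos γ) +
        Real.exp β * Real.sin γ * (Real.exp β * Real.sin γ) = Real.exp β ^ 2 := by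
      linear_combination Real.exp β ^ 2 * Real.cos_sq_add_sin_sq γ
    rw [this]
    exact pow_ne_zero 2 (Real.exp_ne_zero β)
  ε_sq := one_mul 1

lemma shift_add (k l : Fin 4 → ℝ) : shift (k + l) = (shift k).mul (shift l) := by
  ext i <;> simp [shift, mul, μ]
  fin_cases i <;> simp [add_comm]

lemma scaling_add (α β γ α' β' γ' : ℝ) :
    scaling (α + α') (β + β') (γ + γ') = (scaling α β γ).mul (scaling α' β' γ') := by
  ext i
  · simp [scaling, mul, Real.exp_add]
  · simp [scaling, mul, Real.exp_add, Real.cos_add]; ring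
  · simp [scaling, mul, Real.exp_add, Real.sin_add]; ring
  · simp [scaling, mul]
  · fin_cases i <;> simp [scaling, mul]

variable {S : OpenPartialHomeomorph Total Total → Prop}

lemma isOneParameterGroup_shift (hS : ∀ s : Similarity, S s.homeo.toOpenPartialHomeomorph)
    (k : Fin 4 → ℝ) : IsOneParameterGroup S fun s => (shift (s • k)).homeo where
  map_add s r := by rw [add_smul, shift_add, homeo_mul]
  smooth := by
    simp only [homeo_apply]
    refine ContDiff.prodMk ?_ ?_ <;> rw [contDiff_pi] <;> intro i <;> fin_cases i <;>
      simp [base, fibre, shift] <;> fun_prop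
  mem s := hS _

lemma isOneParameterGroup_scaling (hS : ∀ s : Similarity, S s.homeo.toOpenPartialHomeomorph)
    (α β γ : ℝ) : IsOneParameterGroup S fun s => (scaling (s * α) (s * β) (s * γ)).homeo where
  map_add s r := by rw [add_mul, add_mul, add_mul, scaling_add, homeo_mul]
  smooth := by
    simp only [homeo_apply]
    refine ContDiff.prodMk ?_ ?_ <;> rw [contDiff_pi] <;> intro i <;> fin_cases i <;>
      simp [base, fibre, scaling, div_eq_mul_inv, ← Real.exp_neg, ← inv_pow] <;> fun_prop
  mem s := hS _

/-- The polar form of `a + b i` and the logarithm of `τ` split such a similarity into a shift after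
a scaling with rotation, both time-one elements of one-parameter groups. -/
lemma mem_continuousPart (hS : ∀ s : Similarity, S s.homeo.toOpenPartialHomeomorph)
    (s : Similarity) (hτ : 0 < s.τ) (hε : s.ε = 1) : s.homeo ∈ continuousPart S := by
  set z : ℂ := ⟨s.a, s.b⟩ with hz
  have hz0 : z ≠ 0 := by
    intro h
    have h1 := s.norm_ne
    have h2 : s.a = 0 := congrArg Complex.re h
    have h3 : s.b = 0 := congrArg Complex.im h
    simp [h2, h3] at h1
  have hs : s = (shift s.k).mul (scaling (Real.log s.τ) (Real.log ‖z‖) z.arg) := by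
    have ha : ‖z‖ * Real.cos z.arg = s.a := Complex.norm_mul_cos_arg z
    have hb : ‖z‖ * Real.sin z.arg = s.b := Complex.norm_mul_sin_arg z
    have hn : 0 < ‖z‖ := norm_pos_iff.2 hz0
    ext i
    · simp [shift, scaling, mul, Real.exp_log hτ]
    · simp [shift, scaling, mul, Real.exp_log hn, ha]
    · simp [shift, scaling, mul, Real.exp_log hn, hb]
    · simp [shift, scaling, mul, hε]
    · fin_cases i <;> simp [shift, scaling, mul]
  rw [hs, homeo_mul]
  refine mul_mem (Subgroup.subset_closure ⟨_, 1, isOneParameterGroup_shift hS s.k, ?_⟩)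
    (Subgroup.subset_closure ⟨_, 1,
      isOneParameterGroup_scaling hS (Real.log s.τ) (Real.log ‖z‖) z.arg, ?_⟩)
  · rw [one_smul]
  · rw [one_mul, one_mul, one_mul]

/-- An element of a one-parameter group is the square of the element at half the parameter. That one
is a similarity, and squaring makes `τ` positive and `ε` equal to `1`. -/
lemma exists_of_mem_continuousPart (hS : ∀ Φ, S Φ → IsPointSymmetry Φ) {C : Total ≃ₜ Total}
    (hC : C ∈ continuousPart S) : ∃ s : Similarity, C = s.homeo ∧ 0 < s.τ ∧ s.ε = 1 := by
  induction hC using Subgroup.closure_induction with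
  | mem C h =>
    obtain ⟨Ψ, σ, hΨ, rfl⟩ := h
    obtain ⟨s, hs⟩ := (hS _ (hΨ.mem (σ / 2))).exists_similarity
    have h1 : Ψ (σ / 2) = s.homeo := by
      ext1 p
      exact hs (mem_univ p)
    refine ⟨s.mul s, ?_, mul_self_pos.2 s.τ_ne, s.ε_sq⟩
    rw [homeo_mul, ← h1, ← hΨ.map_add, add_halves]
  | one => exact ⟨discrete 0 0, homeo_discrete_zero.symm, by simp [discrete], by simp [discrete]⟩
  | mul C C' _ _ h h' =>
    obtain ⟨s, rfl, h1, h2⟩ := h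
    obtain ⟨r, rfl, h3, h4⟩ := h'
    exact ⟨s.mul r, (homeo_mul s r).symm, mul_pos h1 h3, by simp [mul, h2, h4]⟩
  | inv C _ h =>
    obtain ⟨s, rfl, h1, h2⟩ := h
    exact ⟨s.inv, s.homeo_inv.symm, inv_pos.2 h1, h2⟩

end Similarity

open Similarity in
/-- The discrete transformations in a collection of point symmetries that contains all
similarities. -/
theorem isCompleteDiscreteList {S : OpenPartialHomeomorph Total Total → Prop}
    (hS : ∀ s : Similarity, S s.homeo.toOpenPartialHomeomorph)
    (hS' : ∀ Φ, S Φ → IsPointSymmetry Φ) : IsCompleteDiscreteList S timeReversal reflection where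
  mem_left := timeReversal_eq ▸ hS _
  mem_right := reflection_eq ▸ hS _
  involution_left := by
    ext1 p
    exact timeReversal.left_inv p
  involution_right := by
    ext1 p
    exact reflection.left_inv p
  exhaustive Φ hΦ := by
    obtain ⟨s, hs⟩ := (hS' Φ hΦ).exists_similarity
    -- The signs are chosen so that `s.mul (discrete i j).inv` has positive `τ` and `ε = 1`; these
    -- two expressions are its parameters by definition.
    obtain ⟨i, hi⟩ : ∃ i : Fin 2, 0 < s.τ * ((-1) ^ (i : ℕ))⁻¹ := by
      rcases s.τ_ne.lt_or_gt with h | h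
      · exact ⟨1, by simpa using h⟩
      · exact ⟨0, by simpa using h⟩
    obtain ⟨j, hj⟩ : ∃ j : Fin 2, s.ε * (-1) ^ (j : ℕ) = 1 := by
      rcases mul_self_eq_one_iff.1 s.ε_sq with h | h
      · exact ⟨0, by simpa using h⟩
      · exact ⟨1, by simp [h]⟩
    refine ⟨_, mem_continuousPart hS (s.mul (discrete i j).inv) hi hj, i, j, ?_⟩
    rwa [mul_assoc, ← homeo_discrete, homeo_mul, homeo_inv, inv_mul_cancel_right]
  independent C hC i j U hU hne h := by
    obtain ⟨s, rfl, hτ, hε⟩ := exists_of_mem_continuousPart hS' hC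
    obtain ⟨p, hp⟩ := hne
    rw [← homeo_discrete] at h
    have heq := homeo_eq_of_eventuallyEq (h.eventuallyEq_of_mem (hU.mem_nhds hp))
    have h1 : (-1 : ℝ) ^ (i : ℕ) = s.τ := τ_eq_of_homeo_eq heq
    have h2 : (-1 : ℝ) ^ (j : ℕ) = s.ε := ε_eq_of_homeo_eq heq
    rw [← h1] at hτ
    rw [hε] at h2
    constructor
    · fin_cases i
      · rfl
      · norm_num at hτ
    · fin_cases j
      · rfl
      · norm_num at h2

end ShallowWater

theorem mainTheorem3 :
    ShallowWater.IsCompleteDiscreteList ShallowWater.IsPointSymmetry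
      ShallowWater.timeReversal ShallowWater.reflection ∧
    ShallowWater.IsCompleteDiscreteList ShallowWater.IsEquivalenceTransformation
      ShallowWater.timeReversal ShallowWater.reflection :=
  ⟨ShallowWater.isCompleteDiscreteList (fun s => s.isPointSymmetry) fun _ h => h,
    ShallowWater.isCompleteDiscreteList (fun s => s.isEquivalenceTransformation)
      fun _ h => h.isPointSymmetry⟩
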